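/- **Notation.** $\|\cdot\|$ is the Euclidean norm (for matrices: the induced spectral norm), $\|(x,u)\|=(\|x\|^2+\|u\|^2)^{1/2}$; $\|\cdot\|_1$ is the 1-norm of a vector and, for a matrix, the maximal 1-norm of a column; for a matrix $A$ let $|A|_+:=\max_k\sum_i\max\{A_{i,k},0\}$. $\mathcal K$ is the class of continuous strictly increasing $\alpha:[0,\infty)\to[0,\infty)$ with $\alpha(0)=0$; $\mathcal K_\infty$ those that are also unbounded; $\mathcal L_{\mathbb N}$ the nonincreasing $\delta:\mathbb N_0\to[0,\infty)$ with $\delta(k)\to0$; $\mathcal{KL}$ the continuous $\beta:[0,\infty)^2\to[0,\infty)$ with $\beta(\cdot,s)\in\mathcal K$ and $\beta(r,\cdot)$ nonincreasing with limit $0$; $\mathcal{KLS}$ those $\beta\in\mathcal{KL}$ for which $r\mapsto\sum_{k\ge0}\beta(r,k)$ is finite and of class $\mathcal K$. **Setting.** Let $T\ge2$, $\mathbb X\subseteq\mathbb R^n$, $\mathbb U\subseteq\mathbb R^m$, $\mathbb Z\subseteq\mathbb X\times\mathbb U$, $f:\mathbb Z\to\mathbb X$, $\ell:\mathbb Z\to\mathbb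 R$, $h:\mathbb Z\to\mathbb R^p$. For an input sequence $u$, $x_u(\cdot,x)$ is the solution of $x(k+1)=f(x(k),u(k))$, $x(0)=x$. $\mathbb H$ is the set of $H=[H_1,\dots,H_{T-1}]\in\mathbb R^{p\times(T-1)}$ all of whose columns lie between the componentwise infimum and supremum of $h$ over $\mathbb Z$ ($H$ stores the last $T-1$ values of $h$). For $(x,H)\in\mathbb X\times\mathbb H$ let $\mathbb U^N(x,H)$ be the set of $u=(u(0),\dots,u(N-1))$ such that $(x_u(k,x),u(k))\in\mathbb Z$ for $0\le k\le N-1$, $\sum_{i=j}^{T-1}H_i+\sum_{k=0}^{j-1}h(x_u(k,x),u(k))\le0$ for $1\le j\le\min\{T-1,N\}$, and $\sum_{k=i}^{i+T-1}h(x_u(k,x),u(k))\le0$ for $0\le i\le N-T$. Put $J_N(x,u)=\sum_{k=0}^{N-1}\ell(x_u(k,x),u(k))$. Let $(x_s,u_s)$ minimize $\ell$ over $\{(x,u)\in\mathbb Z: x=f(x,u),\ h(x,u)\le0\}$, and let $\ell_s=\ell(x_s,u_s)$, $h_s=h(x_s,u_s)$, $H^s=[h_s,\dots,h_s]$. With $\lambda,\bar\lambda$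 from Assumption 2 put $\tilde\ell(x,u)=\ell(x,u)-\ell_s+\lambda(x)-\lambda(f(x,u))+\bar\lambda^\top h(x,u)$, $\tilde J_N(x,u)=J_N(x,u)-N\ell_s+\lambda(x)-\lambda(x_u(N,x))+\sum_{k=0}^{N-1}\bar\lambda^\top h(x_u(k,x),u(k))$ and $\tilde J^*_N(x,H)=\inf_{u\in\mathbb U^N(x,H)}\tilde J_N(x,u)$. It is assumed that for all $N$ and all $(x,H)\in\mathbb X\times\mathbb H$ there are minimizers $u^*_{N,x,H}$ of $J_N(x,\cdot)$ and $\tilde u^*_{N,x,H}$ of $\tilde J_N(x,\cdot)$ over $\mathbb U^N(x,H)$ (one of each is fixed). The closed loop with horizon $N$ applies $\mu_N(x,H)=u^*_{N,x,H}(0)$: $x^+=f(x,\mu_N(x,H))$, $H^+=[H_2,\dots,H_{T-1},h(x,\mu_N(x,H))]$; its state after $k$ steps from $(x,H)$ is $(x_{\mu_N}(k,x,H),H^{\mathrm{cl}}(k,x,H))$. **Assumptions.** 1. $\mathbb Z$ is compact; there are $\alpha_f,\alpha_l\in\mathcal K_\infty$ with $\|f(x_1,u_1)-f(x_2,u_2)\|\le\alpha_f(\|(x_1-x_2,u_1-u_2)\|)$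 and $|\ell(x_1,u_1)-\ell(x_2,u_2)|\le\alpha_l(\|(x_1-x_2,u_1-u_2)\|)$ on $\mathbb Z$; $h$ is Lipschitz on $\mathbb Z$ with constant $L_h>0$ with respect to the 1-norms. 2. There are a bounded $\lambda:\mathbb X\to\mathbb R$ with $\lambda(x_s)=0$ and $|\lambda(x_1)-\lambda(x_2)|\le\alpha_\lambda(\|x_1-x_2\|)$ for some $\alpha_\lambda\in\mathcal K_\infty$, a vector $\bar\lambda\in\mathbb R^p_{\ge0}$ and $\rho\in\mathcal K_\infty$ such that $\lambda(f(x,u))-\lambda(x)\le\ell(x,u)-\ell_s+\bar\lambda^\top h(x,u)-\rho(\|(x-x_s,u-u_s)\|)$ on $\mathbb Z$. 3. There are $\beta_1,\beta_2\in\mathcal{KLS}$ such that for all $(x,H)\in\mathbb X\times\mathbb H$ and $N\in\mathbb N$ some $u\in\mathbb U^N(x,H)$ satisfies, for $0\le k\le N-1$, that both $\ell(x_u(k,x),u(k))-\ell_s$ and $\tilde\ell(x_u(k,x),u(k))$ are at most $\beta_1(\|x-x_s\|,k)+\beta_2(|H-H^s|_+,k)$. 4. There are $\delta_c,E_h>0$,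 an integer $d\ge T$ and $\gamma_x,\gamma_u\in\mathcal K_\infty$ such that the following holds. For $u\in\mathbb U^{N}(x,H)$ with $N\ge d+T$ write $H_u:=[h(x_u(d,x),u(d)),\dots,h(x_u(d+T-2,x),u(d+T-2))]$. Let $(x_c,H^c)\in\mathbb X\times\mathbb H$, $|H^c|_+\le E_h$, $u_c\in\mathbb U^{d+T}(x_c,H^c)$ with $\|x_{u_c}(k,x_c)-x_s\|\le\delta_c$ for $0\le k\le d+T$; let $N_1\ge d+T$, $(x_1,H^1)\in\mathbb X\times\mathbb H$, $u_1\in\mathbb U^{N_1}(x_1,H^1)$, $x_3:=x_{u_1}(d,x_1)$ with $\|x_3-x_s\|\le\delta_c$ and $|H_{u_1}-H_{u_c}|_+\le E_h$; and let $(x_2,H^2)\in\mathbb X\times\mathbb H$ with $\|x_2-x_s\|\le\delta_c$, $|H^2-H^c|_+\le E_h$. Then there is $u_2\in\mathbb U^d(x_2,H^2)$ with $x_{u_2}(d,x_2)=x_3$ such that the sequence equal to $u_2$ on $[0,d-1]$ and to $u_1$ on $[d,N_1-1]$ lies in $\mathbb U^{N_1}(x_2,H^2)$, $\|x_{u_2}(k,x_2)-x_{u_c}(k,x_c)\|\le\gamma_x(\zeta)$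 for $0\le k\le d$ and $\|u_2(k)-u_c(k)\|\le\gamma_u(\zeta)$ for $0\le k\le d-1$, where $\zeta=\max\{\|x_2-x_c\|+|H^2-H^c|_+,\ \|x_3-x_{u_c}(d,x_c)\|+|H_{u_1}-H_{u_c}|_+\}$. 5. There is $\bar\psi\in\mathcal K_\infty$ such that, with $\psi(x,H)=\bar\psi(\|x-x_s\|_1+\|H-H^s\|_1)$, $-\bar\lambda^\top\sum_{i=0}^{k}h(x_{\tilde u^*}(i,x),\tilde u^*(i))\le\psi(x,H)$ for $\tilde u^*=\tilde u^*_{N,x,H}$, all $N$, all $T-1\le k\le N-1$ and all $(x,H)\in\mathbb X\times\mathbb H$. 6. There are $a,\omega>0$ with $\rho(r)\ge a r^\omega$ for $0\le r\le\max_{(x,u)\in\mathbb Z}\|(x-x_s,u-u_s)\|$ and $$\psi(x,H)<\tfrac12a(n+m)^{-\omega/2}\Big(\|x-x_s\|_1^\omega+\frac{\|H-H^s\|_1^\omega}{L_h^\omega(T-1)}\Big)$$ for all $(x,H)\in\mathbb X\times\mathbb H$ with $(x,H)\ne(x_s,H^s)$. **Theorem.** Under these assumptions there are $N_6\in\mathbb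 N$, $c>0$, $\alpha_1,\alpha_2,\alpha_3\in\mathcal K_\infty$ and $\delta_1,\delta_2\in\mathcal L_{\mathbb N}$ such that, with $\xi=\|x-x_s\|+\|H-H^s\|_1$, $$\hat W(x,H)=\tilde J^*_N(x,H)+c\sum_{i=1}^{T-1}i\,\|H_i-h_s\|_1^\omega,\qquad W(x,H)=\sum_{j=0}^{T-1}\hat W\big(x_{\mu_N}(j,x,H),H^{\mathrm{cl}}(j,x,H)\big)$$ satisfy, for all $N\ge N_6+1$ and all $(x,H)\in\mathbb X\times\mathbb H$, $$\alpha_1(\xi)\le W(x,H)\le\alpha_2(\xi)+\delta_1(N-N_6),$$ $$W\big(x_{\mu_N}(1,x,H),H^{\mathrm{cl}}(1,x,H)\big)\le W(x,H)-\alpha_3(\xi)+\delta_2(N-N_6).$$ Moreover $(x_s,H^s)$ is practically asymptotically stable on $\mathbb X\times\mathbb H$ with respect to some $\varepsilon(N)\ge0$ with $\varepsilon(N)\to0$ as $N\to\infty$: $(x_s,H^s)\in\mathbb X\times\mathbb H$ and there is $\beta\in\mathcal{KL}$ such that for all $N\ge N_6+1$, $(x,H)\in\mathbb X\times\mathbb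 H$ and $k\in\mathbb N_0$, $$\|x_{\mu_N}(k,x,H)-x_s\|+\|H^{\mathrm{cl}}(k,x,H)-H^s\|\le\max\{\beta(\|x-x_s\|+\|H-H^s\|,k),\ \varepsilon(N)\}.$$ -/

import Mathlib

open Set Filter Topology

/-! ### Comparison functions

Functions on `[0, ∞)` are represented by functions on `ℝ` of which only the values on `[0, ∞)`
matter. -/

/-- Class `K` on `[0, ∞)`: continuous, strictly increasing, zero at zero. -/
structure ClassK (α : ℝ → ℝ) : Prop where
  cont : ContinuousOn α (Ici 0)
  strictMono : StrictMonoOn α (Ici 0)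
  zero : α 0 = 0

/-- Class `K_∞`: class `K` and unbounded. -/
structure ClassKInf (α : ℝ → ℝ) : Prop extends ClassK α where
  unbounded : Tendsto α atTop atTop

/-- Class `L_ℕ`: nonincreasing nonnegative sequences tending to zero. -/
structure ClassLN (δ : ℕ → ℝ) : Prop where
  nonneg : ∀ k, 0 ≤ δ k
  anti : Antitone δ
  lim : Tendsto δ atTop (𝓝 0)

/-- Class `KL` on `[0, ∞) × [0, ∞)`. -/
structure ClassKL (β : ℝ → ℝ → ℝ) : Prop where
  cont : ContinuousOn (Function.uncurry β) (Ici 0 ×ˢ Ici 0)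
  classK : ∀ s, 0 ≤ s → ClassK (fun r => β r s)
  anti : ∀ r, 0 ≤ r → AntitoneOn (β r) (Ici 0)
  lim : ∀ r, 0 ≤ r → Tendsto (β r) atTop (𝓝 0)

/-- Class `KLS`: class `KL`, summable along the integers, with sum of class `K`. -/
structure ClassKLS (β : ℝ → ℝ → ℝ) : Prop extends ClassKL β where
  summable : ∀ r, 0 ≤ r → Summable (fun k : ℕ => β r k)
  classK_sum : ClassK (fun r => ∑' k : ℕ, β r k)

noncomputable section

/-! ### Norms -/

/-- The `1`-norm of a vector. -/
def vecNorm1 {q : ℕ} (v : Fin q → ℝ) : ℝ := ∑ i, |v i|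

/-- The Euclidean norm of the stacked vector `(x, u)`. -/
def pairNorm {n m : ℕ} (x : EuclideanSpace ℝ (Fin n)) (u : EuclideanSpace ℝ (Fin m)) : ℝ :=
  Real.sqrt (‖x‖ ^ 2 + ‖u‖ ^ 2)

/-- The matrix norm induced by the `1`-norm: the maximal `1`-norm of a column. -/
def matNorm1 {p q : ℕ} (A : Matrix (Fin p) (Fin q) ℝ) : ℝ := ⨆ j, ∑ i, |A i j|

/-- The sign-sensitive replacement of a norm: the maximum over the columns of the sum of the
positive parts of the entries. -/
def matPos {p q : ℕ} (A : Matrix (Fin p) (Fin q) ℝ) : ℝ := ⨆ j, ∑ i, max (A i j) 0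

open scoped Matrix.Norms.L2Operator in
/-- The matrix norm induced by the Euclidean norms. -/
def matNorm2 {p q : ℕ} (A : Matrix (Fin p) (Fin q) ℝ) : ℝ := ‖A‖

/-! ### The control system -/

/-- The data of a constrained control problem with stage cost `ell` and auxiliary output `h`, the
averages of which over `T` consecutive time instants are constrained. Outside `Z` the values of
`f`, `ell` and `h` are irrelevant. -/
structure ControlProblem (n m p T : ℕ) where
  /-- state constraint set -/
  X : Set (EuclideanSpace ℝ (Fin n))
  /-- input constraint set -/
  U : Set (EuclideanSpace ℝ (Fin m))
  /-- coupled state and input constraint set -/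
  Z : Set (EuclideanSpace ℝ (Fin n) × EuclideanSpace ℝ (Fin m))
  /-- dynamics -/
  f : EuclideanSpace ℝ (Fin n) → EuclideanSpace ℝ (Fin m) → EuclideanSpace ℝ (Fin n)
  /-- stage cost -/
  ell : EuclideanSpace ℝ (Fin n) → EuclideanSpace ℝ (Fin m) → ℝ
  /-- auxiliary output -/
  h : EuclideanSpace ℝ (Fin n) → EuclideanSpace ℝ (Fin m) → Fin p → ℝ

/-- The storage of the last `T - 1` auxiliary outputs; column `j : Fin (T - 1)` is the column with
number `j + 1` in one-based counting, and the last column is the most recent one. -/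
abbrev Storage (p T : ℕ) : Type := Matrix (Fin p) (Fin (T - 1)) ℝ

namespace ControlProblem

variable {n m p T : ℕ} (S : ControlProblem n m p T)

/-- The set of feasible storages: every column lies between the componentwise infimum and supremum
of `h` on `Z`. -/
def storages : Set (Storage p T) :=
  {H | ∀ i j, sInf ((fun z => S.h z.1 z.2 i) '' S.Z) ≤ H i j ∧
    H i j ≤ sSup ((fun z => S.h z.1 z.2 i) '' S.Z)}

/-- The solution with initial value `x` under the input sequence `u`. -/
def traj (x : EuclideanSpace ℝ (Fin n)) (u : ℕ → EuclideanSpace ℝ (Fin m)) :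
    ℕ → EuclideanSpace ℝ (Fin n)
  | 0 => x
  | k + 1 => S.f (traj x u k) (u k)

/-- The auxiliary output at time `k` along the solution. -/
def out (x : EuclideanSpace ℝ (Fin n)) (u : ℕ → EuclideanSpace ℝ (Fin m)) (k : ℕ) : Fin p → ℝ :=
  S.h (S.traj x u k) (u k)

/-- The storage consisting of the auxiliary outputs at the times `k, …, k + T - 2`, i.e. the
storage at time `k + T - 1`. -/
def window (x : EuclideanSpace ℝ (Fin n)) (u : ℕ → EuclideanSpace ℝ (Fin m)) (k : ℕ) :
    Storage p T :=
  fun i j => S.out x u (k + j) i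

/-- Admissible input sequences with horizon `N` for the extended state `(x, H)`. Only the first `N`
entries of a sequence are relevant. -/
structure Admissible (N : ℕ) (x : EuclideanSpace ℝ (Fin n)) (H : Storage p T)
    (u : ℕ → EuclideanSpace ℝ (Fin m)) : Prop where
  mem : ∀ k < N, (S.traj x u k, u k) ∈ S.Z
  past : ∀ j, 1 ≤ j → j ≤ T - 1 → j ≤ N → ∀ i,
    (∑ l : Fin (T - 1), if j ≤ (l : ℕ) + 1 then H i l else 0)
      + ∑ k ∈ Finset.range j, S.out x u k i ≤ 0
  future : ∀ s, s + T ≤ N → ∀ i, ∑ k ∈ Finset.range T, S.out x u (s + k) i ≤ 0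

/-- Open-loop cost. -/
def cost (N : ℕ) (x : EuclideanSpace ℝ (Fin n)) (u : ℕ → EuclideanSpace ℝ (Fin m)) : ℝ :=
  ∑ k ∈ Finset.range N, S.ell (S.traj x u k) (u k)

/-- `(xs, us)` is an optimal steady state: a minimizer of the stage cost among the steady states in
`Z` with nonpositive auxiliary output. -/
structure IsOptimalSteadyState (xs : EuclideanSpace ℝ (Fin n)) (us : EuclideanSpace ℝ (Fin m)) :
    Prop where
  mem : (xs, us) ∈ S.Z
  steady : S.f xs us = xs
  out_nonpos : ∀ i, S.h xs us i ≤ 0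
  optimal : ∀ x u, (x, u) ∈ S.Z → S.f x u = x → (∀ i, S.h x u i ≤ 0) → S.ell xs us ≤ S.ell x u

/-- The storage all of whose columns are the steady-state output. -/
def steadyStorage (xs : EuclideanSpace ℝ (Fin n)) (us : EuclideanSpace ℝ (Fin m)) : Storage p T :=
  fun i _ => S.h xs us i

/-- The rotated stage cost. -/
def rotStage (xs : EuclideanSpace ℝ (Fin n)) (us : EuclideanSpace ℝ (Fin m))
    (lam : EuclideanSpace ℝ (Fin n) → ℝ) (lbar : Fin p → ℝ)
    (x : EuclideanSpace ℝ (Fin n)) (u : EuclideanSpace ℝ (Fin m)) : ℝ :=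
  S.ell x u - S.ell xs us + lam x - lam (S.f x u) + lbar ⬝ᵥ S.h x u

/-- The rotated cost functional. -/
def rotCost (xs : EuclideanSpace ℝ (Fin n)) (us : EuclideanSpace ℝ (Fin m))
    (lam : EuclideanSpace ℝ (Fin n) → ℝ) (lbar : Fin p → ℝ) (N : ℕ)
    (x : EuclideanSpace ℝ (Fin n)) (u : ℕ → EuclideanSpace ℝ (Fin m)) : ℝ :=
  S.cost N x u - N * S.ell xs us + lam x - lam (S.traj x u N)
    + ∑ k ∈ Finset.range N, lbar ⬝ᵥ S.out x u k

/-- The rotated value function. -/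
def rotValue (xs : EuclideanSpace ℝ (Fin n)) (us : EuclideanSpace ℝ (Fin m))
    (lam : EuclideanSpace ℝ (Fin n) → ℝ) (lbar : Fin p → ℝ) (N : ℕ)
    (x : EuclideanSpace ℝ (Fin n)) (H : Storage p T) : ℝ :=
  sInf (S.rotCost xs us lam lbar N x '' {u | S.Admissible N x H u})

/-- `u` minimizes the functional `J` over the admissible sequences. -/
def IsMinimizer (J : (ℕ → EuclideanSpace ℝ (Fin m)) → ℝ) (N : ℕ)
    (x : EuclideanSpace ℝ (Fin n)) (H : Storage p T) (u : ℕ → EuclideanSpace ℝ (Fin m)) : Prop :=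
  S.Admissible N x H u ∧ ∀ v, S.Admissible N x H v → J u ≤ J v

/-! ### Assumptions -/

/-- Compactness of the constraints, uniform continuity of the dynamics and of the stage cost, and
Lipschitz continuity of the auxiliary output (constant `L` with respect to `1`-norms). -/
structure Regular (L : ℝ) : Prop where
  subset : S.Z ⊆ S.X ×ˢ S.U
  compact : IsCompact S.Z
  mapsTo : ∀ x u, (x, u) ∈ S.Z → S.f x u ∈ S.X
  cont_f : ∃ α, ClassKInf α ∧ ∀ x₁ u₁ x₂ u₂, (x₁, u₁) ∈ S.Z → (x₂, u₂) ∈ S.Z →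
    ‖S.f x₁ u₁ - S.f x₂ u₂‖ ≤ α (pairNorm (x₁ - x₂) (u₁ - u₂))
  cont_ell : ∃ α, ClassKInf α ∧ ∀ x₁ u₁ x₂ u₂, (x₁, u₁) ∈ S.Z → (x₂, u₂) ∈ S.Z →
    |S.ell x₁ u₁ - S.ell x₂ u₂| ≤ α (pairNorm (x₁ - x₂) (u₁ - u₂))
  L_pos : 0 < L
  lipschitz_h : ∀ x₁ u₁ x₂ u₂, (x₁, u₁) ∈ S.Z → (x₂, u₂) ∈ S.Z →
    vecNorm1 (S.h x₁ u₁ - S.h x₂ u₂)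
      ≤ L * (vecNorm1 (x₁ - x₂).ofLp + vecNorm1 (u₁ - u₂).ofLp)

/-- Strict dissipativity with storage function `lam`, multiplier `lbar` and `rho ∈ K_∞`. -/
structure StrictlyDissipative (xs : EuclideanSpace ℝ (Fin n)) (us : EuclideanSpace ℝ (Fin m))
    (lam : EuclideanSpace ℝ (Fin n) → ℝ) (lbar : Fin p → ℝ) (rho : ℝ → ℝ) : Prop where
  bounded : ∃ C, ∀ x ∈ S.X, |lam x| ≤ C
  multiplier_nonneg : ∀ i, 0 ≤ lbar i
  rho_class : ClassKInf rho
  dissip : ∀ x u, (x, u) ∈ S.Z →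
    lam (S.f x u) - lam x
      ≤ S.ell x u - S.ell xs us + lbar ⬝ᵥ S.h x u - rho (pairNorm (x - xs) (u - us))
  cont : ∃ α, ClassKInf α ∧ ∀ x₁ ∈ S.X, ∀ x₂ ∈ S.X, |lam x₁ - lam x₂| ≤ α ‖x₁ - x₂‖
  zero : lam xs = 0

/-- Asymptotic controllability with respect to the stage cost and the rotated stage cost. -/
def AsymptoticallyControllable (xs : EuclideanSpace ℝ (Fin n)) (us : EuclideanSpace ℝ (Fin m))
    (lam : EuclideanSpace ℝ (Fin n) → ℝ) (lbar : Fin p → ℝ) : Prop :=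
  ∃ β₁ β₂, ClassKLS β₁ ∧ ClassKLS β₂ ∧
    ∀ x ∈ S.X, ∀ H ∈ S.storages, ∀ N : ℕ, ∃ u, S.Admissible N x H u ∧ ∀ k < N,
      S.ell (S.traj x u k) (u k) - S.ell xs us
          ≤ β₁ ‖x - xs‖ k + β₂ (matPos (H - S.steadyStorage xs us)) k ∧
      S.rotStage xs us lam lbar (S.traj x u k) (u k)
          ≤ β₁ ‖x - xs‖ k + β₂ (matPos (H - S.steadyStorage xs us)) k

/-- Local controllability around the steady state: from `(x₂, H₂)` one can join in `d` steps any
admissible trajectory `u₁` which at time `d` is at `x₃`, staying close to a given reference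
trajectory `uc`. -/
def LocallyControllable (xs : EuclideanSpace ℝ (Fin n)) : Prop :=
  ∃ δc > 0, ∃ Eh > 0, ∃ d ≥ T, ∃ γx γu, ClassKInf γx ∧ ClassKInf γu ∧
    ∀ xc ∈ S.X, ∀ Hc ∈ S.storages, ∀ uc, S.Admissible (d + T) xc Hc uc →
      matPos Hc ≤ Eh → (∀ k ≤ d + T, ‖S.traj xc uc k - xs‖ ≤ δc) →
    ∀ N₁ ≥ d + T, ∀ x₁ ∈ S.X, ∀ H₁ ∈ S.storages, ∀ u₁, S.Admissible N₁ x₁ H₁ u₁ →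
      matPos (S.window x₁ u₁ d - S.window xc uc d) ≤ Eh → ‖S.traj x₁ u₁ d - xs‖ ≤ δc →
    ∀ x₂ ∈ S.X, ‖x₂ - xs‖ ≤ δc → ∀ H₂ ∈ S.storages, matPos (H₂ - Hc) ≤ Eh →
      ∃ u₂, S.Admissible d x₂ H₂ u₂ ∧ S.traj x₂ u₂ d = S.traj x₁ u₁ d ∧
        S.Admissible N₁ x₂ H₂ (fun k => if k < d then u₂ k else u₁ k) ∧
        (∀ k ≤ d, ‖S.traj x₂ u₂ k - S.traj xc uc k‖ ≤ γx
          (max (‖x₂ - xc‖ + matPos (H₂ - Hc))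
            (‖S.traj x₁ u₁ d - S.traj xc uc d‖
              + matPos (S.window x₁ u₁ d - S.window xc uc d)))) ∧
        (∀ k < d, ‖u₂ k - uc k‖ ≤ γu
          (max (‖x₂ - xc‖ + matPos (H₂ - Hc))
            (‖S.traj x₁ u₁ d - S.traj xc uc d‖
              + matPos (S.window x₁ u₁ d - S.window xc uc d))))

/-- The bound `ψ(x, H)` obtained from a comparison function `psi`. -/
def psiBound (xs : EuclideanSpace ℝ (Fin n)) (us : EuclideanSpace ℝ (Fin m)) (psi : ℝ → ℝ)
    (x : EuclideanSpace ℝ (Fin n)) (H : Storage p T) : ℝ :=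
  psi (vecNorm1 (x - xs).ofLp + matNorm1 (H - S.steadyStorage xs us))

/-- Bound on the accumulated weighted auxiliary outputs along the minimizers `utilde N x H` of the
rotated problem. -/
structure OutputBound (xs : EuclideanSpace ℝ (Fin n)) (us : EuclideanSpace ℝ (Fin m))
    (lbar : Fin p → ℝ)
    (utilde : ℕ → EuclideanSpace ℝ (Fin n) → Storage p T → ℕ → EuclideanSpace ℝ (Fin m))
    (psi : ℝ → ℝ) : Prop where
  psi_class : ClassKInf psi
  bound : ∀ k, T - 1 ≤ k → ∀ N, k < N → ∀ x ∈ S.X, ∀ H ∈ S.storages,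
    -(∑ i ∈ Finset.range (k + 1), lbar ⬝ᵥ S.out x (utilde N x H) i) ≤ S.psiBound xs us psi x H

/-- Polynomial lower bound on `rho` and the matching upper bound on `ψ`. -/
structure PolynomialBounds (xs : EuclideanSpace ℝ (Fin n)) (us : EuclideanSpace ℝ (Fin m))
    (L : ℝ) (rho psi : ℝ → ℝ) (a ω : ℝ) : Prop where
  a_pos : 0 < a
  ω_pos : 0 < ω
  rho_lower : ∀ r, 0 ≤ r → r ≤ sSup ((fun z => pairNorm (z.1 - xs) (z.2 - us)) '' S.Z) →
    a * r ^ ω ≤ rho r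
  psi_upper : ∀ x ∈ S.X, ∀ H ∈ S.storages, (x, H) ≠ (xs, S.steadyStorage xs us) →
    S.psiBound xs us psi x H < 1 / 2 * a * ((n : ℝ) + m) ^ (-ω / 2) *
      (vecNorm1 (x - xs).ofLp ^ ω
        + matNorm1 (H - S.steadyStorage xs us) ^ ω / (L ^ ω * ((T : ℝ) - 1)))

/-! ### The closed loop -/

/-- Drop the first column of the storage and append the column `y`. -/
def shift (H : Storage p T) (y : Fin p → ℝ) : Storage p T :=
  fun i j => if hj : (j : ℕ) + 1 < T - 1 then H i ⟨j + 1, hj⟩ else y i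

/-- One step of the closed loop with horizon `N`, where the first element of the minimizer
`ustar N x H` is applied. -/
def clStep (ustar : ℕ → EuclideanSpace ℝ (Fin n) → Storage p T → ℕ → EuclideanSpace ℝ (Fin m))
    (N : ℕ) (χ : EuclideanSpace ℝ (Fin n) × Storage p T) :
    EuclideanSpace ℝ (Fin n) × Storage p T :=
  (S.f χ.1 (ustar N χ.1 χ.2 0), shift χ.2 (S.h χ.1 (ustar N χ.1 χ.2 0)))

/-- The extended state of the closed loop after `k` steps. -/
def closedLoop (ustar : ℕ → EuclideanSpace ℝ (Fin n) → Storage p T → ℕ → EuclideanSpace ℝ (Fin m))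
    (N k : ℕ) (χ : EuclideanSpace ℝ (Fin n) × Storage p T) :
    EuclideanSpace ℝ (Fin n) × Storage p T :=
  (S.clStep ustar N)^[k] χ

/-- The rotated value function plus `c * ∑ i * ‖H_i - h_s‖₁ ^ ω`. -/
def What (xs : EuclideanSpace ℝ (Fin n)) (us : EuclideanSpace ℝ (Fin m))
    (lam : EuclideanSpace ℝ (Fin n) → ℝ) (lbar : Fin p → ℝ) (ω c : ℝ) (N : ℕ)
    (χ : EuclideanSpace ℝ (Fin n) × Storage p T) : ℝ :=
  S.rotValue xs us lam lbar N χ.1 χ.2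
    + c * ∑ j : Fin (T - 1), ((j : ℝ) + 1) * vecNorm1 (fun i => χ.2 i j - S.h xs us i) ^ ω

/-- The sum of `What` over the closed-loop states at the times `0, …, T - 1`. -/
def Wfun (xs : EuclideanSpace ℝ (Fin n)) (us : EuclideanSpace ℝ (Fin m))
    (lam : EuclideanSpace ℝ (Fin n) → ℝ) (lbar : Fin p → ℝ) (ω c : ℝ)
    (ustar : ℕ → EuclideanSpace ℝ (Fin n) → Storage p T → ℕ → EuclideanSpace ℝ (Fin m))
    (N : ℕ) (χ : EuclideanSpace ℝ (Fin n) × Storage p T) : ℝ :=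
  ∑ j ∈ Finset.range T, S.What xs us lam lbar ω c N (S.closedLoop ustar N j χ)

/-- Practical asymptotic stability of `(xs, H^s)` for the closed loop with horizon `N`, on the set
`A` of extended states, with respect to `ε` and with the function `β` of class `KL`. -/
structure PracticallyStable (xs : EuclideanSpace ℝ (Fin n)) (us : EuclideanSpace ℝ (Fin m))
    (ustar : ℕ → EuclideanSpace ℝ (Fin n) → Storage p T → ℕ → EuclideanSpace ℝ (Fin m))
    (N : ℕ) (A : Set (EuclideanSpace ℝ (Fin n) × Storage p T)) (β : ℝ → ℝ → ℝ) (ε : ℝ) :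
    Prop where
  mem : (xs, S.steadyStorage xs us) ∈ A
  ε_nonneg : 0 ≤ ε
  classKL : ClassKL β
  bound : ∀ χ ∈ A, ∀ k : ℕ,
    ‖(S.closedLoop ustar N k χ).1 - xs‖
        + matNorm2 ((S.closedLoop ustar N k χ).2 - S.steadyStorage xs us)
      ≤ max (β (‖χ.1 - xs‖ + matNorm2 (χ.2 - S.steadyStorage xs us)) k) ε

end ControlProblem

end

/-! ### Constructions of comparison functions -/

/-! Strict dissipativity bounds every rotated stage cost below by `rho` of the distance to the
steady state, so the rotated value function is a natural Lyapunov candidate. The closed loop,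
however, minimizes the original cost. The two functionals differ by a constant, by storage terms at
both ends and by a multiplier-weighted sum of outputs, and the average constraints give this sum a
sign only over multiples of `T` steps. Decrease is therefore sought over `T` steps. Summing `What`
over `T` consecutive closed-loop states turns a `T`-step decrease of `What` into a one-step decrease
of `Wfun`.

For the comparison, optimal solutions have uniformly bounded accumulated `rho`. On a long horizon a
pigeonhole argument yields a time `P = q * T` around which the optimal solutions from the first `T +
1` closed-loop states and the rotated minimizer are all close to the steady state
(`exists_turnpike`). There, local controllability splices one solution onto another at little cost,
so up to time `P` an optimal input is nearly as cheap as any input that also arrives near the steady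
state (`exists_cost_le`). This is iterated along the closed loop and started from a comparison with
the rotated minimizer. Returning to rotated costs, the storage terms at the end are small, the
closed-loop outputs contribute with a favourable sign, and the outputs of the rotated minimizer cost
at most `ψ` (`exists_rotValue_decrease`).

The excess `ψ` depends on the stored outputs as well, on which the rotated cost gives no direct
lower bound; the penalty repairs this. After `T` steps all stored outputs are new, and their penalty
is paid by half of the lower bound on the rotated cost through the Lipschitz bound on `h`. The old
penalty is gained, and the other half gives a term in the initial state. By the polynomial bounds
the net decrease `decay` is positive away from the steady state (`decay_pos`,
`exists_What_decrease`). Compactness converts such qualitative facts into comparison functions, and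
a practical Lyapunov argument gives stability (`exists_lyapunov`, `exists_practicallyStable`). -/

theorem ClassK.nonneg {α : ℝ → ℝ} (h : ClassK α) {r : ℝ} (hr : 0 ≤ r) : 0 ≤ α r := by
  rw [← h.zero]
  exact h.strictMono.monotoneOn (mem_Ici.2 le_rfl) hr hr

theorem ClassK.pos {α : ℝ → ℝ} (h : ClassK α) {r : ℝ} (hr : 0 < r) : 0 < α r := by
  rw [← h.zero]
  exact h.strictMono (mem_Ici.2 le_rfl) hr.le hr

theorem ClassK.mono {α : ℝ → ℝ} (h : ClassK α) {r s : ℝ} (hr : 0 ≤ r) (hrs : r ≤ s) :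
    α r ≤ α s :=
  h.strictMono.monotoneOn hr (hr.trans hrs) hrs

theorem ClassK.lt_of_lt {α : ℝ → ℝ} (h : ClassK α) {r s : ℝ} (hr : 0 ≤ r) (hs : 0 ≤ s)
    (hlt : α r < α s) : r < s :=
  (h.strictMono.lt_iff_lt hr hs).1 hlt

/-- Class `K` functions are small near zero. -/
theorem ClassK.exists_le {α : ℝ → ℝ} (h : ClassK α) {ε : ℝ} (hε : 0 < ε) :
    ∃ σ > 0, ∀ r, 0 ≤ r → r ≤ σ → α r ≤ ε := by
  have hc := h.cont 0 (mem_Ici.2 le_rfl)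
  rw [Metric.continuousWithinAt_iff] at hc
  obtain ⟨δ, hδ, H⟩ := hc ε hε
  refine ⟨δ / 2, by positivity, fun r hr hrs => ?_⟩
  have := H (mem_Ici.2 hr) (by rw [Real.dist_eq, sub_zero, abs_of_nonneg hr]; linarith)
  rw [h.zero, Real.dist_eq, sub_zero] at this
  exact (le_abs_self _).trans this.le

/-- A quantity which is small for small arguments and grows at most linearly is bounded by a
function of class `K_∞`. -/
theorem exists_classKInf_ge {ι : Type*} (r w : ι → ℝ) (hr : ∀ i, 0 ≤ r i)
    (h : ∀ ε > 0, ∃ C, ∀ i, w i ≤ ε + C * r i) :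
    ∃ α, ClassKInf α ∧ ∀ i, w i ≤ α (r i) := by
  have h' : ∀ ε : {ε : ℝ // 0 < ε}, ∃ C, 0 ≤ C ∧ ∀ i, w i ≤ ε + C * r i := by
    rintro ⟨ε, hε⟩
    obtain ⟨C, hC⟩ := h ε hε
    exact ⟨max C 0, le_max_right _ _, fun i => (hC i).trans
      (by simpa using mul_le_mul_of_nonneg_right (le_max_left C 0) (hr i))⟩
  choose C hC0 hC using h'
  have : Nonempty {ε : ℝ // 0 < ε} := ⟨⟨1, one_pos⟩⟩
  -- The infimum of all available affine majorants: monotone, zero at zero because the offsets are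
  -- arbitrarily small, and with `α s / s` nonincreasing.
  set α : ℝ → ℝ := fun s => ⨅ ε : {ε : ℝ // 0 < ε}, ((ε : ℝ) + C ε * s) with hα
  have hbdd : ∀ s, 0 ≤ s → BddBelow (range fun ε : {ε : ℝ // 0 < ε} => (ε : ℝ) + C ε * s) := by
    intro s hs
    refine ⟨0, ?_⟩
    rintro _ ⟨ε, rfl⟩
    have := ε.2
    have := mul_nonneg (hC0 ε) hs
    dsimp only
    linarith
  have hle : ∀ s, 0 ≤ s → ∀ ε : {ε : ℝ // 0 < ε}, α s ≤ (ε : ℝ) + C ε * s :=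
    fun s hs ε => ciInf_le (hbdd s hs) ε
  have hnn : ∀ s, 0 ≤ s → 0 ≤ α s := fun s hs => le_ciInf fun ε => by
    have := ε.2
    have := mul_nonneg (hC0 ε) hs
    linarith
  have hmono : ∀ s t, 0 ≤ s → s ≤ t → α s ≤ α t := fun s t hs hst => le_ciInf fun ε =>
    (hle s hs ε).trans (by
      have := mul_le_mul_of_nonneg_left hst (hC0 ε)
      linarith)
  have hscale : ∀ s t, 0 < s → s ≤ t → α t ≤ t / s * α s := by
    intro s t hs hst
    have hts : 0 < t / s := div_pos (hs.trans_le hst) hs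
    rw [← div_le_iff₀' hts]
    refine le_ciInf fun ε => ?_
    rw [div_le_iff₀' hts]
    refine (hle t (hs.le.trans hst) ε).trans ?_
    have h1 : 1 ≤ t / s := (one_le_div hs).2 hst
    have h2 : t / s * (C ε * s) = C ε * t := by field_simp
    have := mul_le_mul_of_nonneg_right h1 ε.2.le
    rw [mul_add, h2]
    linarith
  have hzero : α 0 = 0 := by
    refine le_antisymm (le_of_forall_pos_le_add fun ε hε => ?_) (hnn 0 le_rfl)
    simpa using hle 0 le_rfl ⟨ε, hε⟩
  have hcont : ContinuousOn α (Ici 0) := by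
    intro s hs
    rcases (mem_Ici.1 hs).eq_or_lt with rfl | hs
    · rw [Metric.continuousWithinAt_iff]
      intro ε hε
      let e : {ε : ℝ // 0 < ε} := ⟨ε / 2, by positivity⟩
      have hCe := hC0 e
      refine ⟨ε / 2 / (C e + 1), by positivity, fun {t} ht htd => ?_⟩
      rw [Real.dist_eq, sub_zero, abs_of_nonneg ht, lt_div_iff₀ (by positivity)] at htd
      rw [hzero, Real.dist_eq, sub_zero, abs_of_nonneg (hnn t ht)]
      have := hle t ht e
      have h3 : (e : ℝ) = ε / 2 := rfl
      have ht' : 0 ≤ t := ht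
      nlinarith
    -- Monotonicity and the scaling inequality squeeze `α t` between `min 1 (t / s) * α s` and `max
    -- 1 (t / s) * α s`.
    · have hlow : Tendsto (fun t => min 1 (t / s) * α s) (𝓝[Ici 0] s) (𝓝 (α s)) := by
        have : ContinuousAt (fun t => min 1 (t / s) * α s) s := by fun_prop
        have h2 := this.tendsto
        simp only [div_self hs.ne', min_self, one_mul] at h2
        exact h2.mono_left nhdsWithin_le_nhds
      have hup : Tendsto (fun t => max 1 (t / s) * α s) (𝓝[Ici 0] s) (𝓝 (α s)) := by
        have : ContinuousAt (fun t => max 1 (t / s) * α s) s := by fun_prop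
        have h2 := this.tendsto
        simp only [div_self hs.ne', max_self, one_mul] at h2
        exact h2.mono_left nhdsWithin_le_nhds
      refine tendsto_of_tendsto_of_tendsto_of_le_of_le' hlow hup ?_ ?_
      · filter_upwards [self_mem_nhdsWithin] with t ht
        have ht : 0 ≤ t := ht
        rcases le_total s t with hst | hts
        · rw [min_eq_left ((one_le_div hs).2 hst), one_mul]
          exact hmono s t hs.le hst
        · rw [min_eq_right ((div_le_one hs).2 hts)]
          rcases ht.eq_or_lt with rfl | ht
          · simp [hzero]
          · have := mul_le_mul_of_nonneg_left (hscale t s ht hts) (div_pos ht hs).le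
            have h3 : t / s * (s / t * α t) = α t := by field_simp
            linarith
      · filter_upwards [self_mem_nhdsWithin] with t ht
        have ht : 0 ≤ t := ht
        rcases le_total s t with hst | hts
        · rw [max_eq_right ((one_le_div hs).2 hst)]
          exact hscale s t hs hst
        · rw [max_eq_left ((div_le_one hs).2 hts), one_mul]
          exact hmono t s ht hts
  -- The infimum may be constant on intervals or bounded; adding the identity gives strictness and
  -- unboundedness.
  refine ⟨fun s => α s + s, ⟨⟨hcont.add continuousOn_id, ?_, by simp [hzero]⟩, ?_⟩, fun i => ?_⟩
  · intro s hs t ht hst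
    exact add_lt_add_of_le_of_lt (hmono s t hs hst.le) hst
  · refine tendsto_atTop_mono' _ ?_ tendsto_id
    filter_upwards [eventually_ge_atTop 0] with s hs
    simpa using hnn s hs
  · have : w i ≤ α (r i) := le_ciInf fun ε => hC ε i
    have := hr i
    dsimp only
    linarith

/-- A quantity which is bounded away from zero for arguments bounded away from zero is bounded
from below by a function of class `K_∞`, provided that the arguments are bounded. -/
theorem exists_classKInf_le {ι : Type*} (r w : ι → ℝ) (R : ℝ)
    (hR : ∀ i, r i ≤ R) (hw : ∀ i, 0 ≤ w i)
    (h : ∀ ε > 0, ∃ c > 0, ∀ i, ε ≤ r i → c ≤ w i) :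
    ∃ α, ClassKInf α ∧ ∀ i, α (r i) ≤ w i := by
  have h' : ∀ ε : {ε : ℝ // 0 < ε}, ∃ C, 0 < C ∧ C ≤ 1 ∧
      ∀ i, C * max (r i - ε) 0 ≤ w i := by
    rintro ⟨ε, hε⟩
    obtain ⟨c, hc, H⟩ := h ε hε
    have hR1 : 0 < |R| + 1 := by positivity
    -- The hinge must stay below `c` on the whole range of arguments, which ends at `R`; the cap `1`
    -- makes all hinges 1-Lipschitz.
    refine ⟨min 1 (c / (|R| + 1)), lt_min one_pos (div_pos hc hR1), min_le_left _ _, fun i => ?_⟩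
    rcases le_total ε (r i) with hi | hi
    · refine le_trans ?_ (H i hi)
      rw [max_eq_left (by simpa using hi)]
      calc min 1 (c / (|R| + 1)) * (r i - ε) ≤ c / (|R| + 1) * (|R| + 1) := by
            refine mul_le_mul (min_le_right _ _) ?_ (by simpa using hi) (div_pos hc hR1).le
            have := hR i
            have := le_abs_self R
            linarith
        _ = c := by field_simp
    · rw [max_eq_right (by simpa using hi), mul_zero]
      exact hw i
  choose C hC0 hC1 hC using h'
  have : Nonempty {ε : ℝ // 0 < ε} := ⟨⟨1, one_pos⟩⟩
  -- A supremum of hinges of slope at most one is 1-Lipschitz, hence continuous; `α s / s` is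
  -- nondecreasing, which together with positivity yields strict monotonicity.
  set α : ℝ → ℝ := fun s => ⨆ ε : {ε : ℝ // 0 < ε}, C ε * max (s - ε) 0 with hα
  have hbdd : ∀ s, BddAbove (range fun ε : {ε : ℝ // 0 < ε} => C ε * max (s - (ε : ℝ)) 0) := by
    intro s
    refine ⟨max s 0, ?_⟩
    rintro _ ⟨ε, rfl⟩
    have h1 : max (s - ε) 0 ≤ max s 0 := max_le_max (by have := ε.2; linarith) le_rfl
    have h2 : 0 ≤ max (s - (ε : ℝ)) 0 := le_max_right _ _
    have := hC1 ε
    dsimp only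
    nlinarith
  have hle : ∀ (s : ℝ) (ε : {ε : ℝ // 0 < ε}), C ε * max (s - ε) 0 ≤ α s :=
    fun s ε => le_ciSup (hbdd s) ε
  have hnn : ∀ s, 0 ≤ α s := fun s =>
    (mul_nonneg (hC0 ⟨1, one_pos⟩).le (le_max_right _ _)).trans (hle s ⟨1, one_pos⟩)
  have hmono : Monotone α := fun s t hst => ciSup_le fun ε =>
    (mul_le_mul_of_nonneg_left (max_le_max (by linarith) le_rfl) (hC0 ε).le).trans (hle t ε)
  have hlip : ∀ s t, s ≤ t → α t ≤ α s + (t - s) := fun s t hst => ciSup_le fun ε => by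
    have h1 := hle s ε
    have h2 : max (t - (ε : ℝ)) 0 ≤ max (s - ε) 0 + (t - s) := by
      rcases le_total 0 (t - (ε : ℝ)) with h | h
      · rw [max_eq_left h]
        have := le_max_left (s - (ε : ℝ)) 0
        linarith
      · rw [max_eq_right h]
        have := le_max_right (s - (ε : ℝ)) 0
        linarith
    have h3 := mul_le_mul_of_nonneg_left h2 (hC0 ε).le
    have h4 := mul_le_mul_of_nonneg_right (hC1 ε) (sub_nonneg.2 hst)
    linarith
  have hcont : Continuous α := by
    refine (LipschitzWith.of_dist_le_mul (K := 1) fun s t => ?_).continuous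
    rw [NNReal.coe_one, one_mul, Real.dist_eq, Real.dist_eq]
    rcases le_total s t with hst | hst
    · rw [abs_of_nonpos (sub_nonpos.2 (hmono hst)), abs_of_nonpos (sub_nonpos.2 hst)]
      have := hlip s t hst
      linarith
    · rw [abs_of_nonneg (sub_nonneg.2 (hmono hst)), abs_of_nonneg (sub_nonneg.2 hst)]
      have := hlip t s hst
      linarith
  have hzero : α 0 = 0 := by
    refine le_antisymm (ciSup_le fun ε => ?_) (hnn 0)
    rw [max_eq_right (by have := ε.2; linarith), mul_zero]
  have hpos : ∀ s, 0 < s → 0 < α s := fun s hs => by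
    refine lt_of_lt_of_le ?_ (hle s ⟨s / 2, by positivity⟩)
    refine mul_pos (hC0 _) (lt_max_of_lt_left ?_)
    dsimp only
    linarith
  have hscale : ∀ s t, 0 < s → s < t → t / s * α s ≤ α t := by
    intro s t hs hst
    have hts : 0 < t / s := div_pos (hs.trans hst) hs
    rw [← le_div_iff₀' hts]
    refine ciSup_le fun ε => ?_
    rw [le_div_iff₀' hts]
    refine le_trans ?_ (hle t ε)
    have h1 : 1 ≤ t / s := (one_le_div hs).2 hst.le
    rw [mul_left_comm]
    refine mul_le_mul_of_nonneg_left ?_ (hC0 ε).le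
    rw [mul_max_of_nonneg _ _ hts.le, mul_zero]
    refine max_le_max ?_ le_rfl
    have h2 : t / s * s = t := by field_simp
    have := mul_le_mul_of_nonneg_right h1 ε.2.le
    rw [mul_sub, h2]
    linarith
  refine ⟨α, ⟨⟨hcont.continuousOn, ?_, hzero⟩, ?_⟩, fun i => ciSup_le fun ε => hC ε i⟩
  · intro s hs t ht hst
    rcases (mem_Ici.1 hs).eq_or_lt with rfl | hs
    · rw [hzero]
      exact hpos t hst
    · refine lt_of_lt_of_le ?_ (hscale s t hs hst)
      exact lt_mul_of_one_lt_left (hpos s hs) ((one_lt_div hs).2 hst)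
  · refine tendsto_atTop_mono (fun s => (mul_le_mul_of_nonneg_left (le_max_left _ _)
      (hC0 ⟨1, one_pos⟩).le).trans (hle s ⟨1, one_pos⟩)) ?_
    exact (tendsto_atTop_add_const_right _ _ tendsto_id).const_mul_atTop (hC0 _)

/-- A class `K` function evaluated along `b / (k + 1)` is of class `L_ℕ`. -/
theorem ClassK.classLN {α : ℝ → ℝ} (h : ClassK α) {b : ℝ} (hb : 0 ≤ b) :
    ClassLN fun k : ℕ => α (b / ((k : ℝ) + 1)) where
  nonneg k := h.nonneg (by positivity)
  anti k l hkl := h.mono (by positivity) (by gcongr)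
  lim := by
    have h1 : Tendsto (fun k : ℕ => b / ((k : ℝ) + 1)) atTop (𝓝[Ici 0] 0) := by
      rw [tendsto_nhdsWithin_iff]
      refine ⟨?_, Eventually.of_forall fun k => mem_Ici.2 (by positivity)⟩
      simpa [div_eq_mul_inv] using
        (tendsto_one_div_add_atTop_nhds_zero_nat (𝕜 := ℝ)).const_mul b
    have h2 := (h.cont 0 (mem_Ici.2 le_rfl)).tendsto.comp h1
    rwa [h.zero] at h2

/-- A uniformly bounded quantity which is small for small `r` and large `ν` is bounded by a class
`K_∞` function of `r` plus a class `L_ℕ` function of `ν`. -/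
theorem exists_classKInf_add_classLN_ge {ι : Type*} (r w : ι → ℝ) (ν : ι → ℕ) (M : ℝ)
    (hr : ∀ i, 0 ≤ r i) (hM : ∀ i, w i ≤ M)
    (h : ∀ ε > 0, ∃ η > 0, ∃ N₀, ∀ i, r i ≤ η → N₀ ≤ ν i → w i ≤ ε) :
    ∃ α δ, ClassKInf α ∧ ClassLN δ ∧ ∀ i, w i ≤ α (r i) + δ (ν i) := by
  -- Both smallness parameters are merged into `r + 1 / (ν + 1)`. If `r > η` or `ν < N₀`, this
  -- quantity is bounded away from zero, so a multiple of it dominates the bound `|M|`.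
  obtain ⟨α, hα, H⟩ := exists_classKInf_ge (fun i => r i + 1 / ((ν i : ℝ) + 1)) w
    (fun i => add_nonneg (hr i) (by positivity)) (by
      intro ε hε
      obtain ⟨η, hη, N₀, H⟩ := h ε hε
      refine ⟨|M| * (1 / η + (N₀ + 1)), fun i => ?_⟩
      have hMi : w i ≤ |M| := (hM i).trans (le_abs_self _)
      have hri := hr i
      have hνi : 0 < 1 / ((ν i : ℝ) + 1) := by positivity
      by_cases h1 : r i ≤ η
      · by_cases h2 : N₀ ≤ ν i
        · refine (H i h1 h2).trans (le_add_of_nonneg_right ?_)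
          positivity
        · have h3 : (ν i : ℝ) + 1 ≤ N₀ + 1 := by
            have : ν i ≤ N₀ := by omega
            have : (ν i : ℝ) ≤ N₀ := by exact_mod_cast this
            linarith
          have h4 : 1 ≤ (N₀ + 1 : ℝ) * (1 / ((ν i : ℝ) + 1)) := by
            rw [mul_one_div, one_le_div (by positivity)]
            exact h3
          have h5 : 1 ≤ (1 / η + (N₀ + 1 : ℝ)) * (r i + 1 / ((ν i : ℝ) + 1)) := by
            refine h4.trans (mul_le_mul ?_ ?_ hνi.le (by positivity))
            · have : 0 < 1 / η := by positivity
              linarith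
            · linarith
          have := mul_le_mul_of_nonneg_left h5 (abs_nonneg M)
          rw [mul_assoc]
          linarith
      · have h4 : 1 ≤ (1 / η) * r i := by
          rw [one_div_mul_eq_div, one_le_div hη]
          exact (not_le.1 h1).le
        have h5 : 1 ≤ (1 / η + (N₀ + 1 : ℝ)) * (r i + 1 / ((ν i : ℝ) + 1)) := by
          refine h4.trans (mul_le_mul ?_ ?_ hri (by positivity))
          · have : (0 : ℝ) ≤ N₀ := Nat.cast_nonneg _
            linarith
          · linarith
        have := mul_le_mul_of_nonneg_left h5 (abs_nonneg M)
        rw [mul_assoc]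
        linarith)
  -- The merged argument is split again: a sum is at most twice its larger summand.
  refine ⟨fun s => α (2 * s), fun k => α (2 / ((k : ℝ) + 1)), ⟨⟨?_, ?_, ?_⟩, ?_⟩,
    hα.toClassK.classLN zero_le_two, fun i => (H i).trans ?_⟩
  · exact hα.cont.comp (by fun_prop) fun s hs => by
      have : (0 : ℝ) ≤ s := hs
      exact mem_Ici.2 (by positivity)
  · intro s hs t ht hst
    have hs : (0 : ℝ) ≤ s := hs
    have ht : (0 : ℝ) ≤ t := ht
    exact hα.strictMono (mem_Ici.2 (by positivity)) (mem_Ici.2 (by positivity)) (by linarith)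
  · simp [hα.zero]
  · exact hα.unbounded.comp (tendsto_id.const_mul_atTop two_pos)
  · have hri := hr i
    have hνi : 0 < 1 / ((ν i : ℝ) + 1) := by positivity
    have h2 : 2 / ((ν i : ℝ) + 1) = 2 * (1 / ((ν i : ℝ) + 1)) := by ring
    dsimp only
    rw [h2]
    rcases le_total (r i) (1 / ((ν i : ℝ) + 1)) with h | h
    · refine (hα.toClassK.mono (by positivity) ?_).trans
        (le_add_of_nonneg_left (hα.toClassK.nonneg (by positivity)))
      linarith
    · refine (hα.toClassK.mono (by positivity) ?_).trans
        (le_add_of_nonneg_right (hα.toClassK.nonneg (by positivity)))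
      linarith

/-- A uniformly bounded quantity which is small for large `ν` is bounded by a class `L_ℕ`
function of `ν`. -/
theorem exists_classLN_ge {ι : Type*} (w : ι → ℝ) (ν : ι → ℕ) (M : ℝ) (hM : ∀ i, w i ≤ M)
    (h : ∀ ε > 0, ∃ N₀, ∀ i, N₀ ≤ ν i → w i ≤ ε) :
    ∃ δ, ClassLN δ ∧ ∀ i, w i ≤ δ (ν i) := by
  obtain ⟨α, δ, hα, hδ, H⟩ := exists_classKInf_add_classLN_ge (fun _ => 0) w ν M
    (fun _ => le_rfl) hM (fun ε hε => by
      obtain ⟨N₀, H⟩ := h ε hε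
      exact ⟨1, one_pos, N₀, fun i _ hi => H i hi⟩)
  refine ⟨δ, hδ, fun i => (H i).trans ?_⟩
  rw [hα.zero, zero_add]

/-- From uniform stability and uniform attractivity, both up to errors vanishing for
`ν → ∞`, to an estimate by a class `KL` function. Here `ξ i k` is the distance at time `k`. -/
theorem exists_classKL {ι : Type*} (ξ : ι → ℕ → ℝ) (ν : ι → ℕ) (M : ℝ)
    (hnn : ∀ i k, 0 ≤ ξ i k) (hM : ∀ i k, ξ i k ≤ M)
    (hS : ∀ ε > 0, ∃ η > 0, ∃ N₀, ∀ i, N₀ ≤ ν i → ξ i 0 ≤ η → ∀ k, ξ i k ≤ ε)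
    (hA : ∀ ε > 0, ∃ K N₀, ∀ i, N₀ ≤ ν i → ∀ k, K ≤ k → ξ i k ≤ ε) :
    ∃ β, ∃ e : ℕ → ℝ, ClassKL β ∧ (∀ N, 0 ≤ e N) ∧ Tendsto e atTop (𝓝 0) ∧
      ∀ i k, ξ i k ≤ max (β (ξ i 0) k) (e (ν i)) := by
  obtain ⟨α, δ, hα, hδ, H1⟩ := exists_classKInf_add_classLN_ge
    (fun q : ι × ℕ => ξ q.1 0) (fun q => ξ q.1 q.2) (fun q => ν q.1) M (fun q => hnn _ _)
    (fun q => hM _ _) (fun ε hε => by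
      obtain ⟨η, hη, N₀, H⟩ := hS ε hε
      exact ⟨η, hη, N₀, fun q h1 h2 => H q.1 h2 h1 q.2⟩)
  -- Attractivity is read as smallness for small `1 / (k + 1)`, so the same construction applies
  -- with time in the role of the argument.
  obtain ⟨α', δ', hα', hδ', H2⟩ := exists_classKInf_add_classLN_ge
    (fun q : ι × ℕ => 1 / ((q.2 : ℝ) + 1)) (fun q => ξ q.1 q.2) (fun q => ν q.1) M
    (fun q => by positivity)
    (fun q => hM _ _) (fun ε hε => by
      obtain ⟨K, N₀, H⟩ := hA ε hε
      refine ⟨1 / ((K : ℝ) + 1), by positivity, N₀, fun q h1 h2 => H q.1 h2 q.2 ?_⟩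
      rw [one_div_le_one_div (by positivity) (by positivity)] at h1
      have : (K : ℝ) ≤ q.2 := by linarith
      exact_mod_cast this)
  have hpos : ∀ s : ℝ, 0 ≤ s → 0 < α' (1 / (s + 1)) := fun s hs => hα'.toClassK.pos (by positivity)
  have hcα' : ContinuousOn (fun s : ℝ => α' (1 / (s + 1))) (Ici 0) := by
    refine hα'.cont.comp (ContinuousOn.div continuousOn_const (by fun_prop) ?_) ?_
    · intro s hs
      have : (0 : ℝ) ≤ s := hs
      positivity
    · intro s hs
      have : (0 : ℝ) ≤ s := hs
      exact mem_Ici.2 (by positivity)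
  -- The geometric mean of the two bounds is small when either is. Once the errors are less than
  -- half of the distance, each of the two bounds is at least the other half; this explains both
  -- factors `2`.
  refine ⟨fun r s => 2 * Real.sqrt (α r * α' (1 / (s + 1))), fun N => 2 * max (δ N) (δ' N),
    ⟨?_, ?_, ?_, ?_⟩, ?_, ?_, ?_⟩
  · refine continuousOn_const.mul (Real.continuous_sqrt.comp_continuousOn ?_)
    exact (hα.cont.comp continuousOn_fst fun q hq => hq.1).mul
      (hcα'.comp continuousOn_snd fun q hq => hq.2)
  · intro s hs
    refine ⟨?_, ?_, by simp [hα.zero]⟩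
    · exact continuousOn_const.mul (Real.continuous_sqrt.comp_continuousOn
        (hα.cont.mul continuousOn_const))
    · intro r hr t ht hrt
      have h1 := hα.strictMono hr ht hrt
      have h2 : α r * α' (1 / (s + 1)) < α t * α' (1 / (s + 1)) :=
        mul_lt_mul_of_pos_right h1 (hpos s hs)
      have h3 := Real.sqrt_lt_sqrt (mul_nonneg (hα.toClassK.nonneg hr) (hpos s hs).le) h2
      dsimp only
      linarith
  · intro r hr s hs t ht hst
    have hs : (0 : ℝ) ≤ s := hs
    have ht : (0 : ℝ) ≤ t := ht
    have h1 : α' (1 / (t + 1)) ≤ α' (1 / (s + 1)) :=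
      hα'.toClassK.mono (by positivity) (by gcongr)
    have := Real.sqrt_le_sqrt (mul_le_mul_of_nonneg_left h1 (hα.toClassK.nonneg hr))
    dsimp only
    linarith
  · intro r hr
    have h1 : Tendsto (fun s : ℝ => 1 / (s + 1)) atTop (𝓝[Ici 0] 0) := by
      rw [tendsto_nhdsWithin_iff]
      refine ⟨?_, ?_⟩
      · simp only [one_div]
        exact tendsto_inv_atTop_zero.comp (tendsto_atTop_add_const_right _ _ tendsto_id)
      · filter_upwards [eventually_ge_atTop 0] with s hs
        exact mem_Ici.2 (by positivity)
    have h2 := (hα'.cont 0 (mem_Ici.2 le_rfl)).tendsto.comp h1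
    rw [hα'.zero] at h2
    have h3 := ((Real.continuous_sqrt.tendsto _).comp (h2.const_mul (α r))).const_mul 2
    simpa using h3
  · intro N
    have := hδ.nonneg N
    positivity
  · have := (hδ.lim.max hδ'.lim).const_mul 2
    simpa using this
  · intro i k
    have h1 : ξ i k ≤ α (ξ i 0) + δ (ν i) := H1 (i, k)
    have h2 : ξ i k ≤ α' (1 / ((k : ℝ) + 1)) + δ' (ν i) := H2 (i, k)
    rw [le_max_iff]
    by_contra! hcon
    obtain ⟨hc1, hc2⟩ := hcon
    have h3 := le_max_left (δ (ν i)) (δ' (ν i))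
    have h4 := le_max_right (δ (ν i)) (δ' (ν i))
    have h5 : ξ i k / 2 ≤ α (ξ i 0) := by linarith
    have h6 : ξ i k / 2 ≤ α' (1 / ((k : ℝ) + 1)) := by linarith
    have h0 := hnn i k
    have h7 : ξ i k / 2 ≤ Real.sqrt (α (ξ i 0) * α' (1 / ((k : ℝ) + 1))) := by
      refine Real.le_sqrt_of_sq_le ?_
      rw [sq]
      exact mul_le_mul h5 h6 (by positivity) (by linarith)
    linarith

/-! ### Solutions, output histories and concatenation of inputs -/

namespace ControlProblem

variable {n m p T : ℕ} (S : ControlProblem n m p T)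
  {x xs : EuclideanSpace ℝ (Fin n)} {us : EuclideanSpace ℝ (Fin m)} {H : Storage p T}
  {u v w : ℕ → EuclideanSpace ℝ (Fin m)} {N M P : ℕ}

/-- The stored outputs followed by the outputs along the solution; the output at time `k` has
index `k + (T - 1)`. -/
def hist (x : EuclideanSpace ℝ (Fin n)) (H : Storage p T) (u : ℕ → EuclideanSpace ℝ (Fin m))
    (k : ℕ) : Fin p → ℝ :=
  if hk : k < T - 1 then fun i => H i ⟨k, hk⟩ else S.out x u (k - (T - 1))

/-- The storage after `P` steps. -/
def store (x : EuclideanSpace ℝ (Fin n)) (H : Storage p T) (u : ℕ → EuclideanSpace ℝ (Fin m))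
    (P : ℕ) : Storage p T :=
  fun i j => S.hist x H u (P + j) i

/-- Apply `v` for `P` steps and `w` afterwards. -/
def concat (P : ℕ) (v w : ℕ → EuclideanSpace ℝ (Fin m)) : ℕ → EuclideanSpace ℝ (Fin m) :=
  fun k => if k < P then v k else w (k - P)

theorem concat_of_lt {k : ℕ} (h : k < P) : concat P v w k = v k := if_pos h

theorem concat_add (k : ℕ) : concat P v w (P + k) = w k := by
  simp [concat]

theorem traj_congr (h : ∀ k < P, u k = v k) {k : ℕ} (hk : k ≤ P) :
    S.traj x u k = S.traj x v k := by
  induction k with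
  | zero => rfl
  | succ k ih => rw [traj, traj, ih (by omega), h k (by omega)]

theorem traj_add (x : EuclideanSpace ℝ (Fin n)) (u : ℕ → EuclideanSpace ℝ (Fin m)) (P k : ℕ) :
    S.traj x u (P + k) = S.traj (S.traj x u P) (fun j => u (P + j)) k := by
  induction k with
  | zero => rfl
  | succ k ih => rw [← add_assoc, traj, traj, ih]

theorem out_congr (h : ∀ k < P, u k = v k) {k : ℕ} (hk : k < P) :
    S.out x u k = S.out x v k := by
  rw [out, out, S.traj_congr h hk.le, h k hk]

theorem out_add (x : EuclideanSpace ℝ (Fin n)) (u : ℕ → EuclideanSpace ℝ (Fin m)) (P k : ℕ) :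
    S.out x u (P + k) = S.out (S.traj x u P) (fun j => u (P + j)) k := by
  rw [out, out, traj_add]

theorem hist_of_lt {k : ℕ} (hk : k < T - 1) : S.hist x H u k = fun i => H i ⟨k, hk⟩ := dif_pos hk

theorem hist_of_le {k : ℕ} (hk : T - 1 ≤ k) : S.hist x H u k = S.out x u (k - (T - 1)) :=
  dif_neg (by omega)

theorem hist_congr (h : ∀ k < P, u k = v k) {k : ℕ} (hk : k < P + (T - 1)) :
    S.hist x H u k = S.hist x H v k := by
  rcases lt_or_ge k (T - 1) with h1 | h1
  · rw [S.hist_of_lt h1, S.hist_of_lt h1]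
  · rw [S.hist_of_le h1, S.hist_of_le h1, S.out_congr h (by omega)]

/-- Restarting after `P` steps loses nothing: the current storage takes the place of the entries
that precede the restart. This makes the average constraints compatible with cutting and joining
solutions. -/
theorem hist_add (x : EuclideanSpace ℝ (Fin n)) (H : Storage p T)
    (u : ℕ → EuclideanSpace ℝ (Fin m)) (P k : ℕ) :
    S.hist x H u (P + k)
      = S.hist (S.traj x u P) (S.store x H u P) (fun j => u (P + j)) k := by
  rcases lt_or_ge k (T - 1) with h1 | h1
  · rw [S.hist_of_lt h1]
    rfl
  · rw [S.hist_of_le h1, S.hist_of_le (by omega), ← out_add]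
    congr 1
    omega

theorem store_congr (h : ∀ k < P, u k = v k) {k : ℕ} (hk : k ≤ P) :
    S.store x H u k = S.store x H v k := by
  ext i j
  exact congrFun (S.hist_congr h (by have := j.2; omega)) i

theorem store_add (x : EuclideanSpace ℝ (Fin n)) (H : Storage p T)
    (u : ℕ → EuclideanSpace ℝ (Fin m)) (P k : ℕ) :
    S.store x H u (P + k)
      = S.store (S.traj x u P) (S.store x H u P) (fun j => u (P + j)) k := by
  ext i j
  rw [store, add_assoc, hist_add]
  rfl

theorem store_zero (x : EuclideanSpace ℝ (Fin n)) (H : Storage p T)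
    (u : ℕ → EuclideanSpace ℝ (Fin m)) : S.store x H u 0 = H := by
  ext i j
  rw [store, zero_add, S.hist_of_lt j.2]

/-- The stored columns `j, …, T - 1` (one-based) and the first `j` outputs are exactly `T`
consecutive entries of the history, starting at index `j - 1`. The two kinds of average constraints
thereby become one. -/
theorem past_sum_eq {j : ℕ} (hj : 1 ≤ j) (hjT : j ≤ T - 1) (i : Fin p) :
    (∑ l : Fin (T - 1), if j ≤ (l : ℕ) + 1 then H i l else 0)
      + ∑ k ∈ Finset.range j, S.out x u k i
      = ∑ k ∈ Finset.range T, S.hist x H u (j - 1 + k) i := by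
  have h1 : (∑ l : Fin (T - 1), if j ≤ (l : ℕ) + 1 then H i l else 0)
      = ∑ l ∈ Finset.range (T - 1), if j ≤ l + 1 then S.hist x H u l i else 0 := by
    rw [← Fin.sum_univ_eq_sum_range (fun l => if j ≤ l + 1 then S.hist x H u l i else 0)]
    refine Finset.sum_congr rfl fun l _ => ?_
    rw [S.hist_of_lt l.2]
  rw [h1]
  have h2 : T - 1 = (j - 1) + (T - j) := by omega
  have h3 : Finset.range T = Finset.range ((T - j) + j) := by congr 1; omega
  rw [h3, Finset.sum_range_add, h2, Finset.sum_range_add, Finset.sum_eq_zero, zero_add]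
  · congr 1
    · refine Finset.sum_congr rfl fun k _ => if_pos (by omega)
    · refine Finset.sum_congr rfl fun k _ => ?_
      rw [S.hist_of_le (by omega)]
      congr 2
      omega
  · intro l hl
    exact if_neg (by have := Finset.mem_range.1 hl; omega)

/-- Admissibility means that the sums of all `T` consecutive entries of the output history are
nonpositive. -/
theorem admissible_iff (hT : 1 ≤ T) :
    S.Admissible N x H u ↔ (∀ k < N, (S.traj x u k, u k) ∈ S.Z) ∧
      ∀ s < N, ∀ i, ∑ k ∈ Finset.range T, S.hist x H u (s + k) i ≤ 0 := by
  constructor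
  · intro h
    refine ⟨h.mem, fun s hs i => ?_⟩
    rcases lt_or_ge s (T - 1) with h1 | h1
    · have := h.past (s + 1) (by omega) (by omega) (by omega) i
      rwa [S.past_sum_eq (by omega) (by omega), Nat.add_sub_cancel] at this
    · have := h.future (s - (T - 1)) (by omega) i
      refine le_of_eq_of_le (Finset.sum_congr rfl fun k _ => ?_) this
      rw [S.hist_of_le (by omega)]
      congr 2
      omega
  · rintro ⟨h1, h2⟩
    refine ⟨h1, fun j hj hjT hjN i => ?_, fun s hs i => ?_⟩
    · rw [S.past_sum_eq hj hjT]
      exact h2 _ (by omega) i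
    · refine le_of_eq_of_le (Finset.sum_congr rfl fun k _ => ?_) (h2 (s + (T - 1)) (by omega) i)
      rw [S.hist_of_le (by omega)]
      congr 2
      omega

variable {S}

theorem Admissible.mono (h : S.Admissible N x H u) (hM : M ≤ N) : S.Admissible M x H u :=
  ⟨fun k hk => h.mem k (by omega), fun j h1 h2 h3 => h.past j h1 h2 (by omega),
    fun s hs => h.future s (by omega)⟩

theorem Admissible.drop (hT : 1 ≤ T) (h : S.Admissible (P + M) x H u) :
    S.Admissible M (S.traj x u P) (S.store x H u P) (fun j => u (P + j)) := by
  rw [S.admissible_iff hT] at h ⊢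
  refine ⟨fun k hk => ?_, fun s hs i => ?_⟩
  · rw [← traj_add]
    exact h.1 (P + k) (by omega)
  · simp only [← hist_add]
    refine le_of_eq_of_le (Finset.sum_congr rfl fun k _ => ?_) (h.2 (P + s) (by omega) i)
    rw [add_assoc]

theorem traj_concat {k : ℕ} (hk : k ≤ P) : S.traj x (concat P v w) k = S.traj x v k :=
  S.traj_congr (fun _ hj => concat_of_lt hj) hk

theorem store_concat {k : ℕ} (hk : k ≤ P) : S.store x H (concat P v w) k = S.store x H v k :=
  S.store_congr (fun _ hj => concat_of_lt hj) hk

theorem traj_concat_add (k : ℕ) :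
    S.traj x (concat P v w) (P + k) = S.traj (S.traj x v P) w k := by
  rw [traj_add, traj_concat le_rfl]
  simp only [concat_add]

/-- A window starting before the junction contains at most `T - 1` later entries than its start, so
it involves only outputs under `v`; a window starting afterwards is one of the restarted problem. -/
theorem Admissible.concat (hT : 1 ≤ T) (hv : S.Admissible P x H v)
    (hw : S.Admissible M (S.traj x v P) (S.store x H v P) w) :
    S.Admissible (P + M) x H (concat P v w) := by
  rw [S.admissible_iff hT] at hv hw ⊢
  refine ⟨fun k hk => ?_, fun s hs i => ?_⟩
  · rcases lt_or_ge k P with h | h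
    · rw [concat_of_lt h, traj_concat h.le]
      exact hv.1 k h
    · obtain ⟨k, rfl⟩ := Nat.exists_eq_add_of_le h
      rw [concat_add, traj_concat_add]
      exact hw.1 k (by omega)
  · rcases lt_or_ge s P with h | h
    · refine le_of_eq_of_le (Finset.sum_congr rfl fun k hk => ?_) (hv.2 s h i)
      have := Finset.mem_range.1 hk
      rw [S.hist_congr (fun _ hj => concat_of_lt hj) (by omega : s + k < P + (T - 1))]
    · obtain ⟨s, rfl⟩ := Nat.exists_eq_add_of_le h
      refine le_of_eq_of_le (Finset.sum_congr rfl fun k _ => ?_) (hw.2 s (by omega) i)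
      rw [add_assoc, hist_add, traj_concat le_rfl, store_concat le_rfl]
      simp only [concat_add]

theorem cost_add (P M : ℕ) (x : EuclideanSpace ℝ (Fin n)) (u : ℕ → EuclideanSpace ℝ (Fin m)) :
    S.cost (P + M) x u = S.cost P x u + S.cost M (S.traj x u P) (fun j => u (P + j)) := by
  rw [cost, Finset.sum_range_add]
  simp only [traj_add]
  rfl

theorem cost_congr (h : ∀ k < N, u k = v k) : S.cost N x u = S.cost N x v := by
  refine Finset.sum_congr rfl fun k hk => ?_
  have hk := Finset.mem_range.1 hk
  rw [S.traj_congr h hk.le, h k hk]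

theorem cost_concat :
    S.cost (P + M) x (concat P v w) = S.cost P x v + S.cost M (S.traj x v P) w := by
  rw [cost_add, cost_congr (fun _ hj => concat_of_lt hj), traj_concat le_rfl]
  simp only [concat_add]

/-- The storage function telescopes along the solution. -/
theorem rotCost_eq_sum (lam : EuclideanSpace ℝ (Fin n) → ℝ) (lbar : Fin p → ℝ) :
    S.rotCost xs us lam lbar N x u
      = ∑ k ∈ Finset.range N, S.rotStage xs us lam lbar (S.traj x u k) (u k) := by
  induction N with
  | zero => simp [rotCost, cost, traj]
  | succ N ih =>
    rw [Finset.sum_range_succ, ← ih]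
    simp only [rotCost, cost, Finset.sum_range_succ, rotStage, out, traj]
    push_cast
    ring

theorem rotCost_concat (lam : EuclideanSpace ℝ (Fin n) → ℝ) (lbar : Fin p → ℝ) :
    S.rotCost xs us lam lbar (P + M) x (concat P v w)
      = S.rotCost xs us lam lbar P x v + S.rotCost xs us lam lbar M (S.traj x v P) w := by
  simp only [rotCost_eq_sum]
  rw [Finset.sum_range_add]
  congr 1
  · refine Finset.sum_congr rfl fun k hk => ?_
    have hk := Finset.mem_range.1 hk
    rw [traj_concat hk.le, concat_of_lt hk]
  · simp only [traj_concat_add, concat_add]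

theorem clStep_eq
    (ustar : ℕ → EuclideanSpace ℝ (Fin n) → Storage p T → ℕ → EuclideanSpace ℝ (Fin m))
    (N : ℕ) (x : EuclideanSpace ℝ (Fin n)) (H : Storage p T) :
    S.clStep ustar N (x, H) = (S.traj x (ustar N x H) 1, S.store x H (ustar N x H) 1) := by
  refine Prod.ext rfl ?_
  ext i j
  simp only [clStep, shift, store]
  split_ifs with hj
  · rw [S.hist_of_lt (by omega)]
    congr 2
    omega
  · rw [S.hist_of_le (by omega), show 1 + (j : ℕ) - (T - 1) = 0 by have := j.2; omega]
    rfl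

theorem closedLoop_succ
    (ustar : ℕ → EuclideanSpace ℝ (Fin n) → Storage p T → ℕ → EuclideanSpace ℝ (Fin m))
    (N k : ℕ) (χ : EuclideanSpace ℝ (Fin n) × Storage p T) :
    S.closedLoop ustar N (k + 1) χ = S.clStep ustar N (S.closedLoop ustar N k χ) :=
  Function.iterate_succ_apply' _ _ _

theorem closedLoop_add
    (ustar : ℕ → EuclideanSpace ℝ (Fin n) → Storage p T → ℕ → EuclideanSpace ℝ (Fin m))
    (N j k : ℕ) (χ : EuclideanSpace ℝ (Fin n) × Storage p T) :
    S.closedLoop ustar N j (S.closedLoop ustar N k χ) = S.closedLoop ustar N (j + k) χ :=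
  (Function.iterate_add_apply _ _ _ _).symm

/-- Sums of outputs over a multiple of `T` steps are nonpositive. -/
theorem Admissible.sum_out_mul_le (h : S.Admissible N x H u) (q : ℕ) (hq : q * T ≤ N)
    (i : Fin p) : ∑ k ∈ Finset.range (q * T), S.out x u k i ≤ 0 := by
  induction q with
  | zero => simp
  | succ q ih =>
    rw [add_mul, one_mul] at hq ⊢
    rw [Finset.sum_range_add]
    exact add_nonpos (ih (by omega)) (h.future _ hq i)

/-- Sums of outputs are bounded uniformly in the horizon. -/
theorem Admissible.sum_out_le (hT : 1 ≤ T) (h : S.Admissible N x H u) {C : ℝ} (hC : 0 ≤ C)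
    (hb : ∀ k < N, ∀ i, S.out x u k i ≤ C) (i : Fin p) :
    ∑ k ∈ Finset.range N, S.out x u k i ≤ T * C := by
  -- Full blocks of length `T` contribute nonpositively, so only fewer than `T` terms have to be
  -- estimated.
  have hN : N = N / T * T + N % T := (Nat.div_add_mod' N T).symm
  have hmod := Nat.mod_lt N (by omega : T > 0)
  rw [hN, Finset.sum_range_add]
  refine (add_le_of_nonpos_of_le (h.sum_out_mul_le _ (by omega) i) (Finset.sum_le_card_nsmul _ _ C
    fun k hk => hb _ (by have := Finset.mem_range.1 hk; omega) i)).trans ?_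
  rw [Finset.card_range, nsmul_eq_mul]
  exact mul_le_mul_of_nonneg_right (by exact_mod_cast hmod.le) hC

end ControlProblem

noncomputable section

/-! ### Norms -/

section Norms

variable {n m p q : ℕ}

theorem vecNorm1_nonneg (v : Fin q → ℝ) : 0 ≤ vecNorm1 v := Finset.sum_nonneg fun _ _ => abs_nonneg _

theorem abs_le_vecNorm1 (v : Fin q → ℝ) (i : Fin q) : |v i| ≤ vecNorm1 v :=
  Finset.single_le_sum (f := fun i => |v i|) (fun _ _ => abs_nonneg _) (Finset.mem_univ i)

theorem pairNorm_nonneg (x : EuclideanSpace ℝ (Fin n)) (u : EuclideanSpace ℝ (Fin m)) :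
    0 ≤ pairNorm x u := Real.sqrt_nonneg _

theorem pairNorm_sq (x : EuclideanSpace ℝ (Fin n)) (u : EuclideanSpace ℝ (Fin m)) :
    pairNorm x u ^ 2 = ‖x‖ ^ 2 + ‖u‖ ^ 2 := Real.sq_sqrt (by positivity)

theorem norm_le_pairNorm (x : EuclideanSpace ℝ (Fin n)) (u : EuclideanSpace ℝ (Fin m)) :
    ‖x‖ ≤ pairNorm x u := Real.le_sqrt_of_sq_le (by nlinarith [sq_nonneg ‖u‖])

theorem pairNorm_le_add (x : EuclideanSpace ℝ (Fin n)) (u : EuclideanSpace ℝ (Fin m)) :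
    pairNorm x u ≤ ‖x‖ + ‖u‖ :=
  Real.sqrt_le_iff.2 ⟨by positivity, by nlinarith [norm_nonneg x, norm_nonneg u]⟩

theorem vecNorm1_sq_le (x : EuclideanSpace ℝ (Fin n)) : vecNorm1 x.ofLp ^ 2 ≤ n * ‖x‖ ^ 2 := by
  rw [EuclideanSpace.norm_sq_eq, vecNorm1]
  simpa using sq_sum_le_card_mul_sum_sq (s := (Finset.univ : Finset (Fin n))) (f := fun i => |x i|)

/-- The dimension of the space of pairs, or one if that space is trivial. -/
def dimPos (n m : ℕ) : ℝ := max ((n : ℝ) + m) 1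

theorem dimPos_pos : 0 < dimPos n m := lt_max_of_lt_right one_pos

/-- Cauchy–Schwarz in dimension `n + m`. Replacing the dimension by `dimPos` keeps the constant
positive even in the trivial space. -/
theorem vecNorm1_add_vecNorm1_le (x : EuclideanSpace ℝ (Fin n)) (u : EuclideanSpace ℝ (Fin m)) :
    vecNorm1 x.ofLp + vecNorm1 u.ofLp ≤ Real.sqrt (dimPos n m) * pairNorm x u := by
  have hD : (n : ℝ) + m ≤ dimPos n m := le_max_left _ _
  have h1 := vecNorm1_sq_le x
  have h2 := vecNorm1_sq_le u
  have h3 : (vecNorm1 x.ofLp + vecNorm1 u.ofLp) ^ 2 ≤ ((n : ℝ) + m) * (‖x‖ ^ 2 + ‖u‖ ^ 2) := by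
    have hn : Real.sqrt n ^ 2 = n := Real.sq_sqrt (Nat.cast_nonneg _)
    have hm : Real.sqrt m ^ 2 = m := Real.sq_sqrt (Nat.cast_nonneg _)
    have h4 : vecNorm1 x.ofLp ≤ Real.sqrt n * ‖x‖ :=
      abs_le_of_sq_le_sq' (by rw [mul_pow, hn]; exact h1) (by positivity) |>.2
    have h5 : vecNorm1 u.ofLp ≤ Real.sqrt m * ‖u‖ :=
      abs_le_of_sq_le_sq' (by rw [mul_pow, hm]; exact h2) (by positivity) |>.2
    calc (vecNorm1 x.ofLp + vecNorm1 u.ofLp) ^ 2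
        ≤ (Real.sqrt n * ‖x‖ + Real.sqrt m * ‖u‖) ^ 2 :=
          pow_le_pow_left₀ (add_nonneg (vecNorm1_nonneg _) (vecNorm1_nonneg _)) (add_le_add h4 h5) 2
      _ ≤ (Real.sqrt n ^ 2 + Real.sqrt m ^ 2) * (‖x‖ ^ 2 + ‖u‖ ^ 2) := by
          nlinarith [sq_nonneg (Real.sqrt n * ‖u‖ - Real.sqrt m * ‖x‖)]
      _ = _ := by rw [hn, hm]
  refine abs_le_of_sq_le_sq' ?_ (by have := pairNorm_nonneg x u; positivity) |>.2
  rw [mul_pow, Real.sq_sqrt dimPos_pos.le, pairNorm_sq]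
  exact h3.trans (mul_le_mul_of_nonneg_right hD (by positivity))

theorem continuous_vecNorm1 : Continuous (vecNorm1 : (Fin q → ℝ) → ℝ) := by
  unfold vecNorm1
  fun_prop

theorem continuous_pairNorm : Continuous fun z : EuclideanSpace ℝ (Fin n) ×
    EuclideanSpace ℝ (Fin m) => pairNorm z.1 z.2 := by
  unfold pairNorm
  fun_prop

theorem vecNorm1_col_le_matNorm1 (A : Matrix (Fin p) (Fin q) ℝ) (j : Fin q) :
    vecNorm1 (fun i => A i j) ≤ matNorm1 A :=
  le_ciSup (f := fun j => ∑ i, |A i j|) (finite_range _).bddAbove j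

theorem matNorm1_nonneg (A : Matrix (Fin p) (Fin q) ℝ) : 0 ≤ matNorm1 A :=
  Real.iSup_nonneg fun _ => Finset.sum_nonneg fun _ _ => abs_nonneg _

theorem matNorm1_le {A : Matrix (Fin p) (Fin q) ℝ} {C : ℝ} (hC : 0 ≤ C)
    (h : ∀ j, vecNorm1 (fun i => A i j) ≤ C) : matNorm1 A ≤ C :=
  Real.iSup_le h hC

theorem matPos_nonneg (A : Matrix (Fin p) (Fin q) ℝ) : 0 ≤ matPos A :=
  Real.iSup_nonneg fun _ => Finset.sum_nonneg fun _ _ => le_max_right _ _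

theorem matPos_le_matNorm1 (A : Matrix (Fin p) (Fin q) ℝ) : matPos A ≤ matNorm1 A :=
  Real.iSup_le (fun j => (Finset.sum_le_sum fun _ _ => max_le (le_abs_self _)
    (abs_nonneg _)).trans (vecNorm1_col_le_matNorm1 A j)) (matNorm1_nonneg A)

theorem matPos_eq_zero {A : Matrix (Fin p) (Fin q) ℝ} (h : ∀ i j, A i j ≤ 0) : matPos A = 0 :=
  le_antisymm (Real.iSup_le (fun j => Finset.sum_nonpos fun i _ => (max_eq_right (h i j)).le)
    le_rfl) (matPos_nonneg A)

theorem abs_le_matNorm1 (A : Matrix (Fin p) (Fin q) ℝ) (i : Fin p) (j : Fin q) :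
    |A i j| ≤ matNorm1 A :=
  (abs_le_vecNorm1 (fun i => A i j) i).trans (vecNorm1_col_le_matNorm1 A j)

theorem matNorm1_zero : matNorm1 (0 : Matrix (Fin p) (Fin q) ℝ) = 0 :=
  le_antisymm (matNorm1_le le_rfl fun j => by simp [vecNorm1]) (matNorm1_nonneg _)

theorem continuous_matNorm1 : Continuous (matNorm1 : Matrix (Fin p) (Fin q) ℝ → ℝ) := by
  rcases isEmpty_or_nonempty (Fin q) with hq | hq
  · have : (matNorm1 : Matrix (Fin p) (Fin q) ℝ → ℝ) = fun _ => 0 := by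
      funext A
      exact Real.iSup_of_isEmpty _
    rw [this]
    exact continuous_const
  · have : (matNorm1 : Matrix (Fin p) (Fin q) ℝ → ℝ)
        = fun A => Finset.univ.sup' Finset.univ_nonempty fun j => ∑ i, |A i j| := by
      funext A
      rw [Finset.sup'_univ_eq_ciSup]
      rfl
    rw [this]
    refine Continuous.finset_sup'_apply _ fun j _ => continuous_finsetSum _ fun i _ => ?_
    exact (continuous_id.matrix_elem i j).abs

open scoped Matrix.Norms.L2Operator in
theorem matNorm2_nonneg (A : Matrix (Fin p) (Fin q) ℝ) : 0 ≤ matNorm2 A := by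
  unfold matNorm2
  exact norm_nonneg _

open scoped Matrix.Norms.L2Operator in
theorem exists_matNorm2_le (p q : ℕ) :
    ∃ C, 0 ≤ C ∧ ∀ A : Matrix (Fin p) (Fin q) ℝ, matNorm2 A ≤ C * matNorm1 A := by
  refine ⟨∑ i : Fin p, ∑ j : Fin q, ‖Matrix.single i j (1 : ℝ)‖,
    Finset.sum_nonneg fun _ _ => Finset.sum_nonneg fun _ _ => norm_nonneg _, fun A => ?_⟩
  unfold matNorm2
  conv_lhs => rw [Matrix.matrix_eq_sum_single A]
  rw [Finset.sum_mul]
  refine norm_sum_le_of_le _ fun i _ => ?_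
  rw [Finset.sum_mul]
  refine norm_sum_le_of_le _ fun j _ => ?_
  have : Matrix.single i j (A i j) = A i j • Matrix.single i j (1 : ℝ) := by
    rw [Matrix.smul_single, smul_eq_mul, mul_one]
  rw [this, norm_smul, mul_comm, Real.norm_eq_abs]
  exact mul_le_mul_of_nonneg_left (abs_le_matNorm1 A i j) (norm_nonneg _)

open scoped Matrix.Norms.L2Operator in
-- An entry is a coordinate of the image of a unit vector.
theorem abs_le_matNorm2 (A : Matrix (Fin p) (Fin q) ℝ) (i : Fin p) (j : Fin q) :
    |A i j| ≤ matNorm2 A := by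
  have h := Matrix.l2_opNorm_mulVec A (EuclideanSpace.single j (1 : ℝ))
  rw [PiLp.norm_single, norm_one, mul_one] at h
  refine le_trans ?_ h
  refine le_trans (le_of_eq ?_) (PiLp.norm_apply_le _ i)
  simp

theorem matNorm1_le_matNorm2 (A : Matrix (Fin p) (Fin q) ℝ) : matNorm1 A ≤ p * matNorm2 A := by
  refine matNorm1_le (mul_nonneg (Nat.cast_nonneg _) (matNorm2_nonneg A)) fun j => ?_
  refine (Finset.sum_le_card_nsmul _ _ _ fun i _ => abs_le_matNorm2 A i j).trans ?_
  simp

end Norms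

namespace ControlProblem

variable {n m p T : ℕ} {S : ControlProblem n m p T}
  {x xs : EuclideanSpace ℝ (Fin n)} {us : EuclideanSpace ℝ (Fin m)} {H : Storage p T}
  {u v w : ℕ → EuclideanSpace ℝ (Fin m)} {N M P : ℕ} {L : ℝ}

/-! ### Bounds for states, outputs and storages -/

theorem Regular.vecNorm1_h_sub_le (h : S.Regular L) (hz : (xs, us) ∈ S.Z)
    {y : EuclideanSpace ℝ (Fin n)} {v : EuclideanSpace ℝ (Fin m)} (hy : (y, v) ∈ S.Z) :
    vecNorm1 (S.h y v - S.h xs us)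
      ≤ L * Real.sqrt (dimPos n m) * pairNorm (y - xs) (v - us) := by
  refine (h.lipschitz_h _ _ _ _ hy hz).trans ?_
  rw [mul_assoc]
  exact mul_le_mul_of_nonneg_left (vecNorm1_add_vecNorm1_le _ _) h.L_pos.le

theorem Regular.pairNorm_le_sSup (h : S.Regular L) (xs : EuclideanSpace ℝ (Fin n))
    (us : EuclideanSpace ℝ (Fin m)) {y : EuclideanSpace ℝ (Fin n)} {v : EuclideanSpace ℝ (Fin m)}
    (hy : (y, v) ∈ S.Z) : pairNorm (y - xs) (v - us)
      ≤ sSup ((fun z => pairNorm (z.1 - xs) (z.2 - us)) '' S.Z) := by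
  have hc : Continuous fun z : EuclideanSpace ℝ (Fin n) × EuclideanSpace ℝ (Fin m) =>
      pairNorm (z.1 - xs) (z.2 - us) :=
    continuous_pairNorm.comp
      (f := fun z : EuclideanSpace ℝ (Fin n) × EuclideanSpace ℝ (Fin m) => (z.1 - xs, z.2 - us))
      (by fun_prop)
  exact le_csSup (h.compact.image hc).bddAbove ⟨(y, v), hy, rfl⟩

theorem Regular.exists_abs_h_le (h : S.Regular L) (hz : (xs, us) ∈ S.Z) :
    ∃ C, 0 ≤ C ∧ ∀ y v, (y, v) ∈ S.Z → ∀ i, |S.h y v i| ≤ C := by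
  obtain ⟨R, hR⟩ : ∃ R, ∀ y v, (y, v) ∈ S.Z → pairNorm (y - xs) (v - us) ≤ R :=
    ⟨_, fun y v hy => h.pairNorm_le_sSup xs us hy⟩
  have hR0 : 0 ≤ R := (pairNorm_nonneg _ _).trans (hR xs us hz)
  have hL := h.L_pos
  refine ⟨L * Real.sqrt (dimPos n m) * R + vecNorm1 (S.h xs us),
    add_nonneg (by positivity) (vecNorm1_nonneg _), fun y v hy i => ?_⟩
  have h1 := (abs_le_vecNorm1 (S.h y v - S.h xs us) i).trans (h.vecNorm1_h_sub_le hz hy)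
  have h2 := abs_le_vecNorm1 (S.h xs us) i
  have h3 : L * Real.sqrt (dimPos n m) * pairNorm (y - xs) (v - us)
      ≤ L * Real.sqrt (dimPos n m) * R :=
    mul_le_mul_of_nonneg_left (hR y v hy) (by positivity)
  have h4 : |S.h y v i| ≤ |(S.h y v - S.h xs us) i| + |S.h xs us i| := by
    have := abs_add_le ((S.h y v - S.h xs us) i) (S.h xs us i)
    rwa [Pi.sub_apply, sub_add_cancel] at this
  linarith

theorem Regular.h_mem_range (h : S.Regular L) {y : EuclideanSpace ℝ (Fin n)}
    {v : EuclideanSpace ℝ (Fin m)} (hy : (y, v) ∈ S.Z) (i : Fin p) :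
    sInf ((fun z => S.h z.1 z.2 i) '' S.Z) ≤ S.h y v i ∧
      S.h y v i ≤ sSup ((fun z => S.h z.1 z.2 i) '' S.Z) := by
  obtain ⟨C, -, hC⟩ := h.exists_abs_h_le hy
  constructor
  · refine csInf_le ⟨-C, ?_⟩ ⟨(y, v), hy, rfl⟩
    rintro _ ⟨z, hz, rfl⟩
    exact (abs_le.1 (hC _ _ hz i)).1
  · refine le_csSup ⟨C, ?_⟩ ⟨(y, v), hy, rfl⟩
    rintro _ ⟨z, hz, rfl⟩
    exact (abs_le.1 (hC _ _ hz i)).2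

theorem Regular.steadyStorage_mem (h : S.Regular L) (hz : (xs, us) ∈ S.Z) :
    S.steadyStorage xs us ∈ S.storages := fun i _ => h.h_mem_range hz i

theorem Regular.traj_mem (h : S.Regular L) (hx : x ∈ S.X) (hu : S.Admissible N x H u) {k : ℕ}
    (hk : k ≤ N) : S.traj x u k ∈ S.X := by
  cases k with
  | zero => exact hx
  | succ k => exact h.mapsTo _ _ (hu.mem k hk)

theorem Regular.store_mem (h : S.Regular L) (hH : H ∈ S.storages) (hu : S.Admissible N x H u)
    {k : ℕ} (hk : k ≤ N) : S.store x H u k ∈ S.storages := by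
  intro i j
  rw [store]
  have := j.2
  rcases lt_or_ge (k + (j : ℕ)) (T - 1) with h1 | h1
  · rw [S.hist_of_lt h1]
    exact hH i _
  · rw [S.hist_of_le h1]
    exact h.h_mem_range (hu.mem _ (by omega)) i

theorem isCompact_storages : IsCompact S.storages := by
  have : S.storages = Set.pi (univ : Set (Fin p)) fun i => (Set.pi (univ : Set (Fin (T - 1)))) fun _ =>
      Icc (sInf ((fun z => S.h z.1 z.2 i) '' S.Z)) (sSup ((fun z => S.h z.1 z.2 i) '' S.Z)) := by
    ext H
    exact ⟨fun h i _ j _ => h i j, fun h i j => h i trivial j trivial⟩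
  rw [this]
  exact isCompact_univ_pi fun i => isCompact_univ_pi fun _ => isCompact_Icc

/-- The solution under `u` is close to the steady state at time `P`, together with the `T - 1`
preceding state-input pairs. -/
structure Near (S : ControlProblem n m p T) (xs : EuclideanSpace ℝ (Fin n))
    (us : EuclideanSpace ℝ (Fin m)) (σ : ℝ) (P : ℕ) (x : EuclideanSpace ℝ (Fin n))
    (u : ℕ → EuclideanSpace ℝ (Fin m)) : Prop where
  le : T - 1 ≤ P
  state : ‖S.traj x u P - xs‖ ≤ σ
  pair : ∀ k, k < P → P ≤ k + (T - 1) → pairNorm (S.traj x u k - xs) (u k - us) ≤ σ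

/-- Since `T - 1 ≤ P`, no initially stored column is left at time `P`; every column is an output at
one of the last `T - 1` pairs, to which the Lipschitz bound applies. -/
theorem Near.matNorm1_store_le {σ : ℝ} (h : S.Near xs us σ P x u) (hS : S.Regular L)
    (hz : (xs, us) ∈ S.Z) (hσ : 0 ≤ σ) (hu : S.Admissible P x H u) :
    matNorm1 (S.store x H u P - S.steadyStorage xs us) ≤ L * Real.sqrt (dimPos n m) * σ := by
  have hL := hS.L_pos
  refine matNorm1_le (by positivity) fun j => ?_
  have hj := j.2
  have hP := h.le
  have h1 : (fun i => (S.store x H u P - S.steadyStorage xs us) i j)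
      = S.h (S.traj x u (P + j - (T - 1))) (u (P + j - (T - 1))) - S.h xs us := by
    funext i
    rw [Matrix.sub_apply, store, S.hist_of_le (by omega)]
    rfl
  rw [h1]
  refine (hS.vecNorm1_h_sub_le hz (hu.mem _ (by omega))).trans ?_
  exact mul_le_mul_of_nonneg_left (h.pair _ (by omega) (by omega)) (by positivity)

end ControlProblem

end

theorem ClassKLS.sum_le {β : ℝ → ℝ → ℝ} (h : ClassKLS β) {r : ℝ} (hr : 0 ≤ r) (N : ℕ) :
    ∑ k ∈ Finset.range N, β r k ≤ ∑' k : ℕ, β r k :=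
  (h.summable r hr).sum_le_tsum _ fun k _ => (h.classK k (Nat.cast_nonneg k)).nonneg hr

namespace ControlProblem

variable {n m p T : ℕ} {S : ControlProblem n m p T}
  {x xs : EuclideanSpace ℝ (Fin n)} {us : EuclideanSpace ℝ (Fin m)} {H : Storage p T}
  {u v w : ℕ → EuclideanSpace ℝ (Fin m)} {N M P : ℕ} {L : ℝ}
  {lam : EuclideanSpace ℝ (Fin n) → ℝ} {lbar : Fin p → ℝ} {rho psi : ℝ → ℝ} {a ω : ℝ}
  {ustar utilde : ℕ → EuclideanSpace ℝ (Fin n) → Storage p T → ℕ → EuclideanSpace ℝ (Fin m)}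

/-- The standing assumptions on the predictive control scheme. -/
structure MPCSetting (S : ControlProblem n m p T) (xs : EuclideanSpace ℝ (Fin n))
    (us : EuclideanSpace ℝ (Fin m))
    (ustar utilde : ℕ → EuclideanSpace ℝ (Fin n) → Storage p T → ℕ → EuclideanSpace ℝ (Fin m))
    (L : ℝ) (lam : EuclideanSpace ℝ (Fin n) → ℝ) (lbar : Fin p → ℝ) (rho psi : ℝ → ℝ)
    (a ω : ℝ) : Prop where
  two_le : 2 ≤ T
  steady : S.IsOptimalSteadyState xs us
  ustar_min : ∀ N, ∀ x ∈ S.X, ∀ H ∈ S.storages,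
    S.IsMinimizer (S.cost N x) N x H (ustar N x H)
  utilde_min : ∀ N, ∀ x ∈ S.X, ∀ H ∈ S.storages,
    S.IsMinimizer (S.rotCost xs us lam lbar N x) N x H (utilde N x H)
  regular : S.Regular L
  dissipative : S.StrictlyDissipative xs us lam lbar rho
  controllable : S.AsymptoticallyControllable xs us lam lbar
  locallyControllable : S.LocallyControllable xs
  outputBound : S.OutputBound xs us lbar utilde psi
  polynomialBounds : S.PolynomialBounds xs us L rho psi a ω

/-! ### The steady state -/

theorem IsOptimalSteadyState.traj_const (h : S.IsOptimalSteadyState xs us) (k : ℕ) :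
    S.traj xs (fun _ => us) k = xs := by
  induction k with
  | zero => rfl
  | succ k ih => rw [traj, ih, h.steady]

theorem IsOptimalSteadyState.window_const (h : S.IsOptimalSteadyState xs us) (k : ℕ) :
    S.window xs (fun _ => us) k = S.steadyStorage xs us := by
  ext i j
  rw [window, out, h.traj_const]
  rfl

theorem IsOptimalSteadyState.admissible_const (h : S.IsOptimalSteadyState xs us) (hT : 1 ≤ T)
    (N : ℕ) : S.Admissible N xs (S.steadyStorage xs us) fun _ => us := by
  rw [S.admissible_iff hT]
  refine ⟨fun k _ => by rw [h.traj_const]; exact h.mem, fun s _ i =>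
    Finset.sum_nonpos fun k _ => ?_⟩
  rcases lt_or_ge (s + k) (T - 1) with h1 | h1
  · rw [S.hist_of_lt h1]
    exact h.out_nonpos i
  · rw [S.hist_of_le h1, out, h.traj_const]
    exact h.out_nonpos i

theorem IsOptimalSteadyState.matPos_steadyStorage (h : S.IsOptimalSteadyState xs us) :
    matPos (S.steadyStorage xs us : Storage p T) = 0 :=
  matPos_eq_zero fun i _ => h.out_nonpos i

/-! ### Moduli at the steady state and consequences of dissipativity -/

theorem Regular.exists_abs_ell_sub_le (h : S.Regular L) (hz : (xs, us) ∈ S.Z) {ε : ℝ}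
    (hε : 0 < ε) : ∃ σ > 0, ∀ y v, (y, v) ∈ S.Z → pairNorm (y - xs) (v - us) ≤ σ →
      |S.ell y v - S.ell xs us| ≤ ε := by
  obtain ⟨α, hα, H⟩ := h.cont_ell
  obtain ⟨σ, hσ, hασ⟩ := hα.toClassK.exists_le hε
  exact ⟨σ, hσ, fun y v hy hd => (H _ _ _ _ hy hz).trans (hασ _ (pairNorm_nonneg _ _) hd)⟩

theorem StrictlyDissipative.exists_abs_lam_le (h : S.StrictlyDissipative xs us lam lbar rho)
    (hx : xs ∈ S.X) {ε : ℝ} (hε : 0 < ε) :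
    ∃ σ > 0, ∀ y ∈ S.X, ‖y - xs‖ ≤ σ → |lam y| ≤ ε := by
  obtain ⟨α, hα, H⟩ := h.cont
  obtain ⟨σ, hσ, hασ⟩ := hα.toClassK.exists_le hε
  refine ⟨σ, hσ, fun y hy hd => ?_⟩
  have := (H y hy xs hx).trans (hασ _ (norm_nonneg _) hd)
  rwa [h.zero, sub_zero] at this

theorem StrictlyDissipative.rho_le_rotStage (h : S.StrictlyDissipative xs us lam lbar rho)
    {y : EuclideanSpace ℝ (Fin n)} {v : EuclideanSpace ℝ (Fin m)} (hy : (y, v) ∈ S.Z) :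
    rho (pairNorm (y - xs) (v - us)) ≤ S.rotStage xs us lam lbar y v := by
  have := h.dissip y v hy
  rw [rotStage]
  linarith

theorem StrictlyDissipative.rho_nonneg (h : S.StrictlyDissipative xs us lam lbar rho)
    (y : EuclideanSpace ℝ (Fin n)) (v : EuclideanSpace ℝ (Fin m)) :
    0 ≤ rho (pairNorm y v) := h.rho_class.toClassK.nonneg (pairNorm_nonneg _ _)

/-- The rotated cost dominates the accumulated distance from the steady state. -/
theorem StrictlyDissipative.sum_rho_le (h : S.StrictlyDissipative xs us lam lbar rho)
    (hu : S.Admissible N x H u) :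
    ∑ k ∈ Finset.range N, rho (pairNorm (S.traj x u k - xs) (u k - us))
      ≤ S.rotCost xs us lam lbar N x u := by
  rw [rotCost_eq_sum]
  exact Finset.sum_le_sum fun k hk => h.rho_le_rotStage (hu.mem k (Finset.mem_range.1 hk))

theorem StrictlyDissipative.rotCost_mono (h : S.StrictlyDissipative xs us lam lbar rho)
    (hu : S.Admissible N x H u) (hM : M ≤ N) :
    S.rotCost xs us lam lbar M x u ≤ S.rotCost xs us lam lbar N x u := by
  rw [rotCost_eq_sum, rotCost_eq_sum]
  refine Finset.sum_le_sum_of_subset_of_nonneg (Finset.range_mono hM) fun k hk _ => ?_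
  exact (h.rho_nonneg _ _).trans (h.rho_le_rotStage (hu.mem k (Finset.mem_range.1 hk)))

theorem StrictlyDissipative.rotCost_nonneg (h : S.StrictlyDissipative xs us lam lbar rho)
    (hu : S.Admissible N x H u) : 0 ≤ S.rotCost xs us lam lbar N x u :=
  (Finset.sum_nonneg fun _ _ => h.rho_nonneg _ _).trans (h.sum_rho_le hu)

/-- Dissipativity supplies the lower bound without which the infimum would not be meaningful. -/
theorem StrictlyDissipative.rotValue_le (h : S.StrictlyDissipative xs us lam lbar rho)
    (hu : S.Admissible N x H u) :
    S.rotValue xs us lam lbar N x H ≤ S.rotCost xs us lam lbar N x u := by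
  refine csInf_le ⟨0, ?_⟩ ⟨u, hu, rfl⟩
  rintro _ ⟨v, hv, rfl⟩
  exact h.rotCost_nonneg hv

theorem IsMinimizer.rotValue_eq
    (h : S.IsMinimizer (S.rotCost xs us lam lbar N x) N x H u) :
    S.rotValue xs us lam lbar N x H = S.rotCost xs us lam lbar N x u := by
  refine IsLeast.csInf_eq ⟨⟨u, h.1, rfl⟩, ?_⟩
  rintro _ ⟨v, hv, rfl⟩
  exact h.2 v hv

/-- Uniform bounds for the costs of suitable admissible inputs. -/
theorem AsymptoticallyControllable.exists_bound
    (h : S.AsymptoticallyControllable xs us lam lbar) :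
    ∃ B₁ B₂, ClassK B₁ ∧ ClassK B₂ ∧ ∀ x ∈ S.X, ∀ H ∈ S.storages, ∀ N : ℕ, ∃ u,
      S.Admissible N x H u ∧
      S.cost N x u - N * S.ell xs us
        ≤ B₁ ‖x - xs‖ + B₂ (matPos (H - S.steadyStorage xs us)) ∧
      S.rotCost xs us lam lbar N x u
        ≤ B₁ ‖x - xs‖ + B₂ (matPos (H - S.steadyStorage xs us)) := by
  obtain ⟨β₁, β₂, h1, h2, hb⟩ := h
  refine ⟨_, _, h1.classK_sum, h2.classK_sum, fun x hx H hH N => ?_⟩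
  obtain ⟨u, hu, hub⟩ := hb x hx H hH N
  have hsum : ∑ k ∈ Finset.range N, (β₁ ‖x - xs‖ k
      + β₂ (matPos (H - S.steadyStorage xs us)) k)
      ≤ ∑' k : ℕ, β₁ ‖x - xs‖ k + ∑' k : ℕ, β₂ (matPos (H - S.steadyStorage xs us)) k := by
    rw [Finset.sum_add_distrib]
    exact add_le_add (h1.sum_le (norm_nonneg _) N) (h2.sum_le (matPos_nonneg _) N)
  refine ⟨u, hu, le_trans ?_ hsum, le_trans ?_ hsum⟩
  · have : S.cost N x u - N * S.ell xs us
        = ∑ k ∈ Finset.range N, (S.ell (S.traj x u k) (u k) - S.ell xs us) := by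
      simp [cost]
    rw [this]
    exact Finset.sum_le_sum fun k hk => (hub k (Finset.mem_range.1 hk)).1
  · rw [rotCost_eq_sum]
    exact Finset.sum_le_sum fun k hk => (hub k (Finset.mem_range.1 hk)).2

/-! ### Extending and exchanging inputs near the steady state -/

namespace MPCSetting

variable (A : MPCSetting S xs us ustar utilde L lam lbar rho psi a ω)

include A

theorem one_le : 1 ≤ T := by
  have := A.two_le
  omega

theorem xs_mem : xs ∈ S.X := (A.regular.subset A.steady.mem).1

theorem steadyStorage_mem : S.steadyStorage xs us ∈ S.storages :=
  A.regular.steadyStorage_mem A.steady.mem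

/-- Close to the steady state at time `P`, the rotated value function exceeds the rotated cost up
to time `P` only slightly. -/
theorem exists_rotValue_le {ε : ℝ} (hε : 0 < ε) : ∃ σ > 0, ∀ x ∈ S.X, ∀ H ∈ S.storages,
    ∀ N P, P ≤ N → ∀ u, S.Admissible P x H u → S.Near xs us σ P x u →
      S.rotValue xs us lam lbar N x H ≤ S.rotCost xs us lam lbar P x u + ε := by
  obtain ⟨B₁, B₂, hB₁, hB₂, hB⟩ := A.controllable.exists_bound
  obtain ⟨σ₁, hσ₁, h1⟩ := hB₁.exists_le (half_pos hε)
  obtain ⟨σ₂, hσ₂, h2⟩ := hB₂.exists_le (half_pos hε)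
  have hL := A.regular.L_pos
  have hC : 0 < L * Real.sqrt (dimPos n m) := mul_pos hL (Real.sqrt_pos.2 dimPos_pos)
  refine ⟨min σ₁ (σ₂ / (L * Real.sqrt (dimPos n m))), lt_min hσ₁ (div_pos hσ₂ hC),
    fun x hx H hH N P hPN u hu hnear => ?_⟩
  -- From time `P` on, asymptotic controllability provides a continuation whose rotated cost is
  -- small, because both the state and the storage at time `P` are near their steady values.
  obtain ⟨w, hw, -, hwb⟩ := hB _ (A.regular.traj_mem hx hu le_rfl) _
    (A.regular.store_mem hH hu le_rfl) (N - P)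
  have hcat := hu.concat A.one_le hw
  have := A.dissipative.rotValue_le hcat
  rw [rotCost_concat, Nat.add_sub_cancel' hPN] at this
  have h3 := h1 _ (norm_nonneg _) (hnear.state.trans (min_le_left _ _))
  have h4 := h2 _ (matPos_nonneg (S.store x H u P - S.steadyStorage xs us)) (by
    refine (matPos_le_matNorm1 _).trans ((hnear.matNorm1_store_le A.regular A.steady.mem
      (lt_min hσ₁ (div_pos hσ₂ hC)).le hu).trans ?_)
    rw [← le_div_iff₀' hC]
    exact min_le_right _ _)
  linarith

/-- Two inputs which both lead close to the steady state at time `P` can be exchanged: up to time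
`P` the optimal input is not essentially worse. -/
theorem exists_cost_le : ∃ d : ℕ, ∀ ε > 0, ∃ σ > 0, ∀ x ∈ S.X, ∀ H ∈ S.storages,
    ∀ N P, P + d + T ≤ N → ∀ v, S.Admissible P x H v → S.Near xs us σ P x v →
      (∀ k, P ≤ k → k < P + d + T →
        pairNorm (S.traj x (ustar N x H) k - xs) (ustar N x H k - us) ≤ σ) →
      S.cost P x (ustar N x H) ≤ S.cost P x v + ε := by
  obtain ⟨δc, hδc, Eh, hEh, d, hdT, γx, γu, hγx, hγu, hloc⟩ := A.locallyControllable
  refine ⟨d, fun ε hε => ?_⟩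
  have hT := A.two_le
  have hd : (0 : ℝ) < d := by
    have : 0 < d := by omega
    exact_mod_cast this
  -- The stage cost is compared with the steady cost on two segments of length `d`, the bridge and
  -- the piece of the optimal solution it replaces; hence the tolerance `ε / (2 * d)`.
  obtain ⟨σℓ, hσℓ, hell⟩ := A.regular.exists_abs_ell_sub_le A.steady.mem
    (show 0 < ε / (2 * d) by positivity)
  obtain ⟨σ₁, hσ₁, h1⟩ := hγx.toClassK.exists_le (half_pos hσℓ)
  obtain ⟨σ₂, hσ₂, h2⟩ := hγu.toClassK.exists_le (half_pos hσℓ)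
  have hL := A.regular.L_pos
  set C := L * Real.sqrt (dimPos n m) with hCdef
  have hC : 0 ≤ C := by positivity
  set b := min Eh (min σ₁ σ₂) with hb
  have hb0 : 0 < b := lt_min hEh (lt_min hσ₁ hσ₂)
  -- The last entry keeps state deviation plus storage deviation, at most `σ + C * σ`, below `b`,
  -- and thus within the range of local controllability and of the moduli of `γx` and `γu`.
  set σ := min (min σℓ δc) (b / (1 + C)) with hσdef
  have hσ : 0 < σ := lt_min (lt_min hσℓ hδc) (by positivity)
  have hσb : σ + C * σ ≤ b := by
    have : σ ≤ b / (1 + C) := min_le_right _ _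
    rw [le_div_iff₀ (by positivity)] at this
    linarith
  have hσδ : σ ≤ δc := (min_le_left _ _).trans (min_le_right _ _)
  have hσσ : σ ≤ σℓ := (min_le_left _ _).trans (min_le_left _ _)
  have hCσ : 0 ≤ C * σ := by positivity
  have hbE : b ≤ Eh := min_le_left _ _
  refine ⟨σ, hσ, fun x hx H hH N P hN v hv hnear hclose => ?_⟩
  obtain ⟨M, rfl⟩ := Nat.exists_eq_add_of_le (show P + d ≤ N by omega)
  set u := ustar (P + d + M) x H with hu
  have humin := A.ustar_min (P + d + M) x hx H hH
  rw [← hu] at humin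
  have hadm : S.Admissible (P + (d + M)) x H u := by
    rw [← add_assoc]
    exact humin.1
  have hP : S.Admissible P x H u := hadm.mono (by omega)
  set x₁ := S.traj x u P with hx₁
  set u₁ : ℕ → EuclideanSpace ℝ (Fin m) := fun j => u (P + j) with hu₁
  have hwin : matNorm1 (S.window x₁ u₁ d - S.steadyStorage xs us) ≤ C * σ := by
    refine matNorm1_le hCσ fun j => ?_
    have hj := j.2
    have h3 : (fun i => (S.window x₁ u₁ d - S.steadyStorage xs us) i j)
        = S.h (S.traj x u (P + (d + j))) (u (P + (d + j))) - S.h xs us := by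
      funext i
      rw [Matrix.sub_apply, window, hx₁, ← S.out_add]
      rfl
    rw [h3]
    refine (A.regular.vecNorm1_h_sub_le A.steady.mem (hadm.mem _ (by omega))).trans ?_
    exact mul_le_mul_of_nonneg_left (hclose _ (by omega) (by omega)) hC
  have hst := hnear.matNorm1_store_le A.regular A.steady.mem hσ.le hv
  rw [← hCdef] at hst
  have hx3 : ‖S.traj x₁ u₁ d - xs‖ ≤ σ := by
    rw [hx₁, ← S.traj_add]
    exact (norm_le_pairNorm _ _).trans (hclose _ (by omega) (by omega))
  -- Local controllability with the constant steady solution as reference: the bridge starts where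
  -- `v` arrives at time `P` and joins the optimal solution at time `P + d`.
  obtain ⟨u₂, hu₂, hu₂d, hjoin, hγ1, hγ2⟩ := hloc xs A.xs_mem (S.steadyStorage xs us)
    A.steadyStorage_mem (fun _ => us) (A.steady.admissible_const A.one_le _)
    (by rw [A.steady.matPos_steadyStorage]; exact hEh.le)
    (fun k _ => by rw [A.steady.traj_const, sub_self, norm_zero]; exact hδc.le)
    (d + M) (by omega) x₁ (A.regular.traj_mem hx hP le_rfl) (S.store x H u P)
    (A.regular.store_mem hH hP le_rfl) u₁ (hadm.drop A.one_le)
    (by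
      rw [A.steady.window_const]
      exact ((matPos_le_matNorm1 _).trans hwin).trans (by linarith))
    (hx3.trans hσδ) (S.traj x v P) (A.regular.traj_mem hx hv le_rfl) (hnear.state.trans hσδ)
    (S.store x H v P) (A.regular.store_mem hH hv le_rfl)
    ((matPos_le_matNorm1 _).trans (hst.trans (by linarith)))
  rw [A.steady.window_const, A.steady.traj_const] at hγ1 hγ2
  set ζ := max (‖S.traj x v P - xs‖ + matPos (S.store x H v P - S.steadyStorage xs us))
    (‖S.traj x₁ u₁ d - xs‖ + matPos (S.window x₁ u₁ d - S.steadyStorage xs us)) with hζ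
  have hζ0 : 0 ≤ ζ := le_max_of_le_left (add_nonneg (norm_nonneg _) (matPos_nonneg _))
  have hζb : ζ ≤ b := max_le
    ((add_le_add hnear.state ((matPos_le_matNorm1 _).trans hst)).trans hσb)
    ((add_le_add hx3 ((matPos_le_matNorm1 _).trans hwin)).trans hσb)
  have hγxζ := h1 ζ hζ0 (hζb.trans ((min_le_right _ _).trans (min_le_left _ _)))
  have hγuζ := h2 ζ hζ0 (hζb.trans ((min_le_right _ _).trans (min_le_right _ _)))
  set w : ℕ → EuclideanSpace ℝ (Fin m) := fun k => if k < d then u₂ k else u₁ k with hw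
  have hwu₂ : ∀ k < d, w k = u₂ k := fun k hk => if_pos hk
  -- The competitor follows `v`, then the bridge, then the optimal tail. Both tails start from the
  -- same state under the same input, so their costs cancel.
  have hopt := humin.2 (concat P v w) (by
    rw [add_assoc]
    exact hv.concat A.one_le hjoin)
  rw [add_assoc, cost_add, cost_concat, cost_add d, cost_add d, ← hx₁, ← hu₁] at hopt
  rw [S.traj_congr hwu₂ le_rfl, hu₂d, cost_congr hwu₂,
    show (fun j => w (d + j)) = fun j => u₁ (d + j) from funext fun j => if_neg (by omega)] at hopt
  have hlow : d * (S.ell xs us - ε / (2 * d)) ≤ S.cost d x₁ u₁ := by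
    have := Finset.card_nsmul_le_sum (Finset.range d)
      (fun k => S.ell (S.traj x₁ u₁ k) (u₁ k)) (S.ell xs us - ε / (2 * d)) fun k hk => by
        have hk := Finset.mem_range.1 hk
        rw [hx₁, ← S.traj_add]
        have := hell _ _ (hadm.mem (P + k) (by omega)) ((hclose (P + k) (by omega)
          (by omega)).trans hσσ)
        have := (abs_le.1 this).1
        linarith
    simpa [cost] using this
  have hup : S.cost d (S.traj x v P) u₂ ≤ d * (S.ell xs us + ε / (2 * d)) := by
    have := Finset.sum_le_card_nsmul (Finset.range d)
      (fun k => S.ell (S.traj (S.traj x v P) u₂ k) (u₂ k)) (S.ell xs us + ε / (2 * d))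
      fun k hk => by
        have hk := Finset.mem_range.1 hk
        have h5 := hγ1 k hk.le
        rw [A.steady.traj_const] at h5
        have h6 := hγ2 k hk
        have := hell _ _ (hu₂.mem k hk) ((pairNorm_le_add _ _).trans (by linarith))
        have := (abs_le.1 this).2
        linarith
    simpa only [cost, Finset.card_range, nsmul_eq_mul] using this
  have h7 : d * (S.ell xs us + ε / (2 * d)) - d * (S.ell xs us - ε / (2 * d)) = ε := by
    field_simp
    ring
  linarith

end MPCSetting

end ControlProblem

/-! ### Blocks with small sums -/

/-- If a sequence has a small sum over many blocks, then it is small on one of them. -/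
theorem exists_block_lt {g : ℕ → ℝ} {C σ : ℝ} {R B : ℕ}
    (hsum : ∑ k ∈ Finset.range (R * B), g k ≤ C) (hnn : ∀ k, 0 ≤ g k) (hC : C < R * σ) :
    ∃ i < R, ∀ k < B, g (i * B + k) < σ := by
  by_contra! hcon
  have key : ∀ Q ≤ R, Q * σ ≤ ∑ k ∈ Finset.range (Q * B), g k := by
    intro Q
    induction Q with
    | zero => simp
    | succ Q ih =>
      intro hQ
      obtain ⟨k, hk, hg⟩ := hcon Q hQ
      rw [add_mul, one_mul, Finset.sum_range_add]
      have h1 := Finset.single_le_sum (f := fun k => g (Q * B + k)) (fun k _ => hnn _)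
        (Finset.mem_range.2 hk)
      have h2 := ih (by omega)
      push_cast
      linarith
  have := key R le_rfl
  linarith

theorem sum_range_shift_le {g : ℕ → ℝ} (hnn : ∀ k, 0 ≤ g k) {s M N : ℕ} (h : s + M ≤ N) :
    ∑ k ∈ Finset.range M, g (s + k) ≤ ∑ k ∈ Finset.range N, g k := by
  have h1 : ∑ k ∈ Finset.range (s + M), g k ≤ ∑ k ∈ Finset.range N, g k :=
    Finset.sum_le_sum_of_subset_of_nonneg (Finset.range_mono h) fun k _ _ => hnn k
  rw [Finset.sum_range_add] at h1
  have h2 : 0 ≤ ∑ k ∈ Finset.range s, g k := Finset.sum_nonneg fun k _ => hnn k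
  linarith

theorem sum_dotProduct_le {p : ℕ} {l : Fin p → ℝ} (hl : ∀ i, 0 ≤ l i) {y : ℕ → Fin p → ℝ}
    {M : ℕ} {C : ℝ} (h : ∀ i, ∑ k ∈ Finset.range M, y k i ≤ C) :
    ∑ k ∈ Finset.range M, l ⬝ᵥ y k ≤ (∑ i, l i) * C := by
  simp only [dotProduct]
  rw [Finset.sum_comm, Finset.sum_mul]
  refine Finset.sum_le_sum fun i _ => ?_
  rw [← Finset.mul_sum]
  exact mul_le_mul_of_nonneg_left (h i) (hl i)

/-! ### Closed-loop admissibility, compactness and the turnpike property -/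

namespace ControlProblem

variable {n m p T : ℕ} {S : ControlProblem n m p T}
  {x xs : EuclideanSpace ℝ (Fin n)} {us : EuclideanSpace ℝ (Fin m)} {H : Storage p T}
  {u v w : ℕ → EuclideanSpace ℝ (Fin m)} {N M P : ℕ} {L : ℝ}
  {lam : EuclideanSpace ℝ (Fin n) → ℝ} {lbar : Fin p → ℝ} {rho psi : ℝ → ℝ} {a ω : ℝ}
  {ustar utilde : ℕ → EuclideanSpace ℝ (Fin n) → Storage p T → ℕ → EuclideanSpace ℝ (Fin m)}

/-- The input sequence generated by the closed loop. -/
def clInput (S : ControlProblem n m p T)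
    (ustar : ℕ → EuclideanSpace ℝ (Fin n) → Storage p T → ℕ → EuclideanSpace ℝ (Fin m)) (N : ℕ)
    (χ : EuclideanSpace ℝ (Fin n) × Storage p T) (k : ℕ) : EuclideanSpace ℝ (Fin m) :=
  ustar N (S.closedLoop ustar N k χ).1 (S.closedLoop ustar N k χ).2 0

/-- The closed loop is regarded as an open-loop solution, so that the results on cutting and joining
apply to it. -/
theorem closedLoop_eq (N k : ℕ) (x : EuclideanSpace ℝ (Fin n)) (H : Storage p T) :
    S.closedLoop ustar N k (x, H)
      = (S.traj x (S.clInput ustar N (x, H)) k, S.store x H (S.clInput ustar N (x, H)) k) := by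
  induction k with
  | zero => rw [store_zero]; rfl
  | succ k ih =>
    rw [closedLoop_succ, ih, clStep_eq, traj_add, store_add]
    have h : ∀ j < 1, ustar N (S.traj x (S.clInput ustar N (x, H)) k)
        (S.store x H (S.clInput ustar N (x, H)) k) j = S.clInput ustar N (x, H) (k + j) := by
      intro j hj
      obtain rfl : j = 0 := by omega
      rw [add_zero, clInput, ih]
    rw [S.traj_congr h le_rfl, S.store_congr h le_rfl]

namespace MPCSetting

variable (A : MPCSetting S xs us ustar utilde L lam lbar rho psi a ω)

include A

/-- The closed loop stays in the constraint set and satisfies the average constraints. -/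
theorem closedLoop_mem_and_admissible (hN : 1 ≤ N) (hx : x ∈ S.X) (hH : H ∈ S.storages) (k : ℕ) :
    S.traj x (S.clInput ustar N (x, H)) k ∈ S.X ∧
      S.store x H (S.clInput ustar N (x, H)) k ∈ S.storages ∧
      S.Admissible k x H (S.clInput ustar N (x, H)) := by
  induction k with
  | zero =>
    refine ⟨hx, ?_, fun _ h => by omega, fun _ _ _ _ => by omega, fun _ h => ?_⟩
    · rwa [store_zero]
    · have := A.two_le
      omega
  | succ k ih =>
    obtain ⟨h1, h2, h3⟩ := ih
    set c := S.clInput ustar N (x, H) with hc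
    have h4 := (A.ustar_min N _ h1 _ h2).1.mono hN
    have h5 : ∀ j < 1, ustar N (S.traj x c k) (S.store x H c k) j = c (k + j) := by
      intro j hj
      obtain rfl : j = 0 := by omega
      rw [add_zero, hc, clInput, closedLoop_eq]
    have h6 : S.Admissible 1 (S.traj x c k) (S.store x H c k) fun j => c (k + j) := by
      rw [S.admissible_iff A.one_le] at h4 ⊢
      refine ⟨fun j hj => ?_, fun s hs i => ?_⟩
      · rw [← S.traj_congr h5 hj.le, ← h5 j hj]
        exact h4.1 j hj
      · refine le_of_eq_of_le (Finset.sum_congr rfl fun j hj => ?_) (h4.2 s hs i)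
        have := Finset.mem_range.1 hj
        rw [S.hist_congr h5 (by omega)]
    have h7 : S.Admissible (k + 1) x H c := by
      have h8 := h3.concat A.one_le h6
      have h9 : concat k c (fun j => c (k + j)) = c := by
        funext j
        rcases lt_or_ge j k with hj | hj
        · rw [concat_of_lt hj]
        · obtain ⟨j, rfl⟩ := Nat.exists_eq_add_of_le hj
          rw [concat_add]
      rwa [h9] at h8
    exact ⟨A.regular.traj_mem hx h7 le_rfl, A.regular.store_mem hH h7 le_rfl, h7⟩

/-- Every state admits an admissible input of length one, so `X` is the projection of the compact
set `Z`. -/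
theorem isCompact_X : IsCompact S.X := by
  have : S.X = Prod.fst '' S.Z := by
    ext y
    constructor
    · intro hy
      exact ⟨_, (A.ustar_min 1 y hy _ A.steadyStorage_mem).1.mem 0 one_pos, rfl⟩
    · rintro ⟨z, hz, rfl⟩
      exact (A.regular.subset hz).1
  rw [this]
  exact A.regular.compact.image continuous_fst

omit A in
theorem continuous_dist (xs : EuclideanSpace ℝ (Fin n)) (Hs : Storage p T) :
    Continuous fun χ : EuclideanSpace ℝ (Fin n) × Storage p T =>
      ‖χ.1 - xs‖ + matNorm1 (χ.2 - Hs) :=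
  (by fun_prop : Continuous fun χ : EuclideanSpace ℝ (Fin n) × Storage p T => ‖χ.1 - xs‖).add
    (continuous_matNorm1.comp (by fun_prop))

theorem exists_dist_le : ∃ R, 0 ≤ R ∧ ∀ x ∈ S.X, ∀ H ∈ S.storages,
    ‖x - xs‖ + matNorm1 (H - S.steadyStorage xs us) ≤ R := by
  obtain ⟨R, hR⟩ := ((A.isCompact_X.prod S.isCompact_storages).image
    (continuous_dist xs (S.steadyStorage xs us))).bddAbove
  have h : ∀ x ∈ S.X, ∀ H ∈ S.storages,
      ‖x - xs‖ + matNorm1 (H - S.steadyStorage xs us) ≤ R := fun x hx H hH =>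
    hR ⟨(x, H), ⟨hx, hH⟩, rfl⟩
  exact ⟨R, (add_nonneg (norm_nonneg _) (matNorm1_nonneg _)).trans
    (h xs A.xs_mem _ A.steadyStorage_mem), h⟩

/-- Bounds for the costs of suitable admissible inputs which are uniform in the extended state. -/
theorem exists_cost_bound : ∃ C, 0 ≤ C ∧ ∀ x ∈ S.X, ∀ H ∈ S.storages, ∀ N : ℕ, ∃ u,
      S.Admissible N x H u ∧ S.cost N x u - N * S.ell xs us ≤ C ∧
      S.rotCost xs us lam lbar N x u ≤ C := by
  obtain ⟨B₁, B₂, hB₁, hB₂, hB⟩ := A.controllable.exists_bound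
  obtain ⟨R, hR0, hR⟩ := A.exists_dist_le
  refine ⟨B₁ R + B₂ R, add_nonneg (hB₁.nonneg hR0) (hB₂.nonneg hR0), fun x hx H hH N => ?_⟩
  obtain ⟨u, hu, h1, h2⟩ := hB x hx H hH N
  have h3 := hR x hx H hH
  have h4 := matNorm1_nonneg (H - S.steadyStorage xs us)
  have h5 : B₁ ‖x - xs‖ ≤ B₁ R := hB₁.mono (norm_nonneg _) (by linarith)
  have h6 : B₂ (matPos (H - S.steadyStorage xs us)) ≤ B₂ R :=
    hB₂.mono (matPos_nonneg _) ((matPos_le_matNorm1 _).trans (by linarith [norm_nonneg (x - xs)]))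
  exact ⟨u, hu, by linarith, by linarith⟩

/-- The accumulated distance of optimal solutions from the steady state is bounded. -/
theorem exists_sum_rho_le : ∃ C, 0 ≤ C ∧ ∀ x ∈ S.X, ∀ H ∈ S.storages, ∀ N : ℕ,
    ∑ k ∈ Finset.range N, rho (pairNorm (S.traj x (ustar N x H) k - xs) (ustar N x H k - us))
      ≤ C ∧
    ∑ k ∈ Finset.range N, rho (pairNorm (S.traj x (utilde N x H) k - xs) (utilde N x H k - us))
      ≤ C := by
  obtain ⟨C, hC0, hC⟩ := A.exists_cost_bound
  obtain ⟨Λ, hΛ⟩ := A.dissipative.bounded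
  obtain ⟨K, hK0, hK⟩ := A.regular.exists_abs_h_le A.steady.mem
  have hΛ0 : 0 ≤ Λ := (abs_nonneg _).trans (hΛ xs A.xs_mem)
  have hl := A.dissipative.multiplier_nonneg
  have hlsum : 0 ≤ ∑ i, lbar i := Finset.sum_nonneg fun i _ => hl i
  have hlK : 0 ≤ (∑ i, lbar i) * (T * K) := by positivity
  refine ⟨C + 2 * Λ + (∑ i, lbar i) * (T * K), by positivity, fun x hx H hH N => ?_⟩
  obtain ⟨v, hv, h1, h2⟩ := hC x hx H hH N
  have hmin := A.ustar_min N x hx H hH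
  have hmint := A.utilde_min N x hx H hH
  constructor
  -- The input minimizes the original cost only. Passing to the rotated cost adds at most two values
  -- of the bounded storage function and an output sum that is bounded independently of the horizon.
  · refine (A.dissipative.sum_rho_le hmin.1).trans ?_
    have h3 := hmin.2 v hv
    have h4 := (abs_le.1 (hΛ x hx)).2
    have h5 := (abs_le.1 (hΛ _ (A.regular.traj_mem hx hmin.1 le_rfl))).1
    have h6 := sum_dotProduct_le hl (hmin.1.sum_out_le A.one_le hK0 fun k hk i =>
      (le_abs_self _).trans (hK _ _ (hmin.1.mem k hk) i))
    rw [rotCost]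
    linarith
  · refine (A.dissipative.sum_rho_le hmint.1).trans ((hmint.2 v hv).trans ?_)
    linarith

/-- For long horizons there is a time at which the optimal solutions from the first closed-loop
states and the solution of the rotated problem are all close to the steady state for many
consecutive steps. -/
theorem exists_turnpike (d : ℕ) {σ : ℝ} (hσ : 0 < σ) : ∃ N₀, ∀ N, N₀ ≤ N → ∀ x ∈ S.X,
    ∀ H ∈ S.storages, ∃ q, 2 ≤ q ∧ q * T + d + T ≤ N ∧
      (∀ χ, ∀ j ≤ T, χ = S.closedLoop ustar N j (x, H) →
        ∀ k, q * T ≤ k + j + (T - 1) → k + j < q * T + d + T →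
          pairNorm (S.traj χ.1 (ustar N χ.1 χ.2) k - xs) (ustar N χ.1 χ.2 k - us) ≤ σ) ∧
      ∀ k, q * T ≤ k + (T - 1) → k < q * T + d + T →
        pairNorm (S.traj x (utilde N x H) k - xs) (utilde N x H k - us) ≤ σ := by
  obtain ⟨C, hC0, hC⟩ := A.exists_sum_rho_le
  have hT := A.two_le
  have hρσ := A.dissipative.rho_class.toClassK.pos hσ
  -- The block must contain a window of length `d + 2 * T - 1`, and its length is a multiple of `T`
  -- so that a multiple of `T` can be placed at the same position in each block.
  set B := (d + 2) * T with hB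
  have hBge : d + 2 * T ≤ B := by
    have : d * 1 ≤ d * T := Nat.mul_le_mul_left d (by omega)
    rw [hB, add_mul]
    omega
  obtain ⟨R, hR⟩ := exists_nat_gt ((T + 2) * C / rho σ)
  rw [div_lt_iff₀ hρσ] at hR
  refine ⟨R * B + T + 1, fun N hN x hx H hH => ?_⟩
  have hmem : ∀ j, (S.closedLoop ustar N j (x, H)).1 ∈ S.X ∧
      (S.closedLoop ustar N j (x, H)).2 ∈ S.storages := by
    intro j
    rw [closedLoop_eq]
    have := A.closedLoop_mem_and_admissible (by omega : 1 ≤ N) hx hH j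
    exact ⟨this.1, this.2.1⟩
  set φ : ℕ → ℕ → ℝ := fun j k =>
    rho (pairNorm (S.traj (S.closedLoop ustar N j (x, H)).1 (ustar N
      (S.closedLoop ustar N j (x, H)).1 (S.closedLoop ustar N j (x, H)).2) k - xs)
      (ustar N (S.closedLoop ustar N j (x, H)).1 (S.closedLoop ustar N j (x, H)).2 k - us)) with hφ
  set φt : ℕ → ℝ := fun k =>
    rho (pairNorm (S.traj x (utilde N x H) k - xs) (utilde N x H k - us)) with hφt
  have hφ0 : ∀ j k, 0 ≤ φ j k := fun j k => A.dissipative.rho_nonneg _ _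
  have hφt0 : ∀ k, 0 ≤ φt k := fun k => A.dissipative.rho_nonneg _ _
  -- The shift by `T - j` aligns all solutions: the argument `k` refers to time `T + k` counted from
  -- the initial state. One pigeonhole argument thus serves `T + 2` solutions at once.
  set g : ℕ → ℝ := fun k => ∑ j ∈ Finset.range (T + 1), φ j (T - j + k) + φt (T + k) with hg
  have hsum : ∑ k ∈ Finset.range (R * B), g k ≤ (T + 2) * C := by
    rw [hg, Finset.sum_add_distrib, Finset.sum_comm]
    have h1 : ∑ j ∈ Finset.range (T + 1), ∑ k ∈ Finset.range (R * B), φ j (T - j + k)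
        ≤ (T + 1) * C := by
      refine (Finset.sum_le_card_nsmul _ _ C fun j _ => ?_).trans (by simp)
      exact (sum_range_shift_le (hφ0 j) (by omega : T - j + R * B ≤ N)).trans
        (hC _ (hmem j).1 _ (hmem j).2 N).1
    have h2 : ∑ k ∈ Finset.range (R * B), φt (T + k) ≤ C :=
      (sum_range_shift_le hφt0 (by omega : T + R * B ≤ N)).trans (hC x hx H hH N).2
    linarith
  obtain ⟨i, hiR, hi⟩ := exists_block_lt hsum
    (fun k => add_nonneg (Finset.sum_nonneg fun j _ => hφ0 _ _) (hφt0 _)) hR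
  have hiB : i * B + B ≤ R * B := by
    have := Nat.mul_le_mul_right B (show i + 1 ≤ R by omega)
    rwa [add_mul, one_mul] at this
  have hq : (i * (d + 2) + 2) * T = i * B + 2 * T := by rw [hB]; ring
  -- Block `i` starts at time `i * B + T`. The time `q * T = i * B + 2 * T` leaves room inside it
  -- for the `T - 1` preceding steps and the `d + T` steps from `q * T` on.
  refine ⟨i * (d + 2) + 2, by omega, by omega, ?_, ?_⟩
  · rintro χ j hj rfl k hk1 hk2
    rw [hq] at hk1 hk2
    have h1 := hi (k + j - T - i * B) (by omega)
    have h2 : φ j k ≤ g (i * B + (k + j - T - i * B)) := by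
      have h4 : T - j + (i * B + (k + j - T - i * B)) = k := by omega
      have h5 : φ j k ≤ ∑ l ∈ Finset.range (T + 1), φ l (T - l + (i * B + (k + j - T - i * B))) := by
        have h6 := Finset.single_le_sum
          (f := fun l => φ l (T - l + (i * B + (k + j - T - i * B)))) (s := Finset.range (T + 1))
          (fun l _ => hφ0 _ _) (Finset.mem_range.2 (by omega : j < T + 1))
        rwa [h4] at h6
      exact h5.trans (le_add_of_nonneg_right (hφt0 _))
    exact (A.dissipative.rho_class.toClassK.lt_of_lt (pairNorm_nonneg _ _) hσ.le
      (h2.trans_lt h1)).le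
  · intro k hk1 hk2
    rw [hq] at hk1 hk2
    have h1 := hi (k - T - i * B) (by omega)
    have h2 : φt k ≤ g (i * B + (k - T - i * B)) := by
      have h4 : T + (i * B + (k - T - i * B)) = k := by omega
      have h5 : g (i * B + (k - T - i * B)) = ∑ j ∈ Finset.range (T + 1),
          φ j (T - j + (i * B + (k - T - i * B))) + φt (T + (i * B + (k - T - i * B))) := rfl
      rw [h5, h4]
      exact le_add_of_nonneg_left (Finset.sum_nonneg fun l _ => hφ0 _ _)
    exact (A.dissipative.rho_class.toClassK.lt_of_lt (pairNorm_nonneg _ _) hσ.le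
      (h2.trans_lt h1)).le

end MPCSetting

end ControlProblem

/-! ### Decrease of the rotated value function over `T` steps -/

namespace ControlProblem

variable {n m p T : ℕ} {S : ControlProblem n m p T}
  {x xs : EuclideanSpace ℝ (Fin n)} {us : EuclideanSpace ℝ (Fin m)} {H : Storage p T}
  {u v w : ℕ → EuclideanSpace ℝ (Fin m)} {N M P : ℕ} {L : ℝ}
  {lam : EuclideanSpace ℝ (Fin n) → ℝ} {lbar : Fin p → ℝ} {rho psi : ℝ → ℝ} {a ω : ℝ}
  {ustar utilde : ℕ → EuclideanSpace ℝ (Fin n) → Storage p T → ℕ → EuclideanSpace ℝ (Fin m)}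

namespace MPCSetting

variable (A : MPCSetting S xs us ustar utilde L lam lbar rho psi a ω)

include A

/-- The rotated value function decreases over `T` steps of the closed loop, up to the bound `ψ`
and an error which vanishes for long horizons; the first optimal state-input pair is controlled by
the rotated value function. -/
theorem exists_rotValue_decrease {ε : ℝ} (hε : 0 < ε) : ∃ N₀, ∀ N, N₀ ≤ N → ∀ x ∈ S.X,
    ∀ H ∈ S.storages,
      S.rotValue xs us lam lbar N (S.closedLoop ustar N T (x, H)).1
          (S.closedLoop ustar N T (x, H)).2
        ≤ S.rotValue xs us lam lbar N x H
          - S.rotCost xs us lam lbar T x (S.clInput ustar N (x, H))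
          + S.psiBound xs us psi x H + ε ∧
      rho (pairNorm (x - xs) (ustar N x H 0 - us))
        ≤ S.rotValue xs us lam lbar N x H + S.psiBound xs us psi x H + ε := by
  have hT := A.two_le
  -- Error budget: `T + 1` exchanges of inputs, one extension to the full horizon, and two values of
  -- the storage function near the steady state.
  set e := ε / (T + 4) with he
  have he0 : 0 < e := by positivity
  have heT : (T + 4) * e = ε := by
    rw [he]
    field_simp
  have hTe : 0 ≤ T * e := by positivity
  obtain ⟨d, hcost⟩ := A.exists_cost_le
  obtain ⟨σ₁, hσ₁, hcost⟩ := hcost e he0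
  obtain ⟨σ₂, hσ₂, hval⟩ := A.exists_rotValue_le he0
  obtain ⟨σ₃, hσ₃, hlam⟩ := A.dissipative.exists_abs_lam_le A.xs_mem he0
  set σ := min σ₁ (min σ₂ σ₃) with hσdef
  have hσ : 0 < σ := lt_min hσ₁ (lt_min hσ₂ hσ₃)
  have hσ1 : σ ≤ σ₁ := min_le_left _ _
  have hσ2 : σ ≤ σ₂ := (min_le_right _ _).trans (min_le_left _ _)
  have hσ3 : σ ≤ σ₃ := (min_le_right _ _).trans (min_le_right _ _)
  have hnear : ∀ {τ P x u}, σ ≤ τ → T ≤ P → (∀ k, P ≤ k + (T - 1) → k ≤ P →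
      pairNorm (S.traj x u k - xs) (u k - us) ≤ σ) → S.Near xs us τ P x u := by
    intro τ P x u hτ hP h
    exact ⟨by omega, ((norm_le_pairNorm _ _).trans (h P (by omega) le_rfl)).trans hτ,
      fun k hk1 hk2 => (h k hk2 hk1.le).trans hτ⟩
  obtain ⟨N₀, hN₀⟩ := A.exists_turnpike d hσ
  refine ⟨N₀, fun N hN x hx H hH => ?_⟩
  obtain ⟨q, hq, hqN, hstar, htilde⟩ := hN₀ N hN x hx H hH
  have hN1 : 1 ≤ N := by omega
  set c := S.clInput ustar N (x, H) with hc
  have hX : ∀ j, S.traj x c j ∈ S.X := fun j => (A.closedLoop_mem_and_admissible hN1 hx hH j).1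
  have hHst : ∀ j, S.store x H c j ∈ S.storages := fun j =>
    (A.closedLoop_mem_and_admissible hN1 hx hH j).2.1
  have hcadm : ∀ j, S.Admissible j x H c := fun j =>
    (A.closedLoop_mem_and_admissible hN1 hx hH j).2.2
  set P := q * T with hP
  -- Guarantees that at least `T` steps remain before time `P` from each of the first `T + 1`
  -- closed-loop states.
  have hPT : 2 * T ≤ P := Nat.mul_le_mul_right T hq
  set U : ℕ → ℕ → EuclideanSpace ℝ (Fin m) := fun j =>
    ustar N (S.traj x c j) (S.store x H c j) with hU
  have hU0 : U 0 = ustar N x H := by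
    simp only [hU, store_zero]
    rfl
  have hUadm : ∀ j, S.Admissible N (S.traj x c j) (S.store x H c j) (U j) := fun j =>
    (A.ustar_min N _ (hX j) _ (hHst j)).1
  have hUclose : ∀ j ≤ T, ∀ k, P ≤ k + j + (T - 1) → k + j < P + d + T →
      pairNorm (S.traj (S.traj x c j) (U j) k - xs) (U j k - us) ≤ σ := fun j hj k h1 h2 =>
    hstar _ j hj (closedLoop_eq N j x H).symm k h1 h2
  have hmint := A.utilde_min N x hx H hH
  set ũ := utilde N x H with hũ
  have htnear : ∀ {τ}, σ ≤ τ → S.Near xs us τ P x ũ := fun hτ =>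
    hnear hτ (by omega) fun k h1 h2 => htilde k h1 (by omega)
  have hUnear : ∀ {τ}, ∀ j ≤ T, σ ≤ τ → S.Near xs us τ (P - j) (S.traj x c j) (U j) :=
    fun j hj hτ => hnear hτ (by omega) fun k h1 h2 => hUclose j hj k (by omega) (by omega)
  have hUcost : ∀ j ≤ T, ∀ v, S.Admissible (P - j) (S.traj x c j) (S.store x H c j) v →
      S.Near xs us σ (P - j) (S.traj x c j) v →
      S.cost (P - j) (S.traj x c j) (U j) ≤ S.cost (P - j) (S.traj x c j) v + e := by
    intro j hj v hv hvn
    refine hcost _ (hX j) _ (hHst j) N (P - j) (by omega) v hv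
      ⟨hvn.le, hvn.state.trans hσ1, fun k h1 h2 => (hvn.pair k h1 h2).trans hσ1⟩ fun k h1 h2 => ?_
    exact (hUclose j hj k (by omega) (by omega)).trans hσ1
  have hstart : S.cost P x (U 0) ≤ S.cost P x ũ + e := by
    have h := hUcost 0 (by omega) ũ
    rw [store_zero] at h
    exact h (hmint.1.mono (by omega)) (htnear le_rfl)
  -- An approximate dynamic programming principle: after one step, the tail of the input optimal at
  -- closed-loop time `j` is a competitor for the one optimal at time `j + 1`. Both are near the
  -- steady state at absolute time `P`, so each exchange costs at most `e`.
  have hchain : ∀ j ≤ T, S.cost (P - j) (S.traj x c j) (U j) + S.cost j x c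
      ≤ S.cost P x (U 0) + j * e := by
    intro j
    induction j with
    | zero => simp [cost, traj]
    | succ j ih =>
      intro hj
      have ih := ih (by omega)
      have hUc : U j 0 = c j := by
        simp only [hU, hc, clInput, closedLoop_eq]
      have htr : S.traj (S.traj x c j) (U j) 1 = S.traj x c (j + 1) := by
        rw [traj, hUc]
        rfl
      have hUc1 : ∀ k < 1, U j k = c (j + k) := fun k hk => by
        obtain rfl : k = 0 := by omega
        exact hUc
      have hst : S.store (S.traj x c j) (S.store x H c j) (U j) 1 = S.store x H c (j + 1) := by
        rw [S.store_congr hUc1 le_rfl, ← store_add]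
      have hPj : P - j = 1 + (P - (j + 1)) := by omega
      have hadm := ((hUadm j).mono (by omega : 1 + (P - (j + 1)) ≤ N)).drop A.one_le
      rw [htr, hst] at hadm
      have h1 := hUcost (j + 1) hj _ hadm (hnear le_rfl (by omega) fun k h1 h2 => by
        rw [← htr, ← traj_add]
        exact hUclose j (by omega) (1 + k) (by omega) (by omega))
      rw [hPj, cost_add, htr] at ih
      have h2 : S.cost 1 (S.traj x c j) (U j) = S.ell (S.traj x c j) (c j) := by
        simp [cost, traj, hUc]
      have h3 : S.cost (j + 1) x c = S.cost j x c + S.ell (S.traj x c j) (c j) :=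
        Finset.sum_range_succ _ _
      rw [h2] at ih
      rw [h3]
      push_cast
      linarith
  have hlbar := A.dissipative.multiplier_nonneg
  have hsumle : ∀ {y : EuclideanSpace ℝ (Fin n)} {G v M}, S.Admissible M y G v →
      ∀ r, r * T ≤ M → ∑ k ∈ Finset.range (r * T), lbar ⬝ᵥ S.out y v k ≤ 0 := by
    intro y G v M hv r hr
    have := sum_dotProduct_le hlbar (C := 0) (hv.sum_out_mul_le r hr)
    rwa [mul_zero] at this
  -- The output sum of the rotated minimizer enters with the unfavourable sign; this is the only
  -- source of `ψ`.
  have hpsi := A.outputBound.bound (P - 1) (by omega) N (by omega) x hx H hH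
  rw [show P - 1 + 1 = P by omega, ← hũ] at hpsi
  have hvalue : S.rotCost xs us lam lbar P x ũ ≤ S.rotValue xs us lam lbar N x H := by
    rw [hmint.rotValue_eq]
    exact A.dissipative.rotCost_mono hmint.1 (by omega)
  have hlamt := abs_le.1 (hlam _ (A.regular.traj_mem hx hmint.1 (by omega : P ≤ N))
    (htnear hσ3).state)
  constructor
  -- The closed-loop sum over `T` steps and the predicted sum over the following `(q - 1) * T` steps
  -- are both nonpositive; here it matters that `P` is a multiple of `T`.
  · have h1 := hval _ (hX T) _ (hHst T) N (P - T) (by omega) (U T)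
      ((hUadm T).mono (by omega)) (hUnear T le_rfl hσ2)
    have h2 := hchain T le_rfl
    have h3 := abs_le.1 (hlam _ (A.regular.traj_mem (hX T) (hUadm T) (by omega : P - T ≤ N))
      (hUnear T le_rfl hσ3).state)
    have hPq : P - T = (q - 1) * T := by rw [hP, Nat.sub_mul, one_mul]
    have h4 := hsumle (hUadm T) (q - 1) (by omega)
    rw [← hPq] at h4
    have h5 := hsumle (hcadm T) 1 (by omega)
    rw [one_mul] at h5
    have hcast : ((P - T : ℕ) : ℝ) = P - T := Nat.cast_sub (by omega)
    rw [closedLoop_eq]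
    refine h1.trans ?_
    rw [rotCost, hcast]
    rw [rotCost] at hvalue
    rw [rotCost]
    linarith
  -- The same conversion without the chain: the first term of the sum is bounded by the rotated cost
  -- of the optimal input up to time `P`, which is compared with that of the rotated minimizer.
  · have h1 := hUadm 0
    rw [store_zero, hU0] at h1
    have h1 : S.Admissible N x H (ustar N x H) := h1
    have h2 : rho (pairNorm (x - xs) (ustar N x H 0 - us))
        ≤ S.rotCost xs us lam lbar P x (ustar N x H) :=
      (Finset.single_le_sum (f := fun k => rho (pairNorm (S.traj x (ustar N x H) k - xs)
        (ustar N x H k - us))) (fun k _ => A.dissipative.rho_nonneg _ _)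
        (Finset.mem_range.2 (by omega : 0 < P))).trans
        (A.dissipative.sum_rho_le (h1.mono (by omega : P ≤ N)))
    have h3 := hsumle h1 q (by omega)
    have hn : S.Near xs us σ₃ P x (ustar N x H) := by
      have := hUnear 0 (by omega) hσ3
      rwa [hU0] at this
    have h4 := abs_le.1 (hlam _ (A.regular.traj_mem hx h1 (by omega : P ≤ N)) hn.state)
    rw [hU0] at hstart
    rw [rotCost] at h2 hvalue
    rw [← hP] at h3
    linarith

end MPCSetting

end ControlProblem

/-! ### Stability from a practical Lyapunov function -/

section Lyapunov

variable {ι : Type*} {ξ V : ι → ℕ → ℝ} {ν : ι → ℕ} {α₁ α₂ α₃ : ℝ → ℝ} {δ₁ δ₂ : ℕ → ℝ}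

/-- For large `ν` a small sublevel set of a practical Lyapunov function is forward invariant, and
outside of it the function decreases by a fixed amount. -/
theorem exists_invariant_level (hα₁ : ClassKInf α₁) (hα₂ : ClassKInf α₂) (hα₃ : ClassKInf α₃)
    (hδ₁ : ClassLN δ₁) (hδ₂ : ClassLN δ₂) (hξ : ∀ i k, 0 ≤ ξ i k)
    (hlow : ∀ i k, α₁ (ξ i k) ≤ V i k) (hup : ∀ i k, V i k ≤ α₂ (ξ i k) + δ₁ (ν i))
    (hdec : ∀ i k, V i (k + 1) ≤ V i k - α₃ (ξ i k) + δ₂ (ν i)) {ε : ℝ} (hε : 0 < ε) :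
    ∃ b η θ : ℝ, 0 < η ∧ 0 < θ ∧ ∃ N₀, ∀ i, N₀ ≤ ν i →
      (∀ k, V i k ≤ b → ξ i k ≤ ε) ∧ (∀ k, ξ i k ≤ η → V i k ≤ b) ∧
      (∀ k, V i k ≤ b → V i (k + 1) ≤ b) ∧ (∀ k, b < V i k → V i (k + 1) ≤ V i k - θ) := by
  have hb := hα₁.toClassK.pos hε
  set b := α₁ ε with hbdef
  obtain ⟨η, hη, hηb⟩ := hα₂.toClassK.exists_le (show 0 < b / 4 by positivity)
  have hθ := hα₃.toClassK.pos hη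
  -- Within distance `η` the function is at most `b / 2`, so an error `b / 2` cannot push it above
  -- `b`. Beyond `η`, half of the decrease survives the error.
  have hev := (hδ₁.lim.eventually_le_const (show 0 < b / 4 by positivity)).and
    (hδ₂.lim.eventually_le_const (show 0 < min (b / 2) (α₃ η / 2) by positivity))
  obtain ⟨N₀, hN₀⟩ := eventually_atTop.1 hev
  refine ⟨b, η, α₃ η / 2, hη, by positivity, N₀, fun i hi => ?_⟩
  obtain ⟨h1, h2⟩ := hN₀ _ hi
  have h3 := h2.trans (min_le_left _ _)
  have h4 := h2.trans (min_le_right _ _)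
  have hsmall : ∀ k, ξ i k ≤ η → V i k ≤ b / 2 := fun k hk => by
    have := hup i k
    have := hηb _ (hξ i k) hk
    linarith
  have hlarge : ∀ k, η < ξ i k → V i (k + 1) ≤ V i k - α₃ η / 2 := fun k hk => by
    have := hdec i k
    have := hα₃.toClassK.mono hη.le hk.le
    linarith
  refine ⟨fun k hk => ?_, fun k hk => ?_, fun k hk => ?_, fun k hk => ?_⟩
  · by_contra! hcon
    have := hα₁.strictMono (mem_Ici.2 hε.le) (mem_Ici.2 (hξ i k)) hcon
    have := hlow i k
    linarith
  · have := hsmall k hk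
    linarith
  · rcases le_or_gt (ξ i k) η with h | h
    · have := hsmall k h
      have := hdec i k
      have := hα₃.toClassK.nonneg (hξ i k)
      linarith
    · have := hlarge k h
      linarith
  · refine hlarge k (not_le.1 fun h => ?_)
    have := hsmall k h
    linarith

theorem stable_of_lyapunov (hα₁ : ClassKInf α₁) (hα₂ : ClassKInf α₂) (hα₃ : ClassKInf α₃)
    (hδ₁ : ClassLN δ₁) (hδ₂ : ClassLN δ₂) (hξ : ∀ i k, 0 ≤ ξ i k)
    (hlow : ∀ i k, α₁ (ξ i k) ≤ V i k) (hup : ∀ i k, V i k ≤ α₂ (ξ i k) + δ₁ (ν i))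
    (hdec : ∀ i k, V i (k + 1) ≤ V i k - α₃ (ξ i k) + δ₂ (ν i)) {ε : ℝ} (hε : 0 < ε) :
    ∃ η > 0, ∃ N₀, ∀ i, N₀ ≤ ν i → ξ i 0 ≤ η → ∀ k, ξ i k ≤ ε := by
  obtain ⟨b, η, θ, hη, -, N₀, hN₀⟩ :=
    exists_invariant_level hα₁ hα₂ hα₃ hδ₁ hδ₂ hξ hlow hup hdec hε
  refine ⟨η, hη, N₀, fun i hi h0 k => ?_⟩
  obtain ⟨h1, h2, h3, -⟩ := hN₀ i hi
  refine h1 k ?_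
  induction k with
  | zero => exact h2 0 h0
  | succ k ih => exact h3 k ih

/-- Above level `b` the nonnegative function loses at least `θ` per step, so it cannot stay there
for more than `M / θ` steps; afterwards invariance applies. -/
theorem attractive_of_lyapunov (hα₁ : ClassKInf α₁) (hα₂ : ClassKInf α₂) (hα₃ : ClassKInf α₃)
    (hδ₁ : ClassLN δ₁) (hδ₂ : ClassLN δ₂) (hξ : ∀ i k, 0 ≤ ξ i k)
    (hlow : ∀ i k, α₁ (ξ i k) ≤ V i k) (hup : ∀ i k, V i k ≤ α₂ (ξ i k) + δ₁ (ν i))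
    (hdec : ∀ i k, V i (k + 1) ≤ V i k - α₃ (ξ i k) + δ₂ (ν i)) {M : ℝ}
    (hM : ∀ i k, V i k ≤ M) {ε : ℝ} (hε : 0 < ε) :
    ∃ K N₀, ∀ i, N₀ ≤ ν i → ∀ k, K ≤ k → ξ i k ≤ ε := by
  obtain ⟨b, η, θ, hη, hθ, N₀, hN₀⟩ :=
    exists_invariant_level hα₁ hα₂ hα₃ hδ₁ hδ₂ hξ hlow hup hdec hε
  obtain ⟨K, hK⟩ := exists_nat_gt (M / θ)
  rw [div_lt_iff₀ hθ] at hK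
  refine ⟨K, N₀, fun i hi k hk => ?_⟩
  obtain ⟨h1, -, h3, h4⟩ := hN₀ i hi
  have hnn : ∀ k, 0 ≤ V i k := fun k => (hα₁.toClassK.nonneg (hξ i k)).trans (hlow i k)
  have key : ∀ k, V i k ≤ b ∨ V i k ≤ M - k * θ := by
    intro k
    induction k with
    | zero => exact Or.inr (by simpa using hM i 0)
    | succ k ih =>
      rcases le_or_gt (V i k) b with h | h
      · exact Or.inl (h3 k h)
      · rcases ih with h' | h'
        · exact absurd h' (not_le.2 h)
        · right
          have := h4 k h
          push_cast
          linarith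
  refine h1 k ((key k).resolve_right fun h => ?_)
  have h5 : (K : ℝ) * θ ≤ k * θ := mul_le_mul_of_nonneg_right (by exact_mod_cast hk) hθ.le
  have := hnn k
  linarith

end Lyapunov

/-! ### The penalized value function and its decay rate -/

noncomputable section

namespace ControlProblem

variable {n m p T : ℕ} {S : ControlProblem n m p T}
  {x xs : EuclideanSpace ℝ (Fin n)} {us : EuclideanSpace ℝ (Fin m)} {H : Storage p T}
  {u v w : ℕ → EuclideanSpace ℝ (Fin m)} {N M P : ℕ} {L : ℝ}
  {lam : EuclideanSpace ℝ (Fin n) → ℝ} {lbar : Fin p → ℝ} {rho psi : ℝ → ℝ} {a ω c : ℝ}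
  {ustar utilde : ℕ → EuclideanSpace ℝ (Fin n) → Storage p T → ℕ → EuclideanSpace ℝ (Fin m)}

/-- The distance of an extended state from the extended steady state. -/
def extDist (S : ControlProblem n m p T) (xs : EuclideanSpace ℝ (Fin n))
    (us : EuclideanSpace ℝ (Fin m)) (χ : EuclideanSpace ℝ (Fin n) × Storage p T) : ℝ :=
  ‖χ.1 - xs‖ + matNorm1 (χ.2 - S.steadyStorage xs us)

theorem extDist_nonneg (χ : EuclideanSpace ℝ (Fin n) × Storage p T) : 0 ≤ S.extDist xs us χ :=
  add_nonneg (norm_nonneg _) (matNorm1_nonneg _)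

theorem norm_le_extDist (χ : EuclideanSpace ℝ (Fin n) × Storage p T) :
    ‖χ.1 - xs‖ ≤ S.extDist xs us χ :=
  le_add_of_nonneg_right (matNorm1_nonneg _)

theorem matNorm1_le_extDist (χ : EuclideanSpace ℝ (Fin n) × Storage p T) :
    matNorm1 (χ.2 - S.steadyStorage xs us) ≤ S.extDist xs us χ :=
  le_add_of_nonneg_left (norm_nonneg _)

/-- The weighted sum of the deviations of the stored outputs from the steady-state output. -/
def penalty (S : ControlProblem n m p T) (xs : EuclideanSpace ℝ (Fin n))
    (us : EuclideanSpace ℝ (Fin m)) (ω : ℝ) (H : Storage p T) : ℝ :=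
  ∑ j : Fin (T - 1), ((j : ℝ) + 1) * vecNorm1 (fun i => H i j - S.h xs us i) ^ ω

theorem What_eq (χ : EuclideanSpace ℝ (Fin n) × Storage p T) :
    S.What xs us lam lbar ω c N χ
      = S.rotValue xs us lam lbar N χ.1 χ.2 + c * S.penalty xs us ω χ.2 := rfl

theorem penalty_nonneg : 0 ≤ S.penalty xs us ω H :=
  Finset.sum_nonneg fun j _ => mul_nonneg (by positivity)
    (Real.rpow_nonneg (vecNorm1_nonneg _) _)

/-- The norm is attained at some column, and every column has weight at least one. -/
theorem rpow_matNorm1_le_penalty (hT : 2 ≤ T) :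
    matNorm1 (H - S.steadyStorage xs us) ^ ω ≤ S.penalty xs us ω H := by
  have : Nonempty (Fin (T - 1)) := ⟨⟨0, by omega⟩⟩
  obtain ⟨j, hj⟩ := exists_eq_ciSup_of_finite
    (f := fun j => ∑ i, |(H - S.steadyStorage xs us) i j|)
  have h1 : vecNorm1 (fun i => H i j - S.h xs us i) = matNorm1 (H - S.steadyStorage xs us) := hj
  rw [← h1]
  refine le_trans ?_ (Finset.single_le_sum (f := fun j : Fin (T - 1) =>
    ((j : ℝ) + 1) * vecNorm1 (fun i => H i j - S.h xs us i) ^ ω)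
    (fun j _ => mul_nonneg (by positivity) (Real.rpow_nonneg (vecNorm1_nonneg _) _))
    (Finset.mem_univ j))
  exact le_mul_of_one_le_left (Real.rpow_nonneg (vecNorm1_nonneg _) _) (by simp)

theorem penalty_le (hω : 0 ≤ ω) :
    S.penalty xs us ω H ≤ T * T * matNorm1 (H - S.steadyStorage xs us) ^ ω := by
  have hnn := Real.rpow_nonneg (matNorm1_nonneg (H - S.steadyStorage xs us)) ω
  have h1 : ((T - 1 : ℕ) : ℝ) ≤ T := by exact_mod_cast Nat.sub_le _ _
  refine (Finset.sum_le_card_nsmul _ _ (T * matNorm1 (H - S.steadyStorage xs us) ^ ω)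
    fun j _ => ?_).trans ?_
  · have hj : ((j : ℝ) + 1) ≤ T := by
      have : (j : ℕ) + 1 ≤ T := by have := j.2; omega
      exact_mod_cast this
    exact mul_le_mul hj (Real.rpow_le_rpow (vecNorm1_nonneg _)
      (vecNorm1_col_le_matNorm1 (H - S.steadyStorage xs us) j) hω)
      (Real.rpow_nonneg (vecNorm1_nonneg _) _) (Nat.cast_nonneg _)
  · rw [Finset.card_univ, Fintype.card_fin, nsmul_eq_mul, mul_assoc]
    exact mul_le_mul_of_nonneg_right h1 (by positivity)

/-- The constant in the lower bound for the rotated stage cost in terms of `1`-norms. -/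
def kappa (n m : ℕ) (a ω : ℝ) : ℝ := 1 / 2 * a * dimPos n m ^ (-ω / 2)

/-- The weight of the penalty in the Lyapunov function. -/
def weight (n m T : ℕ) (L a ω : ℝ) : ℝ := kappa n m a ω / (L ^ ω * ((T : ℝ) - 1))

/-- The amount of decrease of the Lyapunov function along the closed loop. -/
def decay (S : ControlProblem n m p T) (xs : EuclideanSpace ℝ (Fin n))
    (us : EuclideanSpace ℝ (Fin m)) (L : ℝ) (psi : ℝ → ℝ) (a ω : ℝ)
    (χ : EuclideanSpace ℝ (Fin n) × Storage p T) : ℝ :=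
  kappa n m a ω * vecNorm1 (χ.1 - xs).ofLp ^ ω
    + weight n m T L a ω * matNorm1 (χ.2 - S.steadyStorage xs us) ^ ω
    - S.psiBound xs us psi χ.1 χ.2

theorem exists_rpow_le (hω : 0 < ω) {ε : ℝ} (hε : 0 < ε) :
    ∃ σ > 0, ∀ r, 0 ≤ r → r ≤ σ → r ^ ω ≤ ε :=
  ⟨ε ^ ω⁻¹, Real.rpow_pos_of_pos hε _, fun r hr hrs => by
    refine (Real.rpow_le_rpow hr hrs hω.le).trans_eq ?_
    rw [← Real.rpow_mul hε.le, inv_mul_cancel₀ hω.ne', Real.rpow_one]⟩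

theorem vecNorm1_le_extDist (χ : EuclideanSpace ℝ (Fin n) × Storage p T) :
    vecNorm1 (χ.1 - xs).ofLp ≤ Real.sqrt (dimPos n m) * S.extDist xs us χ := by
  have h1 := vecNorm1_add_vecNorm1_le (χ.1 - xs) (0 : EuclideanSpace ℝ (Fin m))
  have h2 := pairNorm_le_add (χ.1 - xs) (0 : EuclideanSpace ℝ (Fin m))
  rw [norm_zero, add_zero] at h2
  have h3 := mul_le_mul_of_nonneg_left (h2.trans (norm_le_extDist (S := S) (us := us) χ))
    (Real.sqrt_nonneg (dimPos n m))
  have h4 := vecNorm1_nonneg (0 : EuclideanSpace ℝ (Fin m)).ofLp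
  linarith

namespace MPCSetting

variable (A : MPCSetting S xs us ustar utilde L lam lbar rho psi a ω)

include A

theorem kappa_pos : 0 < kappa n m a ω := by
  have := A.polynomialBounds.a_pos
  have := Real.rpow_pos_of_pos (dimPos_pos (n := n) (m := m)) (-ω / 2)
  unfold kappa
  positivity

theorem one_le_cast_sub : (1 : ℝ) ≤ (T : ℝ) - 1 := by
  have : (2 : ℝ) ≤ T := by exact_mod_cast A.two_le
  linarith

theorem weight_pos : 0 < weight n m T L a ω := by
  have h1 := A.kappa_pos
  have h2 := A.one_le_cast_sub
  have h3 := Real.rpow_pos_of_pos A.regular.L_pos ω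
  unfold weight
  positivity

/-- The power of `dimPos` in `kappa` cancels the constant of the norm comparison. The factor `2`
allows the bound to be spent once on the state and once on the output. -/
theorem two_kappa_mul_le_rho {y : EuclideanSpace ℝ (Fin n)} {v : EuclideanSpace ℝ (Fin m)}
    (hy : (y, v) ∈ S.Z) :
    2 * kappa n m a ω * (vecNorm1 (y - xs).ofLp + vecNorm1 (v - us).ofLp) ^ ω
      ≤ rho (pairNorm (y - xs) (v - us)) := by
  have ha := A.polynomialBounds.a_pos
  have hω := A.polynomialBounds.ω_pos
  have hD := dimPos_pos (n := n) (m := m)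
  refine le_trans ?_ (A.polynomialBounds.rho_lower _ (pairNorm_nonneg _ _)
    (A.regular.pairNorm_le_sSup xs us hy))
  have h1 := Real.rpow_le_rpow (add_nonneg (vecNorm1_nonneg _) (vecNorm1_nonneg _))
    (vecNorm1_add_vecNorm1_le (y - xs) (v - us)) hω.le
  rw [Real.mul_rpow (Real.sqrt_nonneg _) (pairNorm_nonneg _ _), Real.sqrt_eq_rpow,
    ← Real.rpow_mul hD.le] at h1
  have h2 : dimPos n m ^ (-ω / 2) * dimPos n m ^ (1 / 2 * ω) = 1 := by
    rw [← Real.rpow_add hD, show -ω / 2 + 1 / 2 * ω = 0 by ring, Real.rpow_zero]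
  have h3 := mul_le_mul_of_nonneg_left h1
    (mul_nonneg ha.le (Real.rpow_nonneg hD.le (-ω / 2)))
  calc 2 * kappa n m a ω * (vecNorm1 (y - xs).ofLp + vecNorm1 (v - us).ofLp) ^ ω
      = a * dimPos n m ^ (-ω / 2) * (vecNorm1 (y - xs).ofLp + vecNorm1 (v - us).ofLp) ^ ω := by
        unfold kappa; ring
    _ ≤ _ := h3
    _ = a * pairNorm (y - xs) (v - us) ^ ω
        * (dimPos n m ^ (-ω / 2) * dimPos n m ^ (1 / 2 * ω)) := by ring
    _ = _ := by rw [h2, mul_one]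

/-- Lower bound for the rotated stage cost by the deviations of state and output. -/
theorem kappa_mul_add_le_rho {y : EuclideanSpace ℝ (Fin n)} {v : EuclideanSpace ℝ (Fin m)}
    (hy : (y, v) ∈ S.Z) :
    kappa n m a ω * vecNorm1 (y - xs).ofLp ^ ω
      + weight n m T L a ω * ((T : ℝ) - 1) * vecNorm1 (S.h y v - S.h xs us) ^ ω
      ≤ rho (pairNorm (y - xs) (v - us)) := by
  have hω := A.polynomialBounds.ω_pos
  have hκ := A.kappa_pos
  have hL := A.regular.L_pos
  have hLω := Real.rpow_pos_of_pos hL ω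
  have hT := A.one_le_cast_sub
  set s := vecNorm1 (y - xs).ofLp + vecNorm1 (v - us).ofLp with hs
  have hs0 : 0 ≤ s := add_nonneg (vecNorm1_nonneg _) (vecNorm1_nonneg _)
  have h1 : vecNorm1 (y - xs).ofLp ^ ω ≤ s ^ ω :=
    Real.rpow_le_rpow (vecNorm1_nonneg _) (le_add_of_nonneg_right (vecNorm1_nonneg _)) hω.le
  have h2 : vecNorm1 (S.h y v - S.h xs us) ^ ω ≤ L ^ ω * s ^ ω := by
    rw [← Real.mul_rpow hL.le hs0]
    exact Real.rpow_le_rpow (vecNorm1_nonneg _)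
      (A.regular.lipschitz_h _ _ _ _ hy A.steady.mem) hω.le
  -- The weight is chosen so that the output term uses exactly one half of the bound.
  have h3 : weight n m T L a ω * ((T : ℝ) - 1) * (L ^ ω * s ^ ω) = kappa n m a ω * s ^ ω := by
    unfold weight
    have : (T : ℝ) - 1 ≠ 0 := by linarith
    field_simp
  have h4 := mul_le_mul_of_nonneg_left h1 hκ.le
  have h5 := mul_le_mul_of_nonneg_left h2
    (show 0 ≤ weight n m T L a ω * ((T : ℝ) - 1) from
      mul_nonneg A.weight_pos.le (by linarith))
  have h6 := A.two_kappa_mul_le_rho hy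
  rw [← hs] at h6
  linarith

theorem decay_pos (hx : x ∈ S.X) (hH : H ∈ S.storages) (h : 0 < S.extDist xs us (x, H)) :
    0 < S.decay xs us L psi a ω (x, H) := by
  have hω := A.polynomialBounds.ω_pos
  have ha := A.polynomialBounds.a_pos
  have hLω := Real.rpow_pos_of_pos A.regular.L_pos ω
  have hT := A.one_le_cast_sub
  have hne : (x, H) ≠ (xs, S.steadyStorage xs us) := by
    intro heq
    obtain ⟨rfl, rfl⟩ := Prod.mk.inj heq
    simp [extDist, matNorm1_zero] at h
  have h1 := A.polynomialBounds.psi_upper x hx H hH hne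
  -- For `n + m = 0` the real power of zero with negative exponent is zero, so the comparison also
  -- holds there.
  have h2 : ((n : ℝ) + m) ^ (-ω / 2) ≤ dimPos n m ^ (-ω / 2) := by
    rcases Nat.eq_zero_or_pos (n + m) with h0 | h0
    · have : (n : ℝ) + m = 0 := by exact_mod_cast h0
      rw [this, Real.zero_rpow (by linarith)]
      exact Real.rpow_nonneg dimPos_pos.le _
    · have : (1 : ℝ) ≤ (n : ℝ) + m := by exact_mod_cast h0
      rw [dimPos, max_eq_left this]
  have h3 : 0 ≤ vecNorm1 (x - xs).ofLp ^ ω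
        + matNorm1 (H - S.steadyStorage xs us) ^ ω / (L ^ ω * ((T : ℝ) - 1)) :=
    add_nonneg (Real.rpow_nonneg (vecNorm1_nonneg _) _)
      (div_nonneg (Real.rpow_nonneg (matNorm1_nonneg _) _) (by positivity))
  have h4 := mul_le_mul_of_nonneg_right
    (mul_le_mul_of_nonneg_left h2 (show 0 ≤ 1 / 2 * a by positivity)) h3
  have h5 : 1 / 2 * a * dimPos n m ^ (-ω / 2) * (vecNorm1 (x - xs).ofLp ^ ω
        + matNorm1 (H - S.steadyStorage xs us) ^ ω / (L ^ ω * ((T : ℝ) - 1)))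
      = kappa n m a ω * vecNorm1 (x - xs).ofLp ^ ω
        + weight n m T L a ω * matNorm1 (H - S.steadyStorage xs us) ^ ω := by
    unfold weight kappa
    ring
  rw [h5] at h4
  rw [decay]
  dsimp only
  linarith

theorem decay_nonneg (hx : x ∈ S.X) (hH : H ∈ S.storages) :
    0 ≤ S.decay xs us L psi a ω (x, H) := by
  rcases (extDist_nonneg (S := S) (xs := xs) (us := us) (x, H)).eq_or_lt with h | h
  · have hω := A.polynomialBounds.ω_pos
    have h1 : vecNorm1 (x - xs).ofLp = 0 := by
      refine le_antisymm ?_ (vecNorm1_nonneg _)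
      have := vecNorm1_le_extDist (S := S) (xs := xs) (us := us) (x, H)
      rwa [← h, mul_zero] at this
    have h2 : matNorm1 (H - S.steadyStorage xs us) = 0 := by
      refine le_antisymm ?_ (matNorm1_nonneg _)
      have := matNorm1_le_extDist (S := S) (xs := xs) (us := us) (x, H)
      rwa [← h] at this
    rw [decay, psiBound]
    dsimp only
    rw [h1, h2, add_zero, A.outputBound.psi_class.zero, Real.zero_rpow hω.ne']
    simp
  · exact (A.decay_pos hx hH h).le

/-- Pointwise positivity becomes uniform: `decay` is continuous and attains its minimum on the
compact set of extended states at distance at least `r`. -/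
theorem exists_le_decay {r : ℝ} (hr : 0 < r) : ∃ b > 0, ∀ x ∈ S.X, ∀ H ∈ S.storages,
    r ≤ S.extDist xs us (x, H) → b ≤ S.decay xs us L psi a ω (x, H) := by
  have hω := A.polynomialBounds.ω_pos
  have hd : Continuous (S.extDist xs us) := continuous_dist xs (S.steadyStorage xs us)
  have hm : Continuous fun χ : EuclideanSpace ℝ (Fin n) × Storage p T =>
      matNorm1 (χ.2 - S.steadyStorage xs us) := continuous_matNorm1.comp (by fun_prop)
  have hv : Continuous fun χ : EuclideanSpace ℝ (Fin n) × Storage p T =>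
      vecNorm1 (χ.1 - xs).ofLp := continuous_vecNorm1.comp (by fun_prop)
  have hg : Continuous (S.decay xs us L psi a ω) := by
    refine Continuous.sub ((continuous_const.mul (hv.rpow_const fun _ => Or.inr hω.le)).add
      (continuous_const.mul (hm.rpow_const fun _ => Or.inr hω.le))) ?_
    exact A.outputBound.psi_class.cont.comp_continuous (hv.add hm) fun χ =>
      add_nonneg (vecNorm1_nonneg _) (matNorm1_nonneg _)
  have hK : IsCompact ((S.X ×ˢ S.storages) ∩ {χ | r ≤ S.extDist xs us χ}) :=
    (A.isCompact_X.prod isCompact_storages).inter_right (isClosed_le continuous_const hd)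
  rcases ((S.X ×ˢ S.storages) ∩ {χ | r ≤ S.extDist xs us χ}).eq_empty_or_nonempty with h | h
  · refine ⟨1, one_pos, fun x hx H hH hxr => ?_⟩
    have : (x, H) ∈ (∅ : Set (EuclideanSpace ℝ (Fin n) × Storage p T)) := h ▸ ⟨⟨hx, hH⟩, hxr⟩
    exact this.elim
  · obtain ⟨χ, hχ, hmin⟩ := hK.exists_isMinOn h hg.continuousOn
    exact ⟨_, A.decay_pos hχ.1.1 hχ.1.2 (hr.trans_le hχ.2), fun x hx H hH hxr =>
      hmin ⟨⟨hx, hH⟩, hxr⟩⟩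

theorem rotValue_nonneg (N : ℕ) (hx : x ∈ S.X) (hH : H ∈ S.storages) :
    0 ≤ S.rotValue xs us lam lbar N x H := by
  rw [(A.utilde_min N x hx H hH).rotValue_eq]
  exact A.dissipative.rotCost_nonneg (A.utilde_min N x hx H hH).1

theorem rho_le_rotValue (hN : 1 ≤ N) (hx : x ∈ S.X) (hH : H ∈ S.storages) :
    rho ‖x - xs‖ ≤ S.rotValue xs us lam lbar N x H := by
  rw [(A.utilde_min N x hx H hH).rotValue_eq]
  refine le_trans ?_ (A.dissipative.sum_rho_le (A.utilde_min N x hx H hH).1)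
  refine le_trans ?_ (Finset.single_le_sum (f := fun k => rho (pairNorm
    (S.traj x (utilde N x H) k - xs) (utilde N x H k - us)))
    (fun k _ => A.dissipative.rho_nonneg _ _) (Finset.mem_range.2 hN))
  exact A.dissipative.rho_class.toClassK.mono (norm_nonneg _) (norm_le_pairNorm _ _)

theorem What_nonneg (N : ℕ) (hx : x ∈ S.X) (hH : H ∈ S.storages) :
    0 ≤ S.What xs us lam lbar ω (weight n m T L a ω) N (x, H) := by
  rw [What_eq]
  exact add_nonneg (A.rotValue_nonneg N hx hH) (mul_nonneg A.weight_pos.le penalty_nonneg)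

/-- At least half of the distance comes from the state, which the rotated value function detects, or
from the storage, which the penalty detects. -/
theorem exists_le_What {r : ℝ} (hr : 0 < r) : ∃ b > 0, ∀ N, 1 ≤ N → ∀ x ∈ S.X, ∀ H ∈ S.storages,
    r ≤ S.extDist xs us (x, H) → b ≤ S.What xs us lam lbar ω (weight n m T L a ω) N (x, H) := by
  have hc := A.weight_pos
  have hω := A.polynomialBounds.ω_pos
  refine ⟨min (rho (r / 2)) (weight n m T L a ω * (r / 2) ^ ω),
    lt_min (A.dissipative.rho_class.toClassK.pos (half_pos hr))
      (mul_pos hc (Real.rpow_pos_of_pos (half_pos hr) _)), fun N hN x hx H hH h => ?_⟩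
  rw [What_eq]
  rcases le_total (r / 2) ‖x - xs‖ with h1 | h1
  · refine (min_le_left _ _).trans ?_
    have := A.dissipative.rho_class.toClassK.mono (half_pos hr).le h1
    have := A.rho_le_rotValue hN hx hH
    have := mul_nonneg hc.le (penalty_nonneg (S := S) (xs := xs) (us := us) (ω := ω) (H := H))
    dsimp only
    linarith
  · refine (min_le_right _ _).trans ?_
    have h2 : r / 2 ≤ matNorm1 (H - S.steadyStorage xs us) := by
      rw [extDist] at h
      dsimp only at h
      linarith
    have h3 := (Real.rpow_le_rpow (half_pos hr).le h2 hω.le).trans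
      (rpow_matNorm1_le_penalty A.two_le)
    have := mul_le_mul_of_nonneg_left h3 hc.le
    have := A.rotValue_nonneg N hx hH
    dsimp only
    linarith

theorem exists_What_le_bound : ∃ M, 0 ≤ M ∧ ∀ N, ∀ x ∈ S.X, ∀ H ∈ S.storages,
    S.What xs us lam lbar ω (weight n m T L a ω) N (x, H) ≤ M := by
  obtain ⟨C, hC0, hC⟩ := A.exists_cost_bound
  obtain ⟨R, hR0, hR⟩ := A.exists_dist_le
  have hc := A.weight_pos
  have hω := A.polynomialBounds.ω_pos
  refine ⟨C + weight n m T L a ω * (T * T * R ^ ω), by positivity, fun N x hx H hH => ?_⟩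
  obtain ⟨u, hu, -, h1⟩ := hC x hx H hH N
  have h2 := (A.dissipative.rotValue_le hu).trans h1
  have h3 : matNorm1 (H - S.steadyStorage xs us) ≤ R :=
    (matNorm1_le_extDist (x, H)).trans (hR x hx H hH)
  have h4 := (penalty_le (S := S) (xs := xs) (us := us) (H := H) hω.le).trans
    (mul_le_mul_of_nonneg_left (Real.rpow_le_rpow (matNorm1_nonneg _) h3 hω.le)
      (show (0 : ℝ) ≤ T * T by positivity))
  have h5 := mul_le_mul_of_nonneg_left h4 hc.le
  rw [What_eq]
  exact add_le_add h2 h5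

theorem exists_rotValue_small {ε : ℝ} (hε : 0 < ε) : ∃ η > 0, ∀ N, ∀ x ∈ S.X, ∀ H ∈ S.storages,
    S.extDist xs us (x, H) ≤ η → S.rotValue xs us lam lbar N x H ≤ ε := by
  obtain ⟨B₁, B₂, hB₁, hB₂, hB⟩ := A.controllable.exists_bound
  obtain ⟨σ₁, hσ₁, h1⟩ := hB₁.exists_le (half_pos hε)
  obtain ⟨σ₂, hσ₂, h2⟩ := hB₂.exists_le (half_pos hε)
  refine ⟨min σ₁ σ₂, lt_min hσ₁ hσ₂, fun N x hx H hH h => ?_⟩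
  obtain ⟨u, hu, -, h3⟩ := hB x hx H hH N
  have h4 := A.dissipative.rotValue_le hu
  have h5 := h1 _ (norm_nonneg _) ((norm_le_extDist (x, H)).trans (h.trans (min_le_left _ _)))
  have h6 := h2 _ (matPos_nonneg _) ((matPos_le_matNorm1 _).trans
    ((matNorm1_le_extDist (x, H)).trans (h.trans (min_le_right _ _))))
  dsimp only at h5 h6
  linarith

theorem exists_What_small {ε : ℝ} (hε : 0 < ε) : ∃ η > 0, ∀ N, ∀ x ∈ S.X, ∀ H ∈ S.storages,
    S.extDist xs us (x, H) ≤ η →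
      S.What xs us lam lbar ω (weight n m T L a ω) N (x, H) ≤ ε := by
  have hc := A.weight_pos
  have hω := A.polynomialBounds.ω_pos
  have hT : (0 : ℝ) < T := by exact_mod_cast A.one_le
  obtain ⟨σ₁, hσ₁, h1⟩ := A.exists_rotValue_small (half_pos hε)
  obtain ⟨σ₂, hσ₂, h2⟩ := exists_rpow_le hω
    (show 0 < ε / 2 / (weight n m T L a ω * (T * T)) by positivity)
  refine ⟨min σ₁ σ₂, lt_min hσ₁ hσ₂, fun N x hx H hH h => ?_⟩
  have h3 := h1 N x hx H hH (h.trans (min_le_left _ _))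
  have h4 := h2 _ (matNorm1_nonneg _)
    ((matNorm1_le_extDist (x, H)).trans (h.trans (min_le_right _ _)))
  rw [le_div_iff₀' (by positivity)] at h4
  have h5 := mul_le_mul_of_nonneg_left
    (penalty_le (S := S) (xs := xs) (us := us) (H := H) hω.le) hc.le
  rw [What_eq]
  dsimp only at h4 ⊢
  linarith

theorem exists_psiBound_small {ε : ℝ} (hε : 0 < ε) : ∃ η > 0, ∀ x H,
    S.extDist xs us (x, H) ≤ η → S.psiBound xs us psi x H ≤ ε := by
  obtain ⟨σ, hσ, h1⟩ := A.outputBound.psi_class.toClassK.exists_le hε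
  have hD := Real.sqrt_pos.2 (dimPos_pos (n := n) (m := m))
  refine ⟨σ / (Real.sqrt (dimPos n m) + 1), by positivity, fun x H h => ?_⟩
  refine h1 _ (add_nonneg (vecNorm1_nonneg _) (matNorm1_nonneg _)) ?_
  have h2 := vecNorm1_le_extDist (S := S) (xs := xs) (us := us) (x, H)
  have h3 := matNorm1_le_extDist (S := S) (xs := xs) (us := us) (x, H)
  rw [le_div_iff₀ (by positivity)] at h
  dsimp only at h2 h3
  linarith

end MPCSetting

end ControlProblem

end

/-! ### Lyapunov decrease and practical stability -/

namespace ControlProblem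

variable {n m p T : ℕ} {S : ControlProblem n m p T}
  {x xs : EuclideanSpace ℝ (Fin n)} {us : EuclideanSpace ℝ (Fin m)} {H : Storage p T}
  {u v w : ℕ → EuclideanSpace ℝ (Fin m)} {N M P : ℕ} {L : ℝ}
  {lam : EuclideanSpace ℝ (Fin n) → ℝ} {lbar : Fin p → ℝ} {rho psi : ℝ → ℝ} {a ω c : ℝ}
  {ustar utilde : ℕ → EuclideanSpace ℝ (Fin n) → Storage p T → ℕ → EuclideanSpace ℝ (Fin m)}

/-- The penalty after `T` steps is bounded by the output deviations along the solution. -/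
theorem penalty_store_le (x : EuclideanSpace ℝ (Fin n)) (H : Storage p T)
    (u : ℕ → EuclideanSpace ℝ (Fin m)) :
    S.penalty xs us ω (S.store x H u T)
      ≤ ((T : ℝ) - 1) * ∑ k ∈ Finset.range T, vecNorm1 (S.out x u k - S.h xs us) ^ ω := by
  rcases Nat.eq_zero_or_pos T with rfl | hT
  · simp [penalty]
  have hnn : ∀ k, 0 ≤ vecNorm1 (S.out x u k - S.h xs us) ^ ω := fun k =>
    Real.rpow_nonneg (vecNorm1_nonneg _) _
  have hcast : ((T - 1 : ℕ) : ℝ) = T - 1 := Nat.cast_pred hT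
  rw [← hcast]
  -- After `T` steps the storage holds the outputs at times `1, …, T - 1`; the output at time `0`
  -- has already been dropped.
  have h1 := sum_range_shift_le hnn (by omega : 1 + (T - 1) ≤ T)
  refine le_trans ?_ (mul_le_mul_of_nonneg_left h1 (Nat.cast_nonneg _))
  rw [← Fin.sum_univ_eq_sum_range (fun k => vecNorm1 (S.out x u (1 + k) - S.h xs us) ^ ω),
    Finset.mul_sum]
  refine Finset.sum_le_sum fun j _ => ?_
  have hj : ((j : ℝ) + 1) ≤ ((T - 1 : ℕ) : ℝ) := by exact_mod_cast j.2
  have h2 : (fun i => S.store x H u T i j - S.h xs us i) = S.out x u (1 + j) - S.h xs us := by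
    funext i
    rw [store, S.hist_of_le (by omega), show T + (j : ℕ) - (T - 1) = 1 + j by omega]
    rfl
  rw [h2]
  exact mul_le_mul_of_nonneg_right hj (hnn _)

/-- Shifting the window of summation by one step adds the last term and removes the first; this is
the reason for summing `T` values. -/
theorem Wfun_closedLoop_one (χ : EuclideanSpace ℝ (Fin n) × Storage p T) :
    S.Wfun xs us lam lbar ω c ustar N (S.closedLoop ustar N 1 χ)
      = S.Wfun xs us lam lbar ω c ustar N χ
        + S.What xs us lam lbar ω c N (S.closedLoop ustar N T χ)
        - S.What xs us lam lbar ω c N χ := by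
  have h := Finset.sum_range_succ'
    (fun j => S.What xs us lam lbar ω c N (S.closedLoop ustar N j χ)) T
  rw [Finset.sum_range_succ] at h
  simp only [Wfun, closedLoop_add]
  have h0 : S.closedLoop ustar N 0 χ = χ := rfl
  rw [h0] at h
  linarith

namespace MPCSetting

variable (A : MPCSetting S xs us ustar utilde L lam lbar rho psi a ω)

include A

theorem closedLoop_mem (hN : 1 ≤ N) {χ : EuclideanSpace ℝ (Fin n) × Storage p T}
    (hχ : χ ∈ S.X ×ˢ S.storages) (k : ℕ) : S.closedLoop ustar N k χ ∈ S.X ×ˢ S.storages := by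
  obtain ⟨x, H⟩ := χ
  rw [closedLoop_eq]
  have := A.closedLoop_mem_and_admissible hN hχ.1 hχ.2 k
  exact ⟨this.1, this.2.1⟩

/-- The Lyapunov function decreases over `T` steps of the closed loop. -/
theorem exists_What_decrease {ε : ℝ} (hε : 0 < ε) : ∃ N₀, ∀ N, N₀ ≤ N → ∀ χ ∈ S.X ×ˢ S.storages,
    S.What xs us lam lbar ω (weight n m T L a ω) N (S.closedLoop ustar N T χ)
      ≤ S.What xs us lam lbar ω (weight n m T L a ω) N χ - S.decay xs us L psi a ω χ + ε := by
  obtain ⟨N₀, hN₀⟩ := A.exists_rotValue_decrease hε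
  refine ⟨N₀ + 1, fun N hN χ hχ => ?_⟩
  obtain ⟨x, H⟩ := χ
  obtain ⟨hx, hH⟩ := hχ
  have h1 := (hN₀ N (by omega) x hx H hH).1
  set c := S.clInput ustar N (x, H) with hc
  have hadm := (A.closedLoop_mem_and_admissible (by omega : 1 ≤ N) hx hH T).2.2
  rw [← hc] at hadm
  have hκ := A.kappa_pos
  have hw := A.weight_pos
  -- From the stage-wise lower bounds, only the initial state term is kept, but all output terms are
  -- kept: they pay for the new penalty.
  have h2 : kappa n m a ω * vecNorm1 (x - xs).ofLp ^ ω + weight n m T L a ω * (((T : ℝ) - 1) *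
      ∑ k ∈ Finset.range T, vecNorm1 (S.out x c k - S.h xs us) ^ ω)
      ≤ S.rotCost xs us lam lbar T x c := by
    refine le_trans ?_ (A.dissipative.sum_rho_le hadm)
    have h3 : ∑ k ∈ Finset.range T, (kappa n m a ω * vecNorm1 (S.traj x c k - xs).ofLp ^ ω
        + weight n m T L a ω * ((T : ℝ) - 1) * vecNorm1 (S.out x c k - S.h xs us) ^ ω)
        ≤ ∑ k ∈ Finset.range T, rho (pairNorm (S.traj x c k - xs) (c k - us)) :=
      Finset.sum_le_sum fun k hk => A.kappa_mul_add_le_rho (hadm.mem k (Finset.mem_range.1 hk))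
    have h4 : kappa n m a ω * vecNorm1 (S.traj x c 0 - xs).ofLp ^ ω
        ≤ ∑ k ∈ Finset.range T, kappa n m a ω * vecNorm1 (S.traj x c k - xs).ofLp ^ ω :=
      Finset.single_le_sum
        (f := fun k => kappa n m a ω * vecNorm1 (S.traj x c k - xs).ofLp ^ ω)
        (fun k _ => mul_nonneg hκ.le (Real.rpow_nonneg (vecNorm1_nonneg _) _))
        (Finset.mem_range.2 A.one_le)
    rw [traj] at h4
    rw [Finset.sum_add_distrib, ← Finset.mul_sum (a := weight n m T L a ω * ((T : ℝ) - 1))] at h3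
    linarith
  have h4 := mul_le_mul_of_nonneg_left
    (penalty_store_le (S := S) (xs := xs) (us := us) (ω := ω) x H c) hw.le
  have h5 := mul_le_mul_of_nonneg_left
    (rpow_matNorm1_le_penalty (S := S) (xs := xs) (us := us) (ω := ω) (H := H) A.two_le) hw.le
  rw [What_eq, What_eq, decay]
  rw [closedLoop_eq, ← hc] at h1 ⊢
  dsimp only at h1 ⊢
  linarith

/-- One step of the closed loop does not leave a neighborhood of the steady state immediately. -/
theorem exists_step_small {ε : ℝ} (hε : 0 < ε) : ∃ η > 0, ∃ N₀, ∀ N, N₀ ≤ N →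
    ∀ χ ∈ S.X ×ˢ S.storages, S.extDist xs us χ ≤ η →
      S.extDist xs us (S.clStep ustar N χ) ≤ ε := by
  obtain ⟨α, hα, hf⟩ := A.regular.cont_f
  have hρ := A.dissipative.rho_class.toClassK
  have hL := A.regular.L_pos
  set C := L * Real.sqrt (dimPos n m) with hCdef
  have hC : 0 ≤ C := by positivity
  obtain ⟨σ₁, hσ₁, h1⟩ := hα.toClassK.exists_le (show 0 < ε / 3 by positivity)
  set σ := min σ₁ (ε / 3 / (C + 1)) with hσdef
  have hσ : 0 < σ := lt_min hσ₁ (by positivity)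
  have hCσ : C * σ ≤ ε / 3 := by
    have : σ ≤ ε / 3 / (C + 1) := min_le_right _ _
    rw [le_div_iff₀ (by positivity)] at this
    linarith
  have hb := hρ.pos hσ
  -- Three quarters of `rho σ` stay strictly below `rho σ`, which forces the first optimal
  -- state-input pair to within `σ` of the steady state.
  obtain ⟨η₁, hη₁, h2⟩ := A.exists_rotValue_small (show 0 < rho σ / 4 by positivity)
  obtain ⟨η₂, hη₂, h3⟩ := A.exists_psiBound_small (show 0 < rho σ / 4 by positivity)
  obtain ⟨N₀, hN₀⟩ := A.exists_rotValue_decrease (show 0 < rho σ / 4 by positivity)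
  refine ⟨min (ε / 3) (min η₁ η₂), lt_min (by positivity) (lt_min hη₁ hη₂), N₀ + 1,
    fun N hN χ hχ h => ?_⟩
  obtain ⟨x, H⟩ := χ
  obtain ⟨hx, hH⟩ := hχ
  have h4 := (hN₀ N (by omega) x hx H hH).2
  have h5 := h2 N x hx H hH (h.trans ((min_le_right _ _).trans (min_le_left _ _)))
  have h6 := h3 x H (h.trans ((min_le_right _ _).trans (min_le_right _ _)))
  have h7 : S.extDist xs us (x, H) ≤ ε / 3 := h.trans (min_le_left _ _)
  have hZ : (x, ustar N x H 0) ∈ S.Z := (A.ustar_min N x hx H hH).1.mem 0 (by omega)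
  have h8 : pairNorm (x - xs) (ustar N x H 0 - us) ≤ σ :=
    (hρ.lt_of_lt (pairNorm_nonneg _ _) hσ.le (by linarith)).le
  have h9 : ‖S.f x (ustar N x H 0) - xs‖ ≤ ε / 3 := by
    have := hf _ _ _ _ hZ A.steady.mem
    rw [A.steady.steady] at this
    exact this.trans (h1 _ (pairNorm_nonneg _ _) (h8.trans (min_le_left _ _)))
  have h10 : vecNorm1 (S.h x (ustar N x H 0) - S.h xs us) ≤ ε / 3 :=
    (A.regular.vecNorm1_h_sub_le A.steady.mem hZ).trans
      ((mul_le_mul_of_nonneg_left h8 hC).trans hCσ)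
  have h11 : matNorm1 (shift H (S.h x (ustar N x H 0)) - S.steadyStorage xs us) ≤ ε / 3 := by
    refine matNorm1_le (by positivity) fun j => ?_
    by_cases hj : (j : ℕ) + 1 < T - 1
    · have : (fun i => (shift H (S.h x (ustar N x H 0)) - S.steadyStorage xs us) i j)
          = fun i => (H - S.steadyStorage xs us) i ⟨j + 1, hj⟩ := by
        funext i
        simp only [Matrix.sub_apply, shift, dif_pos hj]
        rfl
      rw [this]
      exact (vecNorm1_col_le_matNorm1 (H - S.steadyStorage xs us) ⟨j + 1, hj⟩).trans
        ((matNorm1_le_extDist (x, H)).trans h7)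
    · have : (fun i => (shift H (S.h x (ustar N x H 0)) - S.steadyStorage xs us) i j)
          = S.h x (ustar N x H 0) - S.h xs us := by
        funext i
        simp only [Matrix.sub_apply, shift, dif_neg hj]
        rfl
      rw [this]
      exact h10
  rw [extDist, clStep]
  dsimp only
  linarith

theorem exists_closedLoop_small (J : ℕ) {ε : ℝ} (hε : 0 < ε) : ∃ η > 0, ∃ N₀, ∀ N, N₀ ≤ N →
    ∀ χ ∈ S.X ×ˢ S.storages, S.extDist xs us χ ≤ η → ∀ j ≤ J,
      S.extDist xs us (S.closedLoop ustar N j χ) ≤ ε := by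
  induction J generalizing ε with
  | zero =>
    refine ⟨ε, hε, 0, fun N _ χ _ h j hj => ?_⟩
    obtain rfl : j = 0 := by omega
    exact h
  | succ J ih =>
    obtain ⟨η₁, hη₁, N₁, h1⟩ := A.exists_step_small hε
    obtain ⟨η₂, hη₂, N₂, h2⟩ := ih (lt_min hε hη₁)
    refine ⟨η₂, hη₂, max N₁ N₂ + 1, fun N hN χ hχ h j hj => ?_⟩
    have h3 := h2 N (by omega) χ hχ h
    rcases Nat.lt_or_ge j (J + 1) with hj' | hj'
    · exact (h3 j (by omega)).trans (min_le_left _ _)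
    · obtain rfl : j = J + 1 := by omega
      rw [closedLoop_succ]
      exact h1 N (by omega) _ (A.closedLoop_mem (by omega) hχ J)
        ((h3 J le_rfl).trans (min_le_right _ _))

/-- The function `Wfun` is a practical Lyapunov function for the closed loop. -/
theorem exists_lyapunov : ∃ α₁ α₂ α₃ : ℝ → ℝ, ∃ δ₁ δ₂ : ℕ → ℝ, ∃ M : ℝ,
    ClassKInf α₁ ∧ ClassKInf α₂ ∧ ClassKInf α₃ ∧ ClassLN δ₁ ∧ ClassLN δ₂ ∧
    ∀ N, 1 ≤ N → ∀ χ ∈ S.X ×ˢ S.storages,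
      α₁ (S.extDist xs us χ) ≤ S.Wfun xs us lam lbar ω (weight n m T L a ω) ustar N χ ∧
      S.Wfun xs us lam lbar ω (weight n m T L a ω) ustar N χ
        ≤ α₂ (S.extDist xs us χ) + δ₁ N ∧
      S.Wfun xs us lam lbar ω (weight n m T L a ω) ustar N (S.closedLoop ustar N 1 χ)
        ≤ S.Wfun xs us lam lbar ω (weight n m T L a ω) ustar N χ
          - α₃ (S.extDist xs us χ) + δ₂ N ∧
      S.Wfun xs us lam lbar ω (weight n m T L a ω) ustar N χ ≤ M := by
  have hT := A.two_le
  have hT0 : (0 : ℝ) < T := by exact_mod_cast A.one_le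
  obtain ⟨R, hR0, hR⟩ := A.exists_dist_le
  obtain ⟨M, hM0, hM⟩ := A.exists_What_le_bound
  have hlowWhat := fun (r : ℝ) (hr : 0 < r) => A.exists_le_What hr
  have hsmall := fun (ε : ℝ) (hε : 0 < ε) => A.exists_What_small hε
  have hdecrease := fun (ε : ℝ) (hε : 0 < ε) => A.exists_What_decrease hε
  have hnn₀ := fun (N : ℕ) (x : EuclideanSpace ℝ (Fin n)) (H : Storage p T)
    (hx : x ∈ S.X) (hH : H ∈ S.storages) => A.What_nonneg N hx hH
  generalize weight n m T L a ω = c at *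
  let ι := {q : ℕ × (EuclideanSpace ℝ (Fin n) × Storage p T) // 1 ≤ q.1 ∧ q.2 ∈ S.X ×ˢ S.storages}
  have hnn : ∀ N χ, χ ∈ S.X ×ˢ S.storages → 0 ≤ S.What xs us lam lbar ω c N χ :=
    fun N χ hχ => hnn₀ N χ.1 χ.2 hχ.1 hχ.2
  have hWle : ∀ N, 1 ≤ N → ∀ χ ∈ S.X ×ˢ S.storages, ∀ b,
      (∀ j ≤ T, S.What xs us lam lbar ω c N (S.closedLoop ustar N j χ) ≤ b) →
      S.Wfun xs us lam lbar ω c ustar N χ ≤ T * b := by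
    intro N hN χ hχ b h
    have h1 := Finset.sum_le_card_nsmul (Finset.range T)
      (fun j => S.What xs us lam lbar ω c N (S.closedLoop ustar N j χ)) b
      fun j hj => h j (Finset.mem_range.1 hj).le
    rw [Finset.card_range, nsmul_eq_mul] at h1
    rw [Wfun]
    exact h1
  have hWM : ∀ N, 1 ≤ N → ∀ χ ∈ S.X ×ˢ S.storages,
      S.Wfun xs us lam lbar ω c ustar N χ ≤ T * M := fun N hN χ hχ =>
    hWle N hN χ hχ M fun j _ => hM N _ (A.closedLoop_mem hN hχ j).1 _ (A.closedLoop_mem hN hχ j).2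
  have hWge : ∀ N, 1 ≤ N → ∀ χ ∈ S.X ×ˢ S.storages,
      S.What xs us lam lbar ω c N χ ≤ S.Wfun xs us lam lbar ω c ustar N χ := by
    intro N hN χ hχ
    have h1 := Finset.single_le_sum (s := Finset.range T)
      (f := fun j => S.What xs us lam lbar ω c N (S.closedLoop ustar N j χ))
      (fun j _ => hnn N _ (A.closedLoop_mem hN hχ j)) (Finset.mem_range.2 A.one_le)
    have h0 : S.closedLoop ustar N 0 χ = χ := rfl
    rw [h0] at h1
    rw [Wfun]
    exact h1
  have hRχ : ∀ χ ∈ S.X ×ˢ S.storages, S.extDist xs us χ ≤ R := fun χ hχ => hR _ hχ.1 _ hχ.2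
  have hlow : ∀ r > 0, ∃ b > 0, ∀ N, 1 ≤ N → ∀ χ ∈ S.X ×ˢ S.storages, r ≤ S.extDist xs us χ →
      b ≤ S.Wfun xs us lam lbar ω c ustar N χ := by
    intro r hr
    obtain ⟨b, hb, h⟩ := hlowWhat r hr
    refine ⟨b, hb, fun N hN χ hχ hrχ => ?_⟩
    exact (h N hN χ.1 hχ.1 χ.2 hχ.2 hrχ).trans (hWge N hN χ hχ)
  have hdecay : ∀ r > 0, ∃ b > 0, ∀ χ ∈ S.X ×ˢ S.storages, r ≤ S.extDist xs us χ →
      b ≤ S.decay xs us L psi a ω χ := by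
    intro r hr
    obtain ⟨b, hb, h⟩ := A.exists_le_decay hr
    exact ⟨b, hb, fun χ hχ hrχ => h χ.1 hχ.1 χ.2 hχ.2 hrχ⟩
  have hdecay0 : ∀ χ ∈ S.X ×ˢ S.storages, 0 ≤ S.decay xs us L psi a ω χ :=
    fun χ hχ => A.decay_nonneg hχ.1 hχ.2
  -- The upper bound involves later closed-loop states, whose smallness requires a long horizon;
  -- this is why `δ₁` appears.
  have hup : ∀ ε > 0, ∃ η > 0, ∃ N₀, ∀ N, 1 ≤ N → ∀ χ ∈ S.X ×ˢ S.storages,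
      S.extDist xs us χ ≤ η → N₀ ≤ N → S.Wfun xs us lam lbar ω c ustar N χ ≤ ε := by
    intro ε hε
    obtain ⟨η, hη, h1⟩ := hsmall (ε / T) (by positivity)
    obtain ⟨η', hη', N₀, h2⟩ := A.exists_closedLoop_small T hη
    refine ⟨η', hη', N₀, fun N hN χ hχ hχη hN₀ => ?_⟩
    have h3 := hWle N hN χ hχ (ε / T) fun j hj =>
      h1 N _ (A.closedLoop_mem hN hχ j).1 _ (A.closedLoop_mem hN hχ j).2 (h2 N hN₀ χ hχ hχη j hj)
    rwa [mul_div_cancel₀ _ hT0.ne'] at h3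
  obtain ⟨α₁, hα₁, H1⟩ := exists_classKInf_le
    (fun q : ι => S.extDist xs us q.1.2) (fun q : ι => S.Wfun xs us lam lbar ω c ustar q.1.1 q.1.2)
    R (fun q => hRχ q.1.2 q.2.2)
    (fun q => (hnn q.1.1 q.1.2 q.2.2).trans (hWge q.1.1 q.2.1 q.1.2 q.2.2)) (fun r hr => by
      obtain ⟨b, hb, h⟩ := hlow r hr
      exact ⟨b, hb, fun q hq => h q.1.1 q.2.1 q.1.2 q.2.2 hq⟩)
  obtain ⟨α₃, hα₃, H3⟩ := exists_classKInf_le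
    (fun q : {χ // χ ∈ S.X ×ˢ S.storages} => S.extDist xs us q.1)
    (fun q => S.decay xs us L psi a ω q.1)
    R (fun q => hRχ q.1 q.2) (fun q => hdecay0 q.1 q.2) (fun r hr => by
      obtain ⟨b, hb, h⟩ := hdecay r hr
      exact ⟨b, hb, fun q hq => h q.1 q.2 hq⟩)
  obtain ⟨α₂, δ₁, hα₂, hδ₁, H2⟩ := exists_classKInf_add_classLN_ge
    (fun q : ι => S.extDist xs us q.1.2) (fun q : ι => S.Wfun xs us lam lbar ω c ustar q.1.1 q.1.2)
    (fun q => q.1.1) (T * M) (fun q => extDist_nonneg _)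
    (fun q => hWM q.1.1 q.2.1 q.1.2 q.2.2) (fun ε hε => by
      obtain ⟨η, hη, N₀, h⟩ := hup ε hε
      exact ⟨η, hη, N₀, fun q hq1 hq2 => h q.1.1 q.2.1 q.1.2 q.2.2 hq1 hq2⟩)
  have hdiff : ∀ N χ, S.Wfun xs us lam lbar ω c ustar N (S.closedLoop ustar N 1 χ)
      - S.Wfun xs us lam lbar ω c ustar N χ
      = S.What xs us lam lbar ω c N (S.closedLoop ustar N T χ)
        - S.What xs us lam lbar ω c N χ := by
    intro N χ
    rw [Wfun_closedLoop_one]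
    ring
  -- The failure of the exact decrease is bounded for every `N ≥ 1` and small for large `N`, so it
  -- is absorbed by a sequence of class `L_ℕ` without excluding short horizons.
  obtain ⟨δ₂, hδ₂, H4⟩ := exists_classLN_ge
    (fun q : ι => S.What xs us lam lbar ω c q.1.1 (S.closedLoop ustar q.1.1 T q.1.2)
      - S.What xs us lam lbar ω c q.1.1 q.1.2 + α₃ (S.extDist xs us q.1.2))
    (fun q => q.1.1) (M + α₃ R) (fun q => by
      have hmem := A.closedLoop_mem q.2.1 q.2.2 T
      have h1 := hM q.1.1 _ hmem.1 _ hmem.2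
      have h2 := hnn q.1.1 q.1.2 q.2.2
      have h3 : α₃ (S.extDist xs us q.1.2) ≤ α₃ R :=
        hα₃.toClassK.mono (extDist_nonneg _) (hRχ q.1.2 q.2.2)
      rw [Prod.mk.eta] at h1
      linarith)
    (fun ε hε => by
      obtain ⟨N₀, h⟩ := hdecrease ε hε
      refine ⟨N₀, fun q hq => ?_⟩
      have h1 := h q.1.1 hq q.1.2 q.2.2
      have h2 := H3 ⟨q.1.2, q.2.2⟩
      dsimp only at h2 ⊢
      linarith)
  refine ⟨α₁, α₂, α₃, δ₁, δ₂, T * M, hα₁, hα₂, hα₃, hδ₁, hδ₂, fun N hN χ hχ =>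
    ⟨H1 ⟨(N, χ), hN, hχ⟩, H2 ⟨(N, χ), hN, hχ⟩, ?_, hWM N hN χ hχ⟩⟩
  have h1 := H4 ⟨(N, χ), hN, hχ⟩
  have h2 := hdiff N χ
  dsimp only at h1
  linarith

/-- Practical asymptotic stability of the closed loop. -/
theorem exists_practicallyStable : ∃ β : ℝ → ℝ → ℝ, ∃ ε : ℕ → ℝ, Tendsto ε atTop (𝓝 0) ∧
    ∀ N, 1 ≤ N → S.PracticallyStable xs us ustar N (S.X ×ˢ S.storages) β (ε N) := by
  obtain ⟨α₁, α₂, α₃, δ₁, δ₂, M, hα₁, hα₂, hα₃, hδ₁, hδ₂, hW⟩ := A.exists_lyapunov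
  obtain ⟨R, hR0, hR⟩ := A.exists_dist_le
  obtain ⟨C, hC0, hC⟩ := exists_matNorm2_le p (T - 1)
  let ι := {q : ℕ × (EuclideanSpace ℝ (Fin n) × Storage p T) // 1 ≤ q.1 ∧ q.2 ∈ S.X ×ˢ S.storages}
  let χ : ι → ℕ → EuclideanSpace ℝ (Fin n) × Storage p T :=
    fun q k => S.closedLoop ustar q.1.1 k q.1.2
  have hχ : ∀ q k, χ q k ∈ S.X ×ˢ S.storages := fun q k => A.closedLoop_mem q.2.1 q.2.2 k
  have hχ1 : ∀ q k, χ q (k + 1) = S.closedLoop ustar q.1.1 1 (χ q k) := fun q k => by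
    dsimp only [χ]
    rw [closedLoop_add, add_comm]
  let ξ : ι → ℕ → ℝ := fun q k => S.extDist xs us (χ q k)
  let ξ₂ : ι → ℕ → ℝ := fun q k =>
    ‖(χ q k).1 - xs‖ + matNorm2 ((χ q k).2 - S.steadyStorage xs us)
  let V : ι → ℕ → ℝ := fun q k => S.Wfun xs us lam lbar ω (weight n m T L a ω) ustar q.1.1 (χ q k)
  let ν : ι → ℕ := fun q => q.1.1
  have hξ : ∀ q k, 0 ≤ ξ q k := fun q k => extDist_nonneg _
  have hlow : ∀ q k, α₁ (ξ q k) ≤ V q k := fun q k => (hW _ q.2.1 _ (hχ q k)).1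
  have hup : ∀ q k, V q k ≤ α₂ (ξ q k) + δ₁ (ν q) := fun q k => (hW _ q.2.1 _ (hχ q k)).2.1
  have hdec : ∀ q k, V q (k + 1) ≤ V q k - α₃ (ξ q k) + δ₂ (ν q) := fun q k => by
    have := (hW _ q.2.1 _ (hχ q k)).2.2.1
    rwa [← hχ1] at this
  have hVM : ∀ q k, V q k ≤ M := fun q k => (hW _ q.2.1 _ (hχ q k)).2.2.2
  have h21 : ∀ q k, ξ₂ q k ≤ (C + 1) * ξ q k := fun q k => by
    have h1 := hC ((χ q k).2 - S.steadyStorage xs us)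
    have h2 : ξ q k = ‖(χ q k).1 - xs‖ + matNorm1 ((χ q k).2 - S.steadyStorage xs us) := rfl
    have h3 : ξ₂ q k = ‖(χ q k).1 - xs‖ + matNorm2 ((χ q k).2 - S.steadyStorage xs us) := rfl
    have h4 := mul_nonneg hC0 (norm_nonneg ((χ q k).1 - xs))
    have h5 := matNorm1_nonneg ((χ q k).2 - S.steadyStorage xs us)
    rw [h2, h3]
    linarith
  have h12 : ∀ q k, ξ q k ≤ (p + 1) * ξ₂ q k := fun q k => by
    have h1 := matNorm1_le_matNorm2 ((χ q k).2 - S.steadyStorage xs us)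
    have h2 : ξ q k = ‖(χ q k).1 - xs‖ + matNorm1 ((χ q k).2 - S.steadyStorage xs us) := rfl
    have h3 : ξ₂ q k = ‖(χ q k).1 - xs‖ + matNorm2 ((χ q k).2 - S.steadyStorage xs us) := rfl
    have h4 := mul_nonneg (Nat.cast_nonneg (α := ℝ) p) (norm_nonneg ((χ q k).1 - xs))
    have h5 := matNorm2_nonneg ((χ q k).2 - S.steadyStorage xs us)
    rw [h2, h3]
    linarith
  have hC1 : 0 < C + 1 := by linarith
  have hp1 : (0 : ℝ) < p + 1 := by positivity
  -- The Lyapunov estimates use the 1-norm of the storage, the stability claim the spectral norm;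
  -- the constants `C + 1` and `p + 1` translate between the two distances.
  obtain ⟨β, e, hβ, he0, he, hbound⟩ := exists_classKL ξ₂ ν ((C + 1) * R)
    (fun q k => add_nonneg (norm_nonneg _) (matNorm2_nonneg _))
    (fun q k => (h21 q k).trans
      (mul_le_mul_of_nonneg_left (hR _ (hχ q k).1 _ (hχ q k).2) hC1.le))
    (fun ε hε => by
      obtain ⟨η, hη, N₀, h⟩ := stable_of_lyapunov hα₁ hα₂ hα₃ hδ₁ hδ₂ hξ hlow hup hdec
        (div_pos hε hC1)
      refine ⟨η / (p + 1), div_pos hη hp1, N₀, fun q hq h0 k => (h21 q k).trans ?_⟩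
      rw [← le_div_iff₀' hC1]
      refine h q hq ((h12 q 0).trans ?_) k
      rwa [← le_div_iff₀' hp1])
    (fun ε hε => by
      obtain ⟨K, N₀, h⟩ := attractive_of_lyapunov hα₁ hα₂ hα₃ hδ₁ hδ₂ hξ hlow hup hdec hVM
        (div_pos hε hC1)
      refine ⟨K, N₀, fun q hq k hk => (h21 q k).trans ?_⟩
      rw [← le_div_iff₀' hC1]
      exact h q hq k hk)
  exact ⟨β, e, he, fun N hN => ⟨⟨A.xs_mem, A.steadyStorage_mem⟩, he0 N, hβ, fun χ₀ hχ₀ k =>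
    hbound ⟨(N, χ₀), hN, hχ₀⟩ k⟩⟩

end MPCSetting

end ControlProblem

theorem theorem4 {n m p T : ℕ} (hT : 2 ≤ T) (S : ControlProblem n m p T)
    (xs : EuclideanSpace ℝ (Fin n)) (us : EuclideanSpace ℝ (Fin m))
    (hs : S.IsOptimalSteadyState xs us)
    (ustar utilde :
      ℕ → EuclideanSpace ℝ (Fin n) → Storage p T → ℕ → EuclideanSpace ℝ (Fin m))
    (L : ℝ) (lam : EuclideanSpace ℝ (Fin n) → ℝ) (lbar : Fin p → ℝ)
    (rho psi : ℝ → ℝ) (a ω : ℝ)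
    (hustar : ∀ N, ∀ x ∈ S.X, ∀ H ∈ S.storages,
      S.IsMinimizer (S.cost N x) N x H (ustar N x H))
    (hutilde : ∀ N, ∀ x ∈ S.X, ∀ H ∈ S.storages,
      S.IsMinimizer (S.rotCost xs us lam lbar N x) N x H (utilde N x H))
    (h1 : S.Regular L)
    (h2 : S.StrictlyDissipative xs us lam lbar rho)
    (h3 : S.AsymptoticallyControllable xs us lam lbar)
    (h4 : S.LocallyControllable xs)
    (h5 : S.OutputBound xs us lbar utilde psi)
    (h6 : S.PolynomialBounds xs us L rho psi a ω) :
    ∃ N₆ : ℕ,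
      (∃ c : ℝ, 0 < c ∧ ∃ α₁ α₂ α₃ : ℝ → ℝ, ∃ δ₁ δ₂ : ℕ → ℝ,
        ClassKInf α₁ ∧ ClassKInf α₂ ∧ ClassKInf α₃ ∧ ClassLN δ₁ ∧ ClassLN δ₂ ∧
        ∀ N ≥ N₆ + 1, ∀ x ∈ S.X, ∀ H ∈ S.storages,
          α₁ (‖x - xs‖ + matNorm1 (H - S.steadyStorage xs us))
            ≤ S.Wfun xs us lam lbar ω c ustar N (x, H) ∧
          S.Wfun xs us lam lbar ω c ustar N (x, H)
            ≤ α₂ (‖x - xs‖ + matNorm1 (H - S.steadyStorage xs us)) + δ₁ (N - N₆) ∧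
          S.Wfun xs us lam lbar ω c ustar N (S.closedLoop ustar N 1 (x, H))
            ≤ S.Wfun xs us lam lbar ω c ustar N (x, H)
              - α₃ (‖x - xs‖ + matNorm1 (H - S.steadyStorage xs us)) + δ₂ (N - N₆)) ∧
      (∃ β : ℝ → ℝ → ℝ, ∃ ε : ℕ → ℝ, Tendsto ε atTop (𝓝 0) ∧
        ∀ N ≥ N₆ + 1,
          S.PracticallyStable xs us ustar N (S.X ×ˢ S.storages) β (ε N)) := by
  have A : S.MPCSetting xs us ustar utilde L lam lbar rho psi a ω :=
    ⟨hT, hs, hustar, hutilde, h1, h2, h3, h4, h5, h6⟩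
  obtain ⟨α₁, α₂, α₃, δ₁, δ₂, M, hα₁, hα₂, hα₃, hδ₁, hδ₂, hW⟩ := A.exists_lyapunov
  obtain ⟨β, ε, hε, hβ⟩ := A.exists_practicallyStable
  -- The value `N₆ = 0` suffices because the error sequences already cover all horizons `N ≥ 1`.
  refine ⟨0, ⟨ControlProblem.weight n m T L a ω, A.weight_pos, α₁, α₂, α₃, δ₁, δ₂,
    hα₁, hα₂, hα₃, hδ₁, hδ₂, fun N hN x hx H hH => ?_⟩, β, ε, hε, fun N hN => hβ N hN⟩
  obtain ⟨h7, h8, h9, -⟩ := hW N hN (x, H) ⟨hx, hH⟩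
  exact ⟨h7, h8, h9⟩
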